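/- Let $\mathbb T^2=(\mathbb R/2\pi\mathbb Z)^2$ and let $m(f)$ be the mean value of $f$ over $\mathbb T^2$. Let $\Phi\in C([-1,1])\cap C^\infty((-1,1))$, and suppose that $\phi=\Phi'$ satisfies $\phi(s)\to-\infty$ as $s\to-1^+$, $\phi(s)\to+\infty$ as $s\to1^-$, and, for some constants $\alpha,C_1,C_2,C_3>0$, $\phi'(s)\ge-\alpha$ and $|\phi'(s)|\le C_1e^{C_2|\phi(s)|}+C_3$ for all $s\in(-1,1)$. For $\varepsilon\in(0,1]$ put $$\varphi(f)=(\varepsilon+(-\Delta)^{-1})^{-1}\big[\Delta f-\phi(f)+m(\phi(f))\big],$$ where $(-\Delta)^{-1}$ acts on mean-zero distributions, and let $\mathbb D_{0,\varepsilon}$ be the set of $f\in H^2(\mathbb T^2)$ with $\|f\|_{L^\infty}\le1$, $m(f)=0$, $\phi(f)\in L^2$ (so $|f|<1$ almost everywhere), $\varepsilon^{1/2}\varphi(f)\in L^2$ and $\varphi(f)\in\dot H^{-1}$, with $$\|f\|_{\mathbb D_{0,\varepsilon}}^2=\|f\|_{H^2}^2+\|\phi(f)\|_{L^2}^2+\varepsilon\|\varphi(f)\|_{L^2}^2+\|\varphi(f)\|_{\dot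 H^{-1}}^2$$ and the topology induced by $f\mapsto(f,\phi(f),\varepsilon^{1/2}\varphi(f),\varphi(f))\in H^2\times L^2\times L^2\times\dot H^{-1}$. **Lemma.** For all $R,K\ge0$ and $0<T<\infty$ there is a constant $C=C(R,K,T)$, depending only on $R$, $K$, $T$ and $\Phi$ (in particular not on $\varepsilon$), with the following property. Let $\varepsilon\in(0,1]$; let $\theta_0\in\mathbb D_{0,\varepsilon}$ with $\|\theta_0\|_{\mathbb D_{0,\varepsilon}}\le R$ and $\|\theta_0\|_{L^\infty}\le1-\delta_0$ for some $\delta_0\in(0,1)$; let $u\in L^\infty(0,T;H^1(\mathbb T^2))\cap L^2(0,T;H^2(\mathbb T^2))$ be a vector field with $\partial_tu\in L^2(0,T;L^2(\mathbb T^2))$, $\operatorname{div}u=0$ and $$\|u\|_{L^\infty(0,T;H^1)}^2+\|u\|_{L^2(0,T;H^2)}^2+\|\partial_tu\|_{L^2(0,T;L^2)}^2\le K^2;$$ and let $\theta$ be a weak solution on $[0,T)$ of the $\varepsilon$-regularized convective Cahn–Hilliard equation $$\varepsilon\partial_t\theta+(-\Delta)^{-1}\big((u\cdot\nabla)\theta+\partial_t\theta\big)=\Delta\theta-\phi(\theta)+m(\phi(\theta)),\qquad\theta|_{t=0}=\theta_0,$$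 with $\|\theta\|_{L^\infty((0,T)\times\mathbb T^2)}\le1$, $\theta\in C([0,T);\mathbb D_{0,\varepsilon})$ and $\partial_t\theta\in L^2_{loc}([0,T);H^1(\mathbb T^2))$. Then, for every $t\in[0,T)$, $$\sup_{\tau\in[0,t]}\|\theta(\tau)\|_{\mathbb D_{0,\varepsilon}}^2+\int_0^t\|\partial_t\theta(\tau)\|_{H^1(\mathbb T^2)}^2\,d\tau\le C(R,K,T),$$ and, for almost every $t\in(0,T)$, $$\varepsilon\|\partial_t\theta(t)\|_{L^2}^2+\|\partial_t\theta(t)\|_{\dot H^{-1}}^2\le C(R,K,T).$$ -/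

import Mathlib

open MeasureTheory Set Filter Topology
open scoped NNReal ENNReal

noncomputable section

instance instFactTwoPiPos : Fact (0 < 2 * Real.pi) := ⟨Real.two_pi_pos⟩

/-- The flat torus `(ℝ / 2πℤ)²`, with Lebesgue measure of total mass `(2π)²`. -/
abbrev Torus2 : Type := Fin 2 → AddCircle (2 * Real.pi)

/-- Real `L²(𝕋²)`. -/
abbrev L2Torus : Type := Lp ℝ 2 (volume : Measure Torus2)

/-- Integer frequencies. A periodic distribution is represented by its Fourier coefficients,
a function `Freq → ℂ`. -/
abbrev Freq : Type := Fin 2 → ℤ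

/-- `|n|²`. -/
def freqSq (n : Freq) : ℝ := ∑ j, (n j : ℝ) ^ 2

/-- Fourier coefficients `ĝ(n) = (2π)⁻² ∫ g(x) e^{-i n·x} dx` of a real function on the torus. -/
def fourierCoeffs (g : Torus2 → ℝ) (n : Freq) : ℂ :=
  ⨍ x, (∏ j, fourier (-(n j)) (x j)) * (g x : ℂ)

/-- `‖c‖²_{H^s} = (2π)² ∑ₙ (1 + |n|²)^s |c(n)|²`, possibly infinite; for `s = 0` this is the square
of the `L²` norm, by Parseval. -/
def sobolevNormSq (s : ℝ) (c : Freq → ℂ) : ℝ≥0∞ :=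
  ∑' n, ENNReal.ofReal ((2 * Real.pi) ^ 2 * (1 + freqSq n) ^ s * ‖c n‖ ^ 2)

/-- `‖c‖²_{Ḣ^s} = (2π)² ∑_{n ≠ 0} |n|^{2s} |c(n)|²`, possibly infinite. -/
def homSobolevNormSq (s : ℝ) (c : Freq → ℂ) : ℝ≥0∞ :=
  ∑' n, if n = 0 then 0 else
    ENNReal.ofReal ((2 * Real.pi) ^ 2 * freqSq n ^ s * ‖c n‖ ^ 2)

/-- The Laplacian on Fourier coefficients. -/
def laplacianF (c : Freq → ℂ) (n : Freq) : ℂ := -(freqSq n : ℂ) * c n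

/-- The inverse `(-Δ)⁻¹` of minus the Laplacian on mean-zero distributions. -/
def invNegLaplacianF (c : Freq → ℂ) (n : Freq) : ℂ :=
  if n = 0 then 0 else c n / (freqSq n : ℂ)

/-- The operator `(ε + (-Δ)⁻¹)⁻¹` on mean-zero distributions. -/
def resolventF (ε : ℝ) (c : Freq → ℂ) (n : Freq) : ℂ :=
  if n = 0 then 0 else c n / ((ε : ℂ) + 1 / (freqSq n : ℂ))

/-- `g = ∂_j f` in the weak sense: integration by parts against every `e^{-i n·x}`. -/
def IsWeakPartial (j : Fin 2) (f g : L2Torus) : Prop :=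
  ∀ n : Freq, fourierCoeffs g n = Complex.I * (n j : ℂ) * fourierCoeffs f n

/-- The standing assumption on the free energy density `Φ` on `[a, b] = [-1, 1]`, with `φ = Φ'`.
Only the values of `Φ` on `[-1, 1]` matter. -/
structure IsSingularPotential (Φ : ℝ → ℝ) : Prop where
  cont : ContinuousOn Φ (Icc (-1) 1)
  smooth : ContDiffOn ℝ ((⊤ : ℕ∞) : WithTop ℕ∞) Φ (Ioo (-1) 1)
  tendsto_left : Tendsto (deriv Φ) (𝓝[>] (-1)) atBot
  tendsto_right : Tendsto (deriv Φ) (𝓝[<] 1) atTop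
  deriv_bounds : ∃ α C₁ C₂ C₃ : ℝ, 0 < α ∧ 0 < C₁ ∧ 0 < C₂ ∧ 0 < C₃ ∧
    ∀ s ∈ Ioo (-1 : ℝ) 1, -α ≤ deriv (deriv Φ) s ∧
      |deriv (deriv Φ) s| ≤ C₁ * Real.exp (C₂ * |deriv Φ s|) + C₃

/-- `Δf - φ(f) + m(φ(f))`, where `m` is the mean value over the torus. -/
def drivingTerm (φ : ℝ → ℝ) (f : L2Torus) : Freq → ℂ :=
  laplacianF (fourierCoeffs f) - fourierCoeffs (fun x => φ (f x))
    + fourierCoeffs (fun _ => ⨍ x, φ (f x))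

/-- `ϕ(f) = (ε + (-Δ)⁻¹)⁻¹ [Δf - φ(f) + m(φ(f))]`. -/
def phaseVelocity (ε : ℝ) (φ : ℝ → ℝ) (f : L2Torus) : Freq → ℂ :=
  resolventF ε (drivingTerm φ f)

/-- `‖f‖²_{𝔻_{0,ε}} = ‖f‖²_{H²} + ‖φ(f)‖²_{L²} + ε ‖ϕ(f)‖²_{L²} + ‖ϕ(f)‖²_{Ḣ⁻¹}`. -/
def phaseNormSq (ε : ℝ) (φ : ℝ → ℝ) (f : L2Torus) : ℝ≥0∞ :=
  sobolevNormSq 2 (fourierCoeffs f)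
    + eLpNorm (fun x => φ (f x)) 2 volume ^ 2
    + ENNReal.ofReal ε * sobolevNormSq 0 (phaseVelocity ε φ f)
    + homSobolevNormSq (-1) (phaseVelocity ε φ f)

/-- The phase space `𝔻_{0,ε}`. As `φ` blows up at `±1`, the requirements `‖f‖_{L^∞} ≤ 1` and
`φ(f) ∈ L²` contain `-1 < f < 1` almost everywhere. -/
structure MemPhaseSpace (ε : ℝ) (φ : ℝ → ℝ) (f : L2Torus) : Prop where
  memH2 : sobolevNormSq 2 (fourierCoeffs f) < ⊤
  range : ∀ᵐ x, f x ∈ Ioo (-1 : ℝ) 1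
  mean_zero : ⨍ x, f x = 0
  memLp_phi : MemLp (fun x => φ (f x)) 2 volume
  phaseVelocity_L2 : ENNReal.ofReal ε * sobolevNormSq 0 (phaseVelocity ε φ f) < ⊤
  phaseVelocity_Hm1 : homSobolevNormSq (-1) (phaseVelocity ε φ f) < ⊤

/-- The squared distance on `𝔻_{0,ε}` induced by
`f ↦ (f, φ(f), ε^{1/2} ϕ(f), ϕ(f)) ∈ H² × L² × L² × Ḣ⁻¹`. -/
def phaseDistSq (ε : ℝ) (φ : ℝ → ℝ) (f g : L2Torus) : ℝ≥0∞ :=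
  sobolevNormSq 2 (fourierCoeffs f - fourierCoeffs g)
    + eLpNorm (fun x => φ (f x) - φ (g x)) 2 volume ^ 2
    + ENNReal.ofReal ε * sobolevNormSq 0 (phaseVelocity ε φ f - phaseVelocity ε φ g)
    + homSobolevNormSq (-1) (phaseVelocity ε φ f - phaseVelocity ε φ g)

/-- `θ ∈ C([0,T); 𝔻_{0,ε})`. -/
def ContinuousIntoPhaseSpace (ε : ℝ) (φ : ℝ → ℝ) (T : ℝ) (θ : ℝ → L2Torus) : Prop :=
  ∀ t ∈ Ico 0 T, MemPhaseSpace ε φ (θ t) ∧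
    Tendsto (fun s => phaseDistSq ε φ (θ s) (θ t)) (𝓝[Ico 0 T] t) (𝓝 0)

/-- `f' = ∂_t f` weakly on the interval `J`, where `f` is the continuous representative:
`f(t) - f(s) = ∫_s^t f'` with a (locally) Bochner integrable `f' : J → L²(𝕋²)`. -/
def IsTimeDerivOn (J : Set ℝ) (f f' : ℝ → L2Torus) : Prop :=
  ∀ s ∈ J, ∀ t ∈ J, IntervalIntegrable f' volume s t ∧ f t - f s = ∫ τ in s..t, f' τ

/-- `‖u‖²_{L^∞(0,T;H¹)} + ‖u‖²_{L²(0,T;H²)} + ‖∂_t u‖²_{L²(0,T;L²)}`, with `u' = ∂_t u`. -/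
def velocityNormSq (T : ℝ) (u u' : Fin 2 → ℝ → L2Torus) : ℝ≥0∞ :=
  essSup (fun t => ∑ j, sobolevNormSq 1 (fourierCoeffs (u j t))) (volume.restrict (Ioo 0 T))
    + (∫⁻ t in Ioo 0 T, ∑ j, sobolevNormSq 2 (fourierCoeffs (u j t)))
    + ∫⁻ t in Ioo 0 T, ∑ j, sobolevNormSq 0 (fourierCoeffs (u' j t))

/-- `div u = 0` weakly, at almost every time in `(0,T)`. -/
def IsDivFree (T : ℝ) (u : Fin 2 → ℝ → L2Torus) : Prop :=
  ∀ᵐ t ∂volume.restrict (Ioo 0 T), ∀ n : Freq,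
    ∑ j, Complex.I * (n j : ℂ) * fourierCoeffs (u j t) n = 0

/-- `θ`, with time derivative `θ'`, is a weak solution on `[0,T)` of
`ε ∂_t θ + (-Δ)⁻¹ ((u·∇)θ + ∂_t θ) = Δθ - φ(θ) + m(φ(θ))`, `θ(0) = θ₀`:
at almost every time the equation holds in the sense of periodic distributions. -/
structure IsWeakSolution (ε : ℝ) (φ : ℝ → ℝ) (T : ℝ) (u : Fin 2 → ℝ → L2Torus)
    (θ₀ : L2Torus) (θ θ' : ℝ → L2Torus) : Prop where
  initial : θ 0 = θ₀
  timeDeriv : IsTimeDerivOn (Ico 0 T) θ θ'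
  equation : ∀ᵐ t ∂volume.restrict (Ioo 0 T), ∃ G : Fin 2 → L2Torus,
    (∀ j, IsWeakPartial j (θ t) (G j)) ∧
    (ε : ℂ) • fourierCoeffs (θ' t)
        + invNegLaplacianF
            (fourierCoeffs (fun x => ∑ j, u j t x * G j x) + fourierCoeffs (θ' t))
      = drivingTerm φ (θ t)

end

/-! The estimate comes from differentiating the equation in time and testing with `∂_t θ`. As `∂_t
θ` has no time derivative at hand, this is done on increments `V(t) = θ(t+h) - θ(t)`. Subtract the
equations at `t+h` and `t` and test with `V`: the energy is `y = ε‖V‖²_{L²} + ‖V‖²_{Ḣ⁻¹}` and the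
Laplacian gives the dissipation. The potential costs at most a multiple of `α‖V‖²_{L²}`, because
`φ(s) + αs` is increasing, and this is interpolated between `H¹` and `Ḣ⁻¹`. Since `div u = 0`, the
transport term is `div(uθ)`, and the increment of `uθ` is `(u(t+h) - u(t)) θ(t+h) + u(t) V`. The
first product is controlled by `|θ| ≤ 1`, the second by `H² ⊂ L^∞` applied to `u`. So `y' +
½‖V‖²_{H¹} ≤ k y + g`, with `k` affine in `‖u‖²_{H²}` and `∫ g ≤ h² ∫ ‖∂_t u‖²`
(`SolvesAt.energy_inequality`, `increment_estimate`).

Initially `y(0) = O(h²)`: `∂_t θ` differs from the phase velocity by a transport term of size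
`‖u‖_{L²}`, and for small times the phase velocity is close to that of `θ₀`, by continuity into the
phase space (`initial_increment_le`). Grönwall then gives `y ≤ C h²` with `C` independent of `ε` and
`h`. Dividing by `h²` and letting `h → 0` bounds `∂_t θ`, with lower semicontinuity and Fatou for
the `H¹` dissipation (`energy_bounds_of_increment`).

The phase norm is recovered at each time. The bound on `∂_t θ` bounds the phase velocity at almost
every time, hence at every time by continuity (`phaseVelocity_energy_le`), and the phase velocity
controls the rest by elliptic regularity (`IsSingularPotential.exists_phaseNormSq_le`). There one
tests `Δf - φ(f) + m(φ(f))` with `Δf`, and the sign of `∫ ∇φ(f)·∇f` up to `α‖∇f‖²` is read off from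
translations, so no chain rule for the singular `φ` is needed (`tsum_freqSq_semimonotone`). -/

/-! ### Characters and the volume of the torus. -/

/-- The character `x ↦ e^{i n·x}` of the torus. -/
noncomputable def torusChar (n : Freq) : C(Torus2, ℂ) where
  toFun x := ∏ j, fourier (n j) (x j)
  continuous_toFun := by fun_prop

lemma torusChar_apply (n : Freq) (x : Torus2) : torusChar n x = ∏ j, fourier (n j) (x j) := rfl

lemma torusChar_neg (n : Freq) (x : Torus2) :
    torusChar (-n) x = (starRingEnd ℂ) (torusChar n x) := by
  simp only [torusChar_apply, Pi.neg_apply, fourier_neg, map_prod]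

lemma torusChar_add (m n : Freq) (x : Torus2) :
    torusChar (m + n) x = torusChar m x * torusChar n x := by
  simp only [torusChar_apply, Pi.add_apply, fourier_add, ← Finset.prod_mul_distrib]

lemma torusChar_zero (x : Torus2) : torusChar 0 x = 1 := by
  simp [torusChar_apply]

lemma norm_torusChar (n : Freq) (x : Torus2) : ‖torusChar n x‖ = 1 := by
  simp only [torusChar_apply, fourier_apply, norm_prod, Circle.norm_coe, Finset.prod_const_one]

lemma torusChar_map_add (n : Freq) (x y : Torus2) :
    torusChar n (x + y) = torusChar n x * torusChar n y := by
  simp only [torusChar_apply, Pi.add_apply, fourier_apply, ← Finset.prod_mul_distrib, smul_add,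
    AddCircle.toCircle_add, Circle.coe_mul]

lemma integral_fourier_of_ne {k : ℤ} (hk : k ≠ 0) :
    ∫ x : AddCircle (2 * Real.pi), fourier k x = 0 := by
  have h := orthonormal_iff_ite.mp (orthonormal_fourier (T := 2 * Real.pi)) 0 k
  rw [if_neg (Ne.symm hk)] at h
  simp only [ContinuousMap.inner_toLp] at h
  rw [AddCircle.volume_eq_smul_haarAddCircle, integral_smul_measure]
  simp only [fourier_zero, map_one, mul_one] at h
  rw [h, smul_zero]

lemma integral_torusChar_of_ne {n : Freq} (hn : n ≠ 0) : ∫ x, torusChar n x = 0 := by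
  simp only [torusChar_apply]
  rw [integral_fintype_prod_volume_eq_prod (fun j (y : AddCircle (2 * Real.pi)) => fourier (n j) y)]
  obtain ⟨i, hi⟩ := Function.ne_iff.mp hn
  exact Finset.prod_eq_zero (Finset.mem_univ i) (integral_fourier_of_ne hi)

lemma torus_volume_univ : (volume : Measure Torus2) univ = ENNReal.ofReal ((2 * Real.pi) ^ 2) := by
  rw [volume_pi, Measure.pi_univ]
  simp [AddCircle.measure_univ, ENNReal.ofReal_pow Real.two_pi_pos.le]

lemma torus_volume_real_univ : (volume : Measure Torus2).real univ = (2 * Real.pi) ^ 2 := by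
  rw [measureReal_def, torus_volume_univ, ENNReal.toReal_ofReal (by positivity)]

lemma torus_average {E : Type*} [NormedAddCommGroup E] [NormedSpace ℝ E] (f : Torus2 → E) :
    ⨍ x, f x = ((2 * Real.pi) ^ 2)⁻¹ • ∫ x, f x := by
  rw [average_eq, torus_volume_real_univ]

/-! ### Completeness of the characters in `L²`. -/

section basis

lemma torusChar_mul_apply (m n : Freq) : torusChar m * torusChar n = torusChar (m + n) := by
  ext x; simp [torusChar_add]

/-- Products of characters are characters, so no new elements arise from multiplication. -/
lemma adjoin_torusChar_eq_span :
    Subalgebra.toSubmodule (Algebra.adjoin ℂ (range torusChar))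
      = Submodule.span ℂ (range torusChar) := by
  apply Algebra.adjoin_eq_span_of_subset
  refine .trans (fun x => Submonoid.closure_induction (fun _ => id) ⟨0, ?_⟩ ?_)
    Submodule.subset_span
  · ext z
    simp [torusChar_zero]
  · rintro _ _ _ _ ⟨m, rfl⟩ ⟨n, rfl⟩
    exact ⟨m + n, (torusChar_mul_apply m n).symm⟩

/-- The star subalgebra generated by the characters. -/
noncomputable def torusCharSubalgebra : StarSubalgebra ℂ C(Torus2, ℂ) where
  toSubalgebra := Algebra.adjoin ℂ (range torusChar)
  star_mem' := by
    change Algebra.adjoin ℂ (range torusChar) ≤ star (Algebra.adjoin ℂ (range torusChar))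
    refine Algebra.adjoin_le ?_
    rintro _ ⟨n, rfl⟩
    refine Algebra.subset_adjoin ⟨-n, ?_⟩
    ext1 x
    simp only [torusChar_neg, starRingEnd_apply, ContinuousMap.star_apply]

/-- If two points differ in coordinate `i`, the character of frequency `e_i` distinguishes them,
since the circle map is injective on one period. -/
lemma torusCharSubalgebra_separatesPoints : torusCharSubalgebra.SeparatesPoints := by
  intro x y hxy
  rw [Ne, funext_iff, not_forall] at hxy
  obtain ⟨i, hi⟩ := hxy
  refine ⟨_, ⟨torusChar (Pi.single i 1), Algebra.subset_adjoin ⟨Pi.single i 1, rfl⟩, rfl⟩, ?_⟩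
  have key : ∀ z : Torus2, torusChar (Pi.single i 1) z = fourier 1 (z i) := by
    intro z
    rw [torusChar_apply, Finset.prod_eq_single i]
    · simp
    · intro j _ hj
      simp [hj]
    · simp
  dsimp only
  rw [key, key, fourier_one, fourier_one]
  exact fun h => hi (AddCircle.injective_toCircle Real.two_pi_pos.ne' (Circle.ext h))

/-- Stone–Weierstrass. -/
lemma span_torusChar_closure_eq_top :
    (Submodule.span ℂ (range torusChar)).topologicalClosure = ⊤ := by
  rw [← adjoin_torusChar_eq_span]
  exact congr_arg (Subalgebra.toSubmodule <| StarSubalgebra.toSubalgebra ·)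
    (ContinuousMap.starSubalgebra_topologicalClosure_eq_top_of_separatesPoints _
      torusCharSubalgebra_separatesPoints)

/-- The normalized characters in `L²`. -/
noncomputable def torusCharLp (n : Freq) : Lp ℂ 2 (volume : Measure Torus2) :=
  ((2 * Real.pi)⁻¹ : ℂ) • ContinuousMap.toLp (E := ℂ) 2 volume ℂ (torusChar n)

lemma coeFn_torusCharLp (n : Freq) :
    torusCharLp n =ᵐ[volume] fun x => ((2 * Real.pi)⁻¹ : ℂ) * torusChar n x := by
  filter_upwards [Lp.coeFn_smul ((2 * Real.pi)⁻¹ : ℂ)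
    (ContinuousMap.toLp (E := ℂ) 2 volume ℂ (torusChar n)),
    ContinuousMap.coeFn_toLp (p := 2) (𝕜 := ℂ) (volume : Measure Torus2) (torusChar n)] with x h1 h2
  rw [torusCharLp, h1, Pi.smul_apply, h2, smul_eq_mul]

lemma inner_torusCharLp (n : Freq) (f : Lp ℂ 2 (volume : Measure Torus2)) :
    inner ℂ (torusCharLp n) f = ((2 * Real.pi)⁻¹ : ℂ) * ∫ x, torusChar (-n) x * f x := by
  rw [L2.inner_def, ← integral_const_mul]
  refine integral_congr_ae ?_
  filter_upwards [coeFn_torusCharLp n] with x hx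
  rw [hx, RCLike.inner_apply, torusChar_neg, map_mul, map_inv₀, map_mul, Complex.conj_ofReal,
    map_ofNat]
  ring

lemma orthonormal_torusCharLp : Orthonormal ℂ torusCharLp := by
  rw [orthonormal_iff_ite]
  intro m n
  rw [inner_torusCharLp]
  have h : ∫ x, torusChar (-m) x * torusCharLp n x
      = ((2 * Real.pi)⁻¹ : ℂ) * ∫ x, torusChar (n - m) x := by
    rw [← integral_const_mul]
    refine integral_congr_ae ?_
    filter_upwards [coeFn_torusCharLp n] with x hx
    rw [hx, sub_eq_add_neg, torusChar_add]
    ring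
  rw [h]
  split_ifs with hmn
  · subst hmn
    have h1 : ∀ x, torusChar (m - m) x = 1 := by simp [torusChar_zero]
    simp only [h1, integral_const, torus_volume_real_univ]
    have : (Real.pi : ℂ) ≠ 0 := by exact_mod_cast Real.pi_ne_zero
    simp
    field_simp
  · rw [integral_torusChar_of_ne (sub_ne_zero.mpr (Ne.symm hmn))]
    simp

/-- Uniform density passes to `L²` because continuous functions are dense there; the normalizing
constant does not change the span. -/
lemma span_torusCharLp_dense :
    ⊤ ≤ (Submodule.span ℂ (range torusCharLp)).topologicalClosure := by
  have h0 : (Submodule.span ℂ (range fun n =>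
      ContinuousMap.toLp (E := ℂ) 2 (volume : Measure Torus2) ℂ (torusChar n))).topologicalClosure
      = ⊤ := by
    simpa only [Submodule.map_span, ContinuousLinearMap.coe_coe, ← range_comp, Function.comp_def]
      using (ContinuousMap.toLp_denseRange ℂ (volume : Measure Torus2) ℂ
        (by simp : (2 : ℝ≥0∞) ≠ ∞)).topologicalClosure_map_submodule
        span_torusChar_closure_eq_top
  rw [← h0]
  refine Submodule.topologicalClosure_mono (Submodule.span_le.mpr ?_)
  rintro _ ⟨n, rfl⟩
  have : ContinuousMap.toLp (E := ℂ) 2 (volume : Measure Torus2) ℂ (torusChar n)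
      = (2 * Real.pi : ℂ) • torusCharLp n := by
    rw [torusCharLp, smul_smul, mul_inv_cancel₀, one_smul]
    exact_mod_cast Real.two_pi_pos.ne'
  simp only [this]
  exact Submodule.smul_mem _ _ (Submodule.subset_span ⟨n, rfl⟩)

/-- The Fourier basis of complex `L²(𝕋²)`. -/
noncomputable def torusBasis : HilbertBasis Freq ℂ (Lp ℂ 2 (volume : Measure Torus2)) :=
  HilbertBasis.mk orthonormal_torusCharLp span_torusCharLp_dense

lemma coe_torusBasis : ⇑torusBasis = torusCharLp := HilbertBasis.coe_mk _ _

end basis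

/-! ### Calculus of Fourier coefficients: Parseval, products, translations, advection. -/

/-- Fourier coefficients of a complex function. -/
noncomputable def fourierCoeffsC (g : Torus2 → ℂ) (n : Freq) : ℂ := ⨍ x, torusChar (-n) x * g x

lemma fourierCoeffs_eq (g : Torus2 → ℝ) (n : Freq) :
    fourierCoeffs g n = fourierCoeffsC (fun x => (g x : ℂ)) n := rfl

lemma fourierCoeffsC_congr {f g : Torus2 → ℂ} (h : f =ᵐ[volume] g) :
    fourierCoeffsC f = fourierCoeffsC g := by
  ext n
  simp only [fourierCoeffsC, torus_average]
  congr 1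
  refine integral_congr_ae ?_
  filter_upwards [h] with x hx
  rw [hx]

lemma inner_torusCharLp_toLp (n : Freq) {f : Torus2 → ℂ} (hf : MemLp f 2 volume) :
    inner ℂ (torusCharLp n) (hf.toLp f) = (2 * Real.pi : ℂ) * fourierCoeffsC f n := by
  rw [inner_torusCharLp, fourierCoeffsC, torus_average]
  have h : ∫ x, torusChar (-n) x * hf.toLp f x = ∫ x, torusChar (-n) x * f x := by
    refine integral_congr_ae ?_
    filter_upwards [hf.coeFn_toLp] with x hx
    rw [hx]
  rw [h]
  have : (Real.pi : ℂ) ≠ 0 := by exact_mod_cast Real.pi_ne_zero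
  rw [Complex.real_smul]
  push_cast
  field_simp

/-- Parseval's identity. -/
lemma hasSum_fourierCoeffsC {f g : Torus2 → ℂ} (hf : MemLp f 2 volume) (hg : MemLp g 2 volume) :
    HasSum (fun n => (starRingEnd ℂ) (fourierCoeffsC f n) * fourierCoeffsC g n)
      (⨍ x, (starRingEnd ℂ) (f x) * g x) := by
  have h := torusBasis.hasSum_inner_mul_inner (hf.toLp f) (hg.toLp g)
  simp only [coe_torusBasis] at h
  have h2 := h.mul_left ((((2 * Real.pi) ^ 2)⁻¹ : ℝ) : ℂ)
  have hpi : (Real.pi : ℂ) ≠ 0 := by exact_mod_cast Real.pi_ne_zero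
  have e1 : (fun n => (starRingEnd ℂ) (fourierCoeffsC f n) * fourierCoeffsC g n)
      = fun n => ((((2 * Real.pi) ^ 2)⁻¹ : ℝ) : ℂ) * (inner ℂ (hf.toLp f) (torusCharLp n)
        * inner ℂ (torusCharLp n) (hg.toLp g)) := by
    ext n
    rw [← inner_conj_symm (hf.toLp f), inner_torusCharLp_toLp n hf, inner_torusCharLp_toLp n hg,
      map_mul, map_mul, Complex.conj_ofReal, map_ofNat]
    push_cast
    field_simp
  have e2 : (⨍ x, (starRingEnd ℂ) (f x) * g x)
      = ((((2 * Real.pi) ^ 2)⁻¹ : ℝ) : ℂ) * inner ℂ (hf.toLp f) (hg.toLp g) := by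
    rw [torus_average, L2.inner_def, Complex.real_smul]
    congr 1
    refine integral_congr_ae ?_
    filter_upwards [hf.coeFn_toLp, hg.coeFn_toLp] with x h1 h2
    rw [h1, h2, RCLike.inner_apply, mul_comm]
  rw [e1, e2]
  exact h2

lemma hasSum_fourierCoeffs {f g : Torus2 → ℝ} (hf : MemLp f 2 volume) (hg : MemLp g 2 volume) :
    HasSum (fun n => ((starRingEnd ℂ) (fourierCoeffs f n) * fourierCoeffs g n).re)
      (⨍ x, f x * g x) := by
  have h := Complex.hasSum_re (hasSum_fourierCoeffsC hf.ofReal hg.ofReal)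
  have e : (⨍ x, f x * g x) = (⨍ x, (starRingEnd ℂ) ((f x : ℝ) : ℂ) * ((g x : ℝ) : ℂ)).re := by
    have e0 : (∫ x, (starRingEnd ℂ) ((f x : ℝ) : ℂ) * ((g x : ℝ) : ℂ))
        = ((∫ x, f x * g x : ℝ) : ℂ) := by
      rw [← integral_complex_ofReal]
      simp
    rw [torus_average, torus_average, Complex.real_smul, Complex.re_ofReal_mul, smul_eq_mul, e0,
      Complex.ofReal_re]
  rw [e]
  exact h

lemma hasSum_sq_fourierCoeffs {f : Torus2 → ℝ} (hf : MemLp f 2 volume) :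
    HasSum (fun n => ‖fourierCoeffs f n‖ ^ 2) (⨍ x, f x ^ 2) := by
  have h := hasSum_fourierCoeffs hf hf
  convert! h using 1
  · ext n
    rw [Complex.conj_mul', ← Complex.ofReal_pow, Complex.ofReal_re]
  · simp only [sq]

lemma fourierCoeffs_congr {f g : Torus2 → ℝ} (h : f =ᵐ[volume] g) :
    fourierCoeffs f = fourierCoeffs g := by
  ext n
  rw [fourierCoeffs_eq, fourierCoeffs_eq]
  exact congrFun (fourierCoeffsC_congr (h.mono fun x hx => by simp [hx])) n

lemma integrable_torusChar_mul {f : Torus2 → ℂ} (hf : Integrable f) (n : Freq) :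
    Integrable (fun x => torusChar n x * f x) :=
  hf.bdd_mul (c := 1) (torusChar n).continuous.aestronglyMeasurable
    (Eventually.of_forall fun x => (norm_torusChar n x).le)

lemma fourierCoeffs_add {f g : Torus2 → ℝ} (hf : Integrable f) (hg : Integrable g) :
    fourierCoeffs (fun x => f x + g x) = fourierCoeffs f + fourierCoeffs g := by
  ext n
  simp only [fourierCoeffs_eq, fourierCoeffsC, torus_average, Pi.add_apply, ← smul_add]
  have hf' : Integrable (fun x => (f x : ℂ)) := hf.ofReal
  have hg' : Integrable (fun x => (g x : ℂ)) := hg.ofReal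
  rw [← integral_add (integrable_torusChar_mul hf' _) (integrable_torusChar_mul hg' _)]
  simp only [Complex.ofReal_add, mul_add]

lemma fourierCoeffs_smul (r : ℝ) (f : Torus2 → ℝ) :
    fourierCoeffs (fun x => r * f x) = (r : ℂ) • fourierCoeffs f := by
  ext n
  simp only [fourierCoeffs_eq, fourierCoeffsC, torus_average, Pi.smul_apply]
  rw [smul_comm, smul_eq_mul (r : ℂ), ← integral_const_mul]
  congr 2
  ext x
  push_cast
  ring

lemma fourierCoeffs_sub {f g : Torus2 → ℝ} (hf : Integrable f) (hg : Integrable g) :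
    fourierCoeffs (fun x => f x - g x) = fourierCoeffs f - fourierCoeffs g := by
  have h := fourierCoeffs_add hf (g := fun x => (-1) * g x) (hg.const_mul (-1))
  rw [fourierCoeffs_smul] at h
  simp only [neg_one_mul, ← sub_eq_add_neg] at h
  rw [h]
  simp [sub_eq_add_neg]

lemma memLp_L2Torus (f : L2Torus) : MemLp f 2 volume := Lp.memLp f

lemma MeasureTheory.MemLp.integrable_torus {f : Torus2 → ℝ} (hf : MemLp f 2 volume) :
    Integrable f := hf.integrable (by norm_num)

lemma fourierCoeffs_Lp_add (f g : L2Torus) :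
    fourierCoeffs (f + g : L2Torus) = fourierCoeffs f + fourierCoeffs g := by
  rw [← fourierCoeffs_add (memLp_L2Torus f).integrable_torus (memLp_L2Torus g).integrable_torus]
  exact fourierCoeffs_congr (Lp.coeFn_add f g)

lemma fourierCoeffs_Lp_sub (f g : L2Torus) :
    fourierCoeffs (f - g : L2Torus) = fourierCoeffs f - fourierCoeffs g := by
  rw [← fourierCoeffs_sub (memLp_L2Torus f).integrable_torus (memLp_L2Torus g).integrable_torus]
  exact fourierCoeffs_congr (Lp.coeFn_sub f g)

lemma fourierCoeffs_Lp_smul (r : ℝ) (f : L2Torus) :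
    fourierCoeffs (r • f : L2Torus) = (r : ℂ) • fourierCoeffs f := by
  rw [← fourierCoeffs_smul]
  exact fourierCoeffs_congr (Lp.coeFn_smul r f)

lemma norm_sq_L2Torus (f : L2Torus) : ‖f‖ ^ 2 = ∫ x, f x ^ 2 := by
  rw [← real_inner_self_eq_norm_sq, L2.inner_def]
  simp [sq]

lemma hasSum_norm_sq_L2Torus (f : L2Torus) :
    HasSum (fun n => (2 * Real.pi) ^ 2 * ‖fourierCoeffs f n‖ ^ 2) (‖f‖ ^ 2) := by
  have h := (hasSum_sq_fourierCoeffs (memLp_L2Torus f)).mul_left ((2 * Real.pi) ^ 2)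
  rw [torus_average, smul_eq_mul, ← norm_sq_L2Torus] at h
  convert! h using 1
  have := Real.pi_ne_zero
  field_simp

lemma norm_fourierCoeffs_le (f : L2Torus) (n : Freq) : ‖fourierCoeffs f n‖ ≤ ‖f‖ := by
  have h := le_hasSum (hasSum_norm_sq_L2Torus f) n (fun m _ => by positivity)
  have h1 : (1 : ℝ) ≤ (2 * Real.pi) ^ 2 := by
    have := Real.pi_gt_three
    nlinarith
  refine le_of_sq_le_sq ?_ (norm_nonneg f)
  nlinarith [sq_nonneg ‖fourierCoeffs f n‖]

/-- This is what makes the Sobolev norms lower semicontinuous on `L²`, hence measurable along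
curves. -/
lemma continuous_fourierCoeffs (n : Freq) :
    Continuous fun f : L2Torus => fourierCoeffs f n := by
  refine LipschitzWith.continuous (K := 1) (LipschitzWith.of_dist_le_mul fun f g => ?_)
  rw [dist_eq_norm, dist_eq_norm, ← Pi.sub_apply, ← fourierCoeffs_Lp_sub]
  simpa using norm_fourierCoeffs_le (f - g) n

lemma fourierCoeffs_zero_freq (f : Torus2 → ℝ) : fourierCoeffs f 0 = ((⨍ x, f x : ℝ) : ℂ) := by
  simp only [fourierCoeffs_eq, fourierCoeffsC, neg_zero, torusChar_zero, one_mul, torus_average]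
  rw [integral_complex_ofReal]
  simp

lemma fourierCoeffs_const (r : ℝ) {n : Freq} (hn : n ≠ 0) :
    fourierCoeffs (fun _ => r) n = 0 := by
  simp only [fourierCoeffs_eq, fourierCoeffsC, torus_average]
  rw [integral_mul_const, integral_torusChar_of_ne (neg_ne_zero.mpr hn)]
  simp

lemma conj_fourierCoeffs (f : Torus2 → ℝ) (n : Freq) :
    (starRingEnd ℂ) (fourierCoeffs f n) = fourierCoeffs f (-n) := by
  simp only [fourierCoeffs_eq, fourierCoeffsC, torus_average, Complex.real_smul, map_mul,
    Complex.conj_ofReal, ← integral_conj]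
  congr 2
  ext x
  rw [torusChar_neg (-n)]

lemma fourierCoeffs_translate (f : Torus2 → ℝ) (a : Torus2) (n : Freq) :
    fourierCoeffs (fun x => f (x + a)) n = torusChar n a * fourierCoeffs f n := by
  simp only [fourierCoeffs_eq, fourierCoeffsC, torus_average, Complex.real_smul]
  rw [mul_left_comm]
  congr 1
  rw [← integral_const_mul,
    ← integral_add_right_eq_self (fun x => torusChar n a * (torusChar (-n) x * (f x : ℂ))) a]
  congr 1
  ext x
  rw [torusChar_map_add, torusChar_neg n a]
  have : torusChar n a * (starRingEnd ℂ) (torusChar n a) = 1 := by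
    rw [Complex.mul_conj', norm_torusChar]
    simp
  linear_combination (-(torusChar (-n) x * (f (x + a) : ℂ))) * this

/-- The Fourier coefficients of a product are the convolution of the Fourier coefficients. -/
lemma hasSum_fourierCoeffs_mul {f g : Torus2 → ℝ} (hf : MemLp f 2 volume) (hg : MemLp g 2 volume)
    (n : Freq) :
    HasSum (fun m => fourierCoeffs f (n - m) * fourierCoeffs g m)
      (fourierCoeffs (fun x => f x * g x) n) := by
  -- Parseval is applied to `e^{i n·x} f` and `g`: conjugating the first factor produces `e^{-i n·x}
  -- f g`.
  have hF : MemLp (fun x => torusChar n x * (f x : ℂ)) 2 volume :=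
    hf.ofReal.mul (p := ⊤) (q := 2) (r := 2)
      (memLp_top_of_bound (torusChar n).continuous.aestronglyMeasurable 1
        (Eventually.of_forall fun x => (norm_torusChar n x).le))
  have hG : MemLp (fun x => (g x : ℂ)) 2 volume := hg.ofReal
  have h := hasSum_fourierCoeffsC hF hG
  convert! h using 1
  · ext m
    rw [fourierCoeffs_eq g]
    congr 1
    have : fourierCoeffsC (fun x => torusChar n x * (f x : ℂ)) m = fourierCoeffs f (m - n) := by
      rw [fourierCoeffs_eq, fourierCoeffsC, fourierCoeffsC]
      congr 1
      ext x
      rw [neg_sub, sub_eq_neg_add, torusChar_add]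
      ring
    rw [this, conj_fourierCoeffs, neg_sub]
  · rw [fourierCoeffs_eq, fourierCoeffsC]
    congr 1
    ext x
    rw [torusChar_neg]
    push_cast
    rw [map_mul, Complex.conj_ofReal]
    ring

/-- `(u·∇)f = div (u f)` for a divergence free field `u`. -/
lemma fourierCoeffs_advection {u : Fin 2 → L2Torus} {f : L2Torus} {G : Fin 2 → L2Torus}
    (hdiv : ∀ n : Freq, ∑ j, Complex.I * (n j : ℂ) * fourierCoeffs (u j) n = 0)
    (hG : ∀ j, IsWeakPartial j f (G j)) (n : Freq) :
    fourierCoeffs (fun x => ∑ j, u j x * G j x) n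
      = ∑ j, Complex.I * (n j : ℂ) * fourierCoeffs (fun x => u j x * f x) n := by
  have h1 : fourierCoeffs (fun x => ∑ j, u j x * G j x) n
      = ∑ j, fourierCoeffs (fun x => u j x * G j x) n := by
    simp only [Fin.sum_univ_two]
    exact congrFun (fourierCoeffs_add ((memLp_L2Torus (u 0)).integrable_mul (memLp_L2Torus (G 0)))
      ((memLp_L2Torus (u 1)).integrable_mul (memLp_L2Torus (G 1)))) n
  rw [h1]
  have hL := hasSum_sum (s := Finset.univ) fun j (_ : j ∈ Finset.univ) =>
    hasSum_fourierCoeffs_mul (memLp_L2Torus (u j)) (memLp_L2Torus (G j)) n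
  have hR := hasSum_sum (s := Finset.univ) fun j (_ : j ∈ Finset.univ) =>
    (hasSum_fourierCoeffs_mul (memLp_L2Torus (u j)) (memLp_L2Torus f) n).mul_left
      (Complex.I * (n j : ℂ))
  refine hL.unique ?_
  convert! hR using 1
  ext m
  -- The two convolution sums differ termwise by `i (n-m)·û(n-m) f̂(m)`, which vanishes by
  -- incompressibility.
  have hd := hdiv (n - m)
  simp only [Fin.sum_univ_two, hG _ m, Pi.sub_apply, Int.cast_sub] at hd ⊢
  linear_combination (-fourierCoeffs f m) * hd

/-- A function with absolutely summable Fourier coefficients is essentially bounded. -/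
lemma ae_abs_le_tsum_fourierCoeffs {f : Torus2 → ℝ} (hf : MemLp f 2 volume)
    (hs : Summable fun n => ‖fourierCoeffs f n‖) :
    ∀ᵐ x, |f x| ≤ ∑' n, ‖fourierCoeffs f n‖ := by
  have hnorm : ∀ n, ‖fourierCoeffs f n • torusChar n‖ ≤ ‖fourierCoeffs f n‖ := fun n => by
    refine (ContinuousMap.norm_le _ (norm_nonneg _)).mpr fun x => ?_
    simp [norm_torusChar]
  have hsG : Summable fun n => ‖fourierCoeffs f n • torusChar n‖ :=
    Summable.of_nonneg_of_le (fun _ => norm_nonneg _) hnorm hs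
  have hfC : MemLp (fun x => (f x : ℂ)) 2 volume := hf.ofReal
  have hG := hsG.of_norm.hasSum
  have hG2 := hG.mapL (ContinuousMap.toLp (E := ℂ) 2 (volume : Measure Torus2) ℂ)
  have hF := torusBasis.hasSum_repr hfC.toLp
  -- The Fourier series converges uniformly by assumption and in `L²` always; the two limits agree,
  -- so `f` has a continuous representative.
  have heq : ContinuousMap.toLp (E := ℂ) 2 (volume : Measure Torus2) ℂ
      (∑' n, fourierCoeffs f n • torusChar n) = hfC.toLp := by
    refine hG2.unique ?_
    convert! hF using 1
    ext1 n
    rw [HilbertBasis.repr_apply_apply, coe_torusBasis, inner_torusCharLp_toLp, torusCharLp,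
      smul_smul, map_smul]
    congr 1
    rw [fourierCoeffs_eq]
    have : (Real.pi : ℂ) ≠ 0 := by exact_mod_cast Real.pi_ne_zero
    field_simp
  have h1 := ContinuousMap.coeFn_toLp (p := 2) (𝕜 := ℂ) (volume : Measure Torus2)
    (∑' n, fourierCoeffs f n • torusChar n)
  rw [heq] at h1
  filter_upwards [h1, hfC.coeFn_toLp] with x hx1 hx2
  rw [hx1] at hx2
  have : |f x| = ‖(f x : ℂ)‖ := by simp
  rw [this]
  refine (congrArg norm hx2.symm).le.trans ?_
  exact (ContinuousMap.norm_coe_le_norm _ x).trans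
    ((norm_tsum_le_tsum_norm hsG).trans (hsG.tsum_le_tsum hnorm hs))

/-! ### Frequency weights, Sobolev norms and the embedding `H² ⊂ L^∞`. -/

lemma freqSq_nonneg (n : Freq) : 0 ≤ freqSq n := Finset.sum_nonneg fun _ _ => sq_nonneg _

lemma freqSq_zero : freqSq 0 = 0 := by simp [freqSq]

lemma one_le_freqSq {n : Freq} (hn : n ≠ 0) : 1 ≤ freqSq n := by
  obtain ⟨i, hi⟩ := Function.ne_iff.mp hn
  have h1 : (1 : ℝ) ≤ (n i : ℝ) ^ 2 := by
    have : (1 : ℤ) ≤ n i ^ 2 := by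
      have := sq_pos_of_ne_zero (show n i ≠ 0 from hi)
      omega
    exact_mod_cast this
  exact h1.trans (Finset.single_le_sum (f := fun j => (n j : ℝ) ^ 2)
    (fun _ _ => sq_nonneg _) (Finset.mem_univ i))

/-- Since `(1 + n₀²)(1 + n₁²) ≤ (1 + |n|²)²`, the double series is dominated by a product of two
convergent ones. -/
lemma summable_one_add_freqSq : Summable fun n : Freq => ((1 + freqSq n) ^ 2)⁻¹ := by
  have h1 : Summable fun k : ℤ => (1 + (k : ℝ) ^ 2)⁻¹ := by
    refine Summable.of_nonneg_of_le (f := fun k : ℤ => (if k = 0 then 1 else 0) + 1 / (k : ℝ) ^ 2)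
      (fun k => by positivity) (fun k => ?_) ?_
    · split_ifs with h
      · simp [h]
      · have : 0 < (k : ℝ) ^ 2 := by positivity
        rw [zero_add, one_div]
        exact inv_anti₀ this (by linarith)
    · refine Summable.add (summable_of_ne_finset_zero (s := {0}) fun k hk => ?_)
        (Real.summable_one_div_int_pow.mpr (by norm_num))
      simp at hk
      simp [hk]
  have h2 := h1.mul_of_nonneg h1 (fun k => by positivity) (fun k => by positivity)
  have h3 := (finTwoArrowEquiv ℤ).summable_iff.mpr h2
  refine Summable.of_nonneg_of_le (fun n => by positivity) (fun n => ?_) h3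
  simp only [Function.comp, freqSq, Fin.sum_univ_two]
  change _ ≤ (1 + (n 0 : ℝ) ^ 2)⁻¹ * (1 + (n 1 : ℝ) ^ 2)⁻¹
  rw [← mul_inv]
  refine inv_anti₀ (by positivity) ?_
  nlinarith [sq_nonneg (n 0 : ℝ), sq_nonneg (n 1 : ℝ),
    mul_nonneg (sq_nonneg (n 0 : ℝ)) (sq_nonneg (n 1 : ℝ))]

lemma tsum_ofReal_eq {a : Freq → ℝ} (ha : ∀ n, 0 ≤ a n) (hs : Summable a) :
    ∑' n, ENNReal.ofReal (a n) = ENNReal.ofReal (∑' n, a n) :=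
  (ENNReal.ofReal_tsum_of_nonneg ha hs).symm

lemma summable_of_tsum_ofReal_lt_top {a : Freq → ℝ} (ha : ∀ n, 0 ≤ a n)
    (h : ∑' n, ENNReal.ofReal (a n) < ⊤) : Summable a := by
  have := ENNReal.summable_toReal h.ne
  simpa only [ENNReal.toReal_ofReal (ha _)] using this

lemma sobolevNormSq_zero (c : Freq → ℂ) :
    sobolevNormSq 0 c = ∑' n, ENNReal.ofReal ((2 * Real.pi) ^ 2 * ‖c n‖ ^ 2) := by
  simp [sobolevNormSq]

lemma sobolevNormSq_one (c : Freq → ℂ) :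
    sobolevNormSq 1 c = ∑' n, ENNReal.ofReal ((2 * Real.pi) ^ 2 * (1 + freqSq n) * ‖c n‖ ^ 2) := by
  simp [sobolevNormSq]

lemma sobolevNormSq_two (c : Freq → ℂ) : sobolevNormSq 2 c
    = ∑' n, ENNReal.ofReal ((2 * Real.pi) ^ 2 * (1 + freqSq n) ^ 2 * ‖c n‖ ^ 2) := by
  simp [sobolevNormSq]

/-- With the convention `0⁻¹ = 0` the weight `|n|⁻²` vanishes at `n = 0`, so the zero mode needs no
separate case from here on. -/
lemma homSobolevNormSq_neg_one (c : Freq → ℂ) : homSobolevNormSq (-1) c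
    = ∑' n, ENNReal.ofReal ((2 * Real.pi) ^ 2 * (freqSq n)⁻¹ * ‖c n‖ ^ 2) := by
  refine tsum_congr fun n => ?_
  split_ifs with h
  · simp [h, freqSq_zero]
  · rw [Real.rpow_neg_one]

lemma sobolevNormSq_mono {s t : ℝ} (h : s ≤ t) (c : Freq → ℂ) :
    sobolevNormSq s c ≤ sobolevNormSq t c := by
  refine ENNReal.tsum_le_tsum fun n => ENNReal.ofReal_le_ofReal ?_
  have := freqSq_nonneg n
  gcongr
  linarith

lemma sobolevNormSq_zero_L2Torus (f : L2Torus) :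
    sobolevNormSq 0 (fourierCoeffs f) = ENNReal.ofReal (‖f‖ ^ 2) := by
  rw [sobolevNormSq_zero, tsum_ofReal_eq (fun n => by positivity)
    (hasSum_norm_sq_L2Torus f).summable, (hasSum_norm_sq_L2Torus f).tsum_eq]

/-- A sum of nonnegative continuous functions is lower semicontinuous. Used for measurability in
time and for the limit of difference quotients. -/
lemma lowerSemicontinuous_sobolevNormSq (s : ℝ) :
    LowerSemicontinuous fun f : L2Torus => sobolevNormSq s (fourierCoeffs f) := by
  refine lowerSemicontinuous_tsum fun n => Continuous.lowerSemicontinuous ?_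
  exact ENNReal.continuous_ofReal.comp
    (continuous_const.mul ((continuous_fourierCoeffs n).norm.pow 2))

lemma MeasureTheory.AEStronglyMeasurable.sobolevNormSq {α : Type*} [MeasurableSpace α]
    {μ : Measure α} {f : α → L2Torus} (hf : AEStronglyMeasurable f μ) (s : ℝ) :
    AEMeasurable (fun t => sobolevNormSq s (fourierCoeffs (f t))) μ := by
  borelize L2Torus
  exact (lowerSemicontinuous_sobolevNormSq s).measurable.comp_aemeasurable hf.aemeasurable

/-- The Cauchy–Schwarz inequality for series. -/
lemma summable_mul_and_sq_tsum_mul_le {a b : Freq → ℝ} (ha : ∀ n, 0 ≤ a n) (hb : ∀ n, 0 ≤ b n)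
    (hsa : Summable fun n => a n ^ 2) (hsb : Summable fun n => b n ^ 2) :
    Summable (fun n => a n * b n) ∧
      (∑' n, a n * b n) ^ 2 ≤ (∑' n, a n ^ 2) * ∑' n, b n ^ 2 := by
  have hs : Summable fun n => a n * b n :=
    Summable.of_nonneg_of_le (fun n => mul_nonneg (ha n) (hb n))
      (fun n => by nlinarith [sq_nonneg (a n - b n)]) (hsa.add hsb)
  refine ⟨hs, le_of_tendsto' (hs.hasSum.pow 2) fun s => ?_⟩
  refine (Finset.sum_mul_sq_le_sq_mul_sq s a b).trans ?_
  exact mul_le_mul (hsa.sum_le_tsum s fun n _ => sq_nonneg _)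
    (hsb.sum_le_tsum s fun n _ => sq_nonneg _)
    (Finset.sum_nonneg fun n _ => sq_nonneg _) (tsum_nonneg fun n => sq_nonneg _)

/-- The constant of the embedding `H² ⊂ L^∞`. -/
noncomputable def sobolevConst : ℝ := ∑' n : Freq, ((1 + freqSq n) ^ 2)⁻¹

lemma sobolevConst_nonneg : 0 ≤ sobolevConst := tsum_nonneg fun n => by positivity

/-- The Sobolev embedding `H² ⊂ L^∞` on the torus. -/
lemma ae_sq_le_sobolev {f : L2Torus} (hf : sobolevNormSq 2 (fourierCoeffs f) < ⊤) :
    ∃ M : ℝ, 0 ≤ M ∧ (∀ᵐ x, |f x| ≤ M) ∧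
      M ^ 2 ≤ sobolevConst * (sobolevNormSq 2 (fourierCoeffs f)).toReal := by
  rw [sobolevNormSq_two] at hf ⊢
  have hs := summable_of_tsum_ofReal_lt_top (fun n => by positivity) hf
  rw [tsum_ofReal_eq (fun n => by positivity) hs,
    ENNReal.toReal_ofReal (tsum_nonneg fun n => by positivity)]
  have h1 : (1 : ℝ) ≤ (2 * Real.pi) ^ 2 := by
    have := Real.pi_gt_three
    nlinarith
  have hpos : ∀ n, 0 < 1 + freqSq n := fun n => by linarith [freqSq_nonneg n]
  have hle : ∀ n, ((1 + freqSq n) * ‖fourierCoeffs f n‖) ^ 2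
      ≤ (2 * Real.pi) ^ 2 * (1 + freqSq n) ^ 2 * ‖fourierCoeffs f n‖ ^ 2 := fun n => by
    rw [mul_pow, mul_assoc]
    exact le_mul_of_one_le_left (by positivity) h1
  have hs' : Summable fun n => ((1 + freqSq n) * ‖fourierCoeffs f n‖) ^ 2 :=
    Summable.of_nonneg_of_le (fun n => by positivity) hle hs
  have hc : Summable fun n : Freq => ((1 + freqSq n)⁻¹) ^ 2 := by
    simpa only [inv_pow] using summable_one_add_freqSq
  -- Cauchy–Schwarz on `|f̂(n)| = (1+|n|²)⁻¹ · (1+|n|²)|f̂(n)|` gives absolute summability.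
  obtain ⟨hS, hCS⟩ := summable_mul_and_sq_tsum_mul_le (fun n => (inv_pos.mpr (hpos n)).le)
    (fun n => mul_nonneg (hpos n).le (norm_nonneg (fourierCoeffs f n))) hc hs'
  have hterm : ∀ n, (1 + freqSq n)⁻¹ * ((1 + freqSq n) * ‖fourierCoeffs f n‖)
      = ‖fourierCoeffs f n‖ := fun n => by
    rw [← mul_assoc, inv_mul_cancel₀ (hpos n).ne', one_mul]
  simp only [hterm] at hS hCS
  refine ⟨∑' n, ‖fourierCoeffs f n‖, tsum_nonneg fun n => norm_nonneg _,
    ae_abs_le_tsum_fourierCoeffs (memLp_L2Torus f) hS, hCS.trans ?_⟩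
  simp only [inv_pow]
  exact mul_le_mul_of_nonneg_left (hs'.tsum_le_tsum hle hs) sobolevConst_nonneg

/-! ### Consequences of the assumptions on the potential. -/

lemma IsSingularPotential.differentiableOn_deriv {Φ : ℝ → ℝ} (hΦ : IsSingularPotential Φ) :
    DifferentiableOn ℝ (deriv Φ) (Ioo (-1) 1) :=
  (hΦ.smooth.deriv_of_isOpen (m := 1) isOpen_Ioo
    (WithTop.coe_le_coe.mpr le_top)).differentiableOn (by norm_num)

/-- The derivative of the potential is monotone up to a linear term. -/
lemma IsSingularPotential.exists_semimonotone {Φ : ℝ → ℝ} (hΦ : IsSingularPotential Φ) :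
    ∃ α : ℝ, 0 ≤ α ∧ ∀ a ∈ Ioo (-1 : ℝ) 1, ∀ b ∈ Ioo (-1 : ℝ) 1,
      0 ≤ (deriv Φ a - deriv Φ b) * (a - b) + α * (a - b) ^ 2 := by
  obtain ⟨α, _, _, _, hα, -, -, -, hb⟩ := hΦ.deriv_bounds
  refine ⟨α, hα.le, ?_⟩
  have hd := hΦ.differentiableOn_deriv
  have hd2 : DifferentiableOn ℝ (fun s => deriv Φ s + α * s) (Ioo (-1) 1) :=
    hd.add (differentiableOn_id.const_mul α)
  -- The lower bound `φ' ≥ -α` makes `φ(s) + αs` nondecreasing.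
  have hmono : MonotoneOn (fun s => deriv Φ s + α * s) (Ioo (-1) 1) := by
    refine monotoneOn_of_deriv_nonneg (convex_Ioo _ _) hd2.continuousOn
      (hd2.mono interior_subset) fun s hs => ?_
    rw [interior_Ioo] at hs
    have h1 : DifferentiableAt ℝ (deriv Φ) s := (hd s hs).differentiableAt (Ioo_mem_nhds hs.1 hs.2)
    have h2 : HasDerivAt (fun s => deriv Φ s + α * s) (deriv (deriv Φ) s + α * 1) s :=
      h1.hasDerivAt.add ((hasDerivAt_id s).const_mul α)
    rw [h2.deriv]
    linarith [(hb s hs).1]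
  have key : ∀ a ∈ Ioo (-1 : ℝ) 1, ∀ b ∈ Ioo (-1 : ℝ) 1, a ≤ b →
      0 ≤ (deriv Φ a - deriv Φ b) * (a - b) + α * (a - b) ^ 2 := fun a ha b hb hab => by
    have h := hmono ha hb hab
    simp only at h
    nlinarith
  intro a ha b hb
  rcases le_total a b with h | h
  · exact key a ha b hb h
  · have := key b hb a ha h
    linarith [show (deriv Φ b - deriv Φ a) * (b - a) + α * (b - a) ^ 2
      = (deriv Φ a - deriv Φ b) * (a - b) + α * (a - b) ^ 2 by ring]

/-- Near `±1`, `φ(s)` has the sign of `s` and `|s| ≥ 1/2`, whence the factor `2`; on the remaining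
compact interval `φ` is bounded. This later controls the mean of `φ(f)` by `∫ φ(f) f`, which the
zero mode does not enter. -/
lemma IsSingularPotential.exists_abs_le {Φ : ℝ → ℝ} (hΦ : IsSingularPotential Φ) :
    ∃ C : ℝ, 0 ≤ C ∧ ∀ s ∈ Ioo (-1 : ℝ) 1, |deriv Φ s| ≤ 2 * (deriv Φ s * s) + C := by
  have h1 : ∀ᶠ s in 𝓝[>] (-1 : ℝ), deriv Φ s ≤ 0 := hΦ.tendsto_left.eventually_le_atBot 0
  have h2 : ∀ᶠ s in 𝓝[<] (1 : ℝ), 0 ≤ deriv Φ s := hΦ.tendsto_right.eventually_ge_atTop 0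
  obtain ⟨a, ha, hla⟩ :=
    (mem_nhdsGT_iff_exists_Ioo_subset' (show (-1 : ℝ) < -1/2 by norm_num)).mp h1
  obtain ⟨b, hb, hrb⟩ :=
    (mem_nhdsLT_iff_exists_Ioo_subset' (show (1/2 : ℝ) < 1 by norm_num)).mp h2
  have ha' : -1 < min a (-1/2) := lt_min ha (by norm_num)
  have hb' : max b (1/2) < 1 := max_lt hb (by norm_num)
  have hsub : Icc (min a (-1/2)) (max b (1/2)) ⊆ Ioo (-1) 1 := fun s hs =>
    ⟨ha'.trans_le hs.1, hs.2.trans_lt hb'⟩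
  obtain ⟨M, hM⟩ := isCompact_Icc.exists_bound_of_continuousOn
    (hΦ.differentiableOn_deriv.continuousOn.mono hsub)
  -- In the middle range `|φ(s)| ≤ M` and `2φ(s)s ≥ -2M`, so `3M` suffices.
  refine ⟨3 * max M 0, by positivity, fun s hs => ?_⟩
  have hM0 := le_max_right M 0
  by_cases hl : s < min a (-1/2)
  · have h : deriv Φ s ≤ 0 := hla ⟨hs.1, hl.trans_le (min_le_left _ _)⟩
    have h' : s < -1/2 := hl.trans_le (min_le_right _ _)
    rw [abs_of_nonpos h]
    nlinarith
  · by_cases hr : max b (1/2) < s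
    · have h : 0 ≤ deriv Φ s := hrb ⟨(le_max_left _ _).trans_lt hr, hs.2⟩
      have h' : 1/2 < s := (le_max_right _ _).trans_lt hr
      rw [abs_of_nonneg h]
      nlinarith
    · have h := (hM s ⟨not_lt.mp hl, not_lt.mp hr⟩).trans (le_max_left M 0)
      rw [Real.norm_eq_abs] at h
      have h3 : |deriv Φ s * s| ≤ max M 0 := by
        rw [abs_mul]
        calc |deriv Φ s| * |s| ≤ |deriv Φ s| * 1 :=
              mul_le_mul_of_nonneg_left (abs_le.mpr ⟨hs.1.le, hs.2.le⟩) (abs_nonneg _)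
          _ ≤ max M 0 := by rwa [mul_one]
      linarith [(abs_le.mp h3).1]

/-! ### Semimonotonicity in Fourier variables, by translation. -/

/-- Translation by `h` in the direction `j`. -/
noncomputable def axisShift (j : Fin 2) (h : ℝ) : Torus2 :=
  Pi.single j (h : AddCircle (2 * Real.pi))

lemma torusChar_axisShift (n : Freq) (j : Fin 2) (h : ℝ) :
    torusChar n (axisShift j h) = Complex.exp (Complex.I * ((n j * h : ℝ) : ℂ)) := by
  rw [torusChar_apply, Finset.prod_eq_single j]
  · rw [axisShift, Pi.single_eq_same, fourier_coe_apply]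
    congr 1
    have : (Real.pi : ℂ) ≠ 0 := by exact_mod_cast Real.pi_ne_zero
    push_cast
    field_simp
  · intro i _ hi
    rw [axisShift, Pi.single_eq_of_ne hi]
    exact fourier_eval_zero _
  · simp

lemma norm_torusChar_axisShift_sub_one_le (n : Freq) (j : Fin 2) (h : ℝ) :
    ‖torusChar n (axisShift j h) - 1‖ ≤ |(n j : ℝ) * h| := by
  rw [torusChar_axisShift]
  exact Real.norm_exp_I_mul_ofReal_sub_one_le

lemma tendsto_torusChar_axisShift (n : Freq) (j : Fin 2) :
    Tendsto (fun h : ℝ => ‖torusChar n (axisShift j h) - 1‖ ^ 2 / h ^ 2) (𝓝[≠] 0)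
      (𝓝 ((n j : ℝ) ^ 2)) := by
  have hd : HasDerivAt (fun h : ℝ => Complex.exp (Complex.I * ((n j * h : ℝ) : ℂ)))
      (Complex.I * (n j : ℂ)) 0 := by
    have h1 : HasDerivAt (fun h : ℝ => Complex.I * ((n j * h : ℝ) : ℂ))
        (Complex.I * ((n j * 1 : ℝ) : ℂ)) 0 :=
      (((hasDerivAt_id (0 : ℝ)).const_mul (n j : ℝ)).ofReal_comp).const_mul _
    have h2 := h1.cexp
    simpa using h2
  have h3 := (hasDerivAt_iff_tendsto_slope_zero.mp hd).norm.pow 2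
  have e : ‖Complex.I * (n j : ℂ)‖ ^ 2 = (n j : ℝ) ^ 2 := by simp
  rw [e] at h3
  refine h3.congr fun h => ?_
  rw [torusChar_axisShift, norm_smul, mul_pow]
  simp
  ring

/-- Integration by parts against a semimonotone function of `f`:
`∫ ∇g·∇f ≥ -α ∫ |∇f|²`. -/
lemma tsum_freqSq_semimonotone {f g : Torus2 → ℝ} (hf : MemLp f 2 volume) (hg : MemLp g 2 volume)
    {α : ℝ} {S : Set ℝ} {ψ : ℝ → ℝ} (hS : ∀ᵐ x, f x ∈ S ∧ g x = ψ (f x))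
    (hψ : ∀ a ∈ S, ∀ b ∈ S, 0 ≤ (ψ a - ψ b) * (a - b) + α * (a - b) ^ 2)
    (hH2 : Summable fun n => freqSq n ^ 2 * ‖fourierCoeffs f n‖ ^ 2) :
    Summable (fun n => freqSq n * (((starRingEnd ℂ) (fourierCoeffs g n) * fourierCoeffs f n).re
        + α * ‖fourierCoeffs f n‖ ^ 2)) ∧
      0 ≤ ∑' n, freqSq n * (((starRingEnd ℂ) (fourierCoeffs g n) * fourierCoeffs f n).re
        + α * ‖fourierCoeffs f n‖ ^ 2) := by
  set q : Freq → ℝ := fun n => ((starRingEnd ℂ) (fourierCoeffs g n) * fourierCoeffs f n).re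
        + α * ‖fourierCoeffs f n‖ ^ 2 with hq
  have hsf := (hasSum_sq_fourierCoeffs hf).summable
  have hsg := (hasSum_sq_fourierCoeffs hg).summable
  -- The dominating sequence: the cross term `|ĝ| · |n|²|f̂|` is split by Young, using only `g ∈ L²`
  -- and `f ∈ H²`.
  have hqb : ∀ n, freqSq n * |q n| ≤ ‖fourierCoeffs g n‖ ^ 2 + |α| * ‖fourierCoeffs f n‖ ^ 2
      + (1 + |α|) * (freqSq n ^ 2 * ‖fourierCoeffs f n‖ ^ 2) := fun n => by
    have h0 := freqSq_nonneg n
    have h1 : |q n| ≤ ‖fourierCoeffs g n‖ * ‖fourierCoeffs f n‖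
        + |α| * ‖fourierCoeffs f n‖ ^ 2 := by
      refine (abs_add_le _ _).trans (add_le_add ?_ ?_)
      · refine (Complex.abs_re_le_norm _).trans ?_
        rw [norm_mul, RCLike.norm_conj]
      · rw [abs_mul, abs_of_nonneg (sq_nonneg ‖fourierCoeffs f n‖)]
    have h2 : freqSq n ≤ 1 + freqSq n ^ 2 := by nlinarith [sq_nonneg (freqSq n - 1)]
    have h3 := mul_le_mul_of_nonneg_left h1 h0
    have h4 := mul_le_mul_of_nonneg_left h2
      (mul_nonneg (abs_nonneg α) (sq_nonneg ‖fourierCoeffs f n‖))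
    nlinarith [sq_nonneg (‖fourierCoeffs g n‖ - freqSq n * ‖fourierCoeffs f n‖),
      sq_nonneg (‖fourierCoeffs g n‖), sq_nonneg (freqSq n * ‖fourierCoeffs f n‖)]
  have hbs : Summable fun n => ‖fourierCoeffs g n‖ ^ 2 + |α| * ‖fourierCoeffs f n‖ ^ 2
      + (1 + |α|) * (freqSq n ^ 2 * ‖fourierCoeffs f n‖ ^ 2) :=
    (hsg.add (hsf.mul_left _)).add (hH2.mul_left _)
  -- Apply the pointwise inequality to the values `f(x+a)` and `f(x)`, integrate, and use Parseval;
  -- translation by `a` multiplies the `n`-th coefficient by `e^{i n·a}`.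
  have hdiff : ∀ a : Torus2, 0 ≤ ∑' n, ‖torusChar n a - 1‖ ^ 2 * q n := fun a => by
    have hmp : MeasurePreserving (fun x : Torus2 => x + a) := measurePreserving_add_right volume a
    have hfa : MemLp (fun x => f (x + a)) 2 volume := hf.comp_measurePreserving hmp
    have hga : MemLp (fun x => g (x + a)) 2 volume := hg.comp_measurePreserving hmp
    have hF : ∀ n, fourierCoeffs (fun x => f (x + a) - f x) n
        = (torusChar n a - 1) * fourierCoeffs f n := fun n => by
      rw [fourierCoeffs_sub hfa.integrable_torus hf.integrable_torus, Pi.sub_apply,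
        fourierCoeffs_translate]
      ring
    have hG : ∀ n, fourierCoeffs (fun x => g (x + a) - g x) n
        = (torusChar n a - 1) * fourierCoeffs g n := fun n => by
      rw [fourierCoeffs_sub hga.integrable_torus hg.integrable_torus, Pi.sub_apply,
        fourierCoeffs_translate]
      ring
    have hs1 := hasSum_fourierCoeffs (hga.sub hg) (hfa.sub hf)
    have hs2 := (hasSum_sq_fourierCoeffs (hfa.sub hf)).mul_left α
    have hs := hs1.add hs2
    have hterm : (fun n => ((starRingEnd ℂ) (fourierCoeffs ((fun x => g (x + a)) - g) n)
        * fourierCoeffs ((fun x => f (x + a)) - f) n).re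
        + α * ‖fourierCoeffs ((fun x => f (x + a)) - f) n‖ ^ 2)
        = fun n => ‖torusChar n a - 1‖ ^ 2 * q n := by
      ext n
      change ((starRingEnd ℂ) (fourierCoeffs (fun x => g (x + a) - g x) n)
        * fourierCoeffs (fun x => f (x + a) - f x) n).re
        + α * ‖fourierCoeffs (fun x => f (x + a) - f x) n‖ ^ 2 = _
      rw [hF, hG, hq, norm_mul, map_mul, mul_mul_mul_comm, Complex.conj_mul', ← Complex.ofReal_pow,
        Complex.re_ofReal_mul]
      ring
    rw [hterm] at hs
    rw [hs.tsum_eq]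
    have hint1 : Integrable
        (fun x => ((fun x => g (x + a)) - g) x * ((fun x => f (x + a)) - f) x) :=
      (hga.sub hg).integrable_mul (hfa.sub hf)
    have hint2 := (hfa.sub hf).integrable_sq.const_mul α
    rw [torus_average, torus_average, smul_eq_mul, smul_eq_mul, mul_left_comm, ← mul_add,
      ← integral_const_mul, ← integral_add hint1 hint2]
    refine mul_nonneg (by positivity) (integral_nonneg_of_ae ?_)
    filter_upwards [hS, hmp.quasiMeasurePreserving.ae hS] with x hx1 hx2
    have := hψ _ hx2.1 _ hx1.1
    rw [← hx1.2, ← hx2.2] at this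
    exact this
  -- Take `a = h e_j`, divide by `h²` and let `h → 0`: the multiplier tends to `n_j²` and never
  -- exceeds it.
  have hj : ∀ j, 0 ≤ ∑' n : Freq, (n j : ℝ) ^ 2 * q n := fun j => by
    have hlim : Tendsto (fun h : ℝ => ∑' n, (‖torusChar n (axisShift j h) - 1‖ ^ 2 / h ^ 2) * q n)
        (𝓝[≠] 0) (𝓝 (∑' n : Freq, (n j : ℝ) ^ 2 * q n)) := by
      refine tendsto_tsum_of_dominated_convergence hbs
        (fun n => (tendsto_torusChar_axisShift n j).mul_const _) ?_
      filter_upwards [self_mem_nhdsWithin] with h hh n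
      have hh' : 0 < h ^ 2 := by
        have : h ≠ 0 := hh
        positivity
      refine le_trans ?_ (hqb n)
      rw [norm_mul, Real.norm_eq_abs, Real.norm_eq_abs]
      refine mul_le_mul_of_nonneg_right ?_ (abs_nonneg _)
      rw [abs_of_nonneg (by positivity), div_le_iff₀ hh']
      refine (pow_le_pow_left₀ (norm_nonneg _)
        (norm_torusChar_axisShift_sub_one_le n j h) 2).trans ?_
      rw [sq_abs, mul_pow]
      refine mul_le_mul_of_nonneg_right ?_ hh'.le
      exact Finset.single_le_sum (f := fun j => (n j : ℝ) ^ 2) (fun _ _ => sq_nonneg _)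
        (Finset.mem_univ j)
    refine ge_of_tendsto hlim ?_
    filter_upwards [self_mem_nhdsWithin] with h _
    have := mul_nonneg (inv_nonneg.mpr (sq_nonneg h)) (hdiff (axisShift j h))
    rw [← tsum_mul_left] at this
    refine this.trans_eq (tsum_congr fun n => ?_)
    ring
  have hsum : ∀ j, Summable fun n : Freq => (n j : ℝ) ^ 2 * q n := fun j => by
    refine Summable.of_norm_bounded hbs fun n => le_trans ?_ (hqb n)
    rw [norm_mul, Real.norm_eq_abs, Real.norm_eq_abs, abs_of_nonneg (sq_nonneg _)]
    exact mul_le_mul_of_nonneg_right (Finset.single_le_sum (f := fun j => (n j : ℝ) ^ 2)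
      (fun _ _ => sq_nonneg _) (Finset.mem_univ j)) (abs_nonneg _)
  have hsplit : (fun n => freqSq n * q n)
      = fun n : Freq => (n 0 : ℝ) ^ 2 * q n + (n 1 : ℝ) ^ 2 * q n := by
    ext n
    simp only [freqSq, Fin.sum_univ_two]
    ring
  rw [hsplit, (hsum 0).tsum_add (hsum 1)]
  exact ⟨(hsum 0).add (hsum 1), add_nonneg (hj 0) (hj 1)⟩

/-! ### The velocity energy and elliptic regularity. -/

/-- `ε ‖c‖²_{L²} + ‖c‖²_{Ḣ⁻¹}`. -/
noncomputable def velocityEnergy (ε : ℝ) (c : Freq → ℂ) : ℝ≥0∞ :=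
  ENNReal.ofReal ε * sobolevNormSq 0 c + homSobolevNormSq (-1) c

lemma velocityEnergy_eq {ε : ℝ} (hε : 0 ≤ ε) (c : Freq → ℂ) : velocityEnergy ε c
    = ∑' n, ENNReal.ofReal ((2 * Real.pi) ^ 2 * (ε + (freqSq n)⁻¹) * ‖c n‖ ^ 2) := by
  rw [velocityEnergy, sobolevNormSq_zero, homSobolevNormSq_neg_one, ← ENNReal.tsum_mul_left,
    ← ENNReal.tsum_add]
  refine tsum_congr fun n => ?_
  have := freqSq_nonneg n
  rw [← ENNReal.ofReal_mul hε, ← ENNReal.ofReal_add (by positivity) (by positivity)]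
  congr 1
  ring

lemma velocityEnergy_add_le {ε : ℝ} (hε : 0 ≤ ε) (c d : Freq → ℂ) :
    velocityEnergy ε (c + d) ≤ 2 * velocityEnergy ε c + 2 * velocityEnergy ε d := by
  rw [velocityEnergy_eq hε, velocityEnergy_eq hε, velocityEnergy_eq hε, ← ENNReal.tsum_mul_left,
    ← ENNReal.tsum_mul_left, ← ENNReal.tsum_add]
  refine ENNReal.tsum_le_tsum fun n => ?_
  have h0 := freqSq_nonneg n
  have h2 : (2 : ℝ≥0∞) = ENNReal.ofReal 2 := by simp
  rw [h2, ← ENNReal.ofReal_mul (by norm_num), ← ENNReal.ofReal_mul (by norm_num),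
    ← ENNReal.ofReal_add (by positivity) (by positivity)]
  refine ENNReal.ofReal_le_ofReal ?_
  have h3 : ‖(c + d) n‖ ^ 2 ≤ 2 * ‖c n‖ ^ 2 + 2 * ‖d n‖ ^ 2 := by
    have := pow_le_pow_left₀ (norm_nonneg _) (norm_add_le (c n) (d n)) 2
    rw [Pi.add_apply]
    nlinarith [sq_nonneg (‖c n‖ - ‖d n‖)]
  have h4 := mul_le_mul_of_nonneg_left h3
    (show 0 ≤ (2 * Real.pi) ^ 2 * (ε + (freqSq n)⁻¹) by positivity)
  linarith

/-- Subtracting the mean of `φ(f)` removes the zero mode exactly. -/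
lemma drivingTerm_zero (φ : ℝ → ℝ) (f : L2Torus) : drivingTerm φ f 0 = 0 := by
  simp [drivingTerm, laplacianF, freqSq_zero, fourierCoeffs_zero_freq, torus_average]

lemma drivingTerm_of_ne (φ : ℝ → ℝ) (f : L2Torus) {n : Freq} (hn : n ≠ 0) :
    drivingTerm φ f n
      = -(freqSq n : ℂ) * fourierCoeffs f n - fourierCoeffs (fun x => φ (f x)) n := by
  simp [drivingTerm, laplacianF, fourierCoeffs_const _ hn]

lemma MeasureTheory.MemLp.eLpNorm_sq_torus {g : Torus2 → ℝ} (hg : MemLp g 2 volume) :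
    eLpNorm g 2 volume ^ 2 = ENNReal.ofReal (∫ x, g x ^ 2) := by
  have h1 : ‖hg.toLp g‖ ^ 2 = ∫ x, g x ^ 2 := by
    rw [norm_sq_L2Torus]
    refine integral_congr_ae ?_
    filter_upwards [hg.coeFn_toLp] with x hx
    rw [hx]
  rw [← h1, Lp.norm_toLp, ENNReal.ofReal_pow ENNReal.toReal_nonneg,
    ENNReal.ofReal_toReal hg.eLpNorm_ne_top]

lemma MemPhaseSpace.summable_sq {ε : ℝ} {φ : ℝ → ℝ} {f : L2Torus} (hf : MemPhaseSpace ε φ f) :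
    Summable fun n => freqSq n ^ 2 * ‖fourierCoeffs f n‖ ^ 2 := by
  have h := hf.memH2
  rw [sobolevNormSq_two] at h
  refine Summable.of_nonneg_of_le (fun n => by positivity) (fun n => ?_)
    (summable_of_tsum_ofReal_lt_top (fun n => by positivity) h)
  have h0 := freqSq_nonneg n
  have h1 : (1 : ℝ) ≤ (2 * Real.pi) ^ 2 := by
    have := Real.pi_gt_three
    nlinarith
  rw [mul_assoc]
  refine le_trans ?_ (le_mul_of_one_le_left (by positivity) h1)
  gcongr
  linarith

lemma MemPhaseSpace.abs_le_one {ε : ℝ} {φ : ℝ → ℝ} {f : L2Torus} (hf : MemPhaseSpace ε φ f) :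
    ∀ᵐ x, |f x| ≤ 1 :=
  hf.range.mono fun _ hx => abs_le.mpr ⟨hx.1.le, hx.2.le⟩

/-- The resolvent divides by the same weight `ε + |n|⁻²` that defines the energy, so one inverse
power of it survives. -/
lemma velocityEnergy_phaseVelocity {ε : ℝ} (hε : 0 < ε) (φ : ℝ → ℝ) (f : L2Torus) :
    velocityEnergy ε (phaseVelocity ε φ f) = ∑' n, ENNReal.ofReal
      ((2 * Real.pi) ^ 2 * (ε + (freqSq n)⁻¹)⁻¹ * ‖drivingTerm φ f n‖ ^ 2) := by
  rw [velocityEnergy_eq hε.le]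
  refine tsum_congr fun n => ?_
  congr 1
  rw [phaseVelocity, resolventF]
  split_ifs with hn
  · simp [hn, drivingTerm_zero]
  · have h0 := freqSq_nonneg n
    have hpos : 0 < ε + (freqSq n)⁻¹ := by positivity
    have : ((ε : ℂ) + 1 / (freqSq n : ℂ)) = ((ε + (freqSq n)⁻¹ : ℝ) : ℂ) := by
      push_cast
      rw [one_div]
    rw [this, norm_div, Complex.norm_real, Real.norm_eq_abs, abs_of_pos hpos]
    field_simp

/-- For `ε ≤ 1` the weight satisfies `ε + |n|⁻² ≤ 2`, so the energy controls the driving term in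
`L²` uniformly in `ε`. -/
lemma summable_sq_drivingTerm {ε : ℝ} (hε : ε ∈ Ioc (0 : ℝ) 1) {φ : ℝ → ℝ} {f : L2Torus} {A : ℝ}
    (hA : 0 ≤ A) (h : velocityEnergy ε (phaseVelocity ε φ f) ≤ ENNReal.ofReal A) :
    Summable (fun n => ‖drivingTerm φ f n‖ ^ 2) ∧ ∑' n, ‖drivingTerm φ f n‖ ^ 2 ≤ 2 * A := by
  rw [velocityEnergy_phaseVelocity hε.1] at h
  have hw : ∀ n : Freq, 0 < ε + (freqSq n)⁻¹ := fun n => by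
    have := inv_nonneg.mpr (freqSq_nonneg n)
    linarith [hε.1]
  have hnn : ∀ n, 0 ≤ (2 * Real.pi) ^ 2 * (ε + (freqSq n)⁻¹)⁻¹ * ‖drivingTerm φ f n‖ ^ 2 :=
    fun n => by
      have := (hw n).le
      positivity
  have hs := summable_of_tsum_ofReal_lt_top hnn (h.trans_lt ENNReal.ofReal_lt_top)
  rw [tsum_ofReal_eq hnn hs, ENNReal.ofReal_le_ofReal_iff hA] at h
  have hle : ∀ n, ‖drivingTerm φ f n‖ ^ 2
      ≤ 2 * ((2 * Real.pi) ^ 2 * (ε + (freqSq n)⁻¹)⁻¹ * ‖drivingTerm φ f n‖ ^ 2) := fun n => by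
    have h1 : (1 : ℝ) ≤ (2 * Real.pi) ^ 2 := by
      have := Real.pi_gt_three
      nlinarith
    have h2 : ε + (freqSq n)⁻¹ ≤ 2 := by
      have : (freqSq n)⁻¹ ≤ 1 := by
        by_cases hn : n = 0
        · simp [hn, freqSq_zero]
        · exact inv_le_one_of_one_le₀ (one_le_freqSq hn)
      linarith [hε.2]
    have h3 : (2 : ℝ)⁻¹ ≤ (ε + (freqSq n)⁻¹)⁻¹ := inv_anti₀ (hw n) h2
    have h4 : 1 ≤ 2 * ((2 * Real.pi) ^ 2 * (ε + (freqSq n)⁻¹)⁻¹) := by nlinarith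
    rw [← mul_assoc]
    exact le_mul_of_one_le_left (by positivity) h4
  have hs2 := Summable.of_nonneg_of_le (fun n => by positivity) hle (hs.mul_left 2)
  refine ⟨hs2, (hs2.tsum_le_tsum hle (hs.mul_left 2)).trans ?_⟩
  rw [tsum_mul_left]
  linarith

/-- Elliptic regularity: the norm of the phase space is controlled by the phase velocity. -/
lemma IsSingularPotential.exists_phaseNormSq_le {Φ : ℝ → ℝ} (hΦ : IsSingularPotential Φ) :
    ∃ E : ℝ → ℝ, ∀ ε ∈ Ioc (0 : ℝ) 1, ∀ A : ℝ, 0 ≤ A → ∀ f : L2Torus,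
      MemPhaseSpace ε (deriv Φ) f →
      velocityEnergy ε (phaseVelocity ε (deriv Φ) f) ≤ ENNReal.ofReal A →
      phaseNormSq ε (deriv Φ) f ≤ ENNReal.ofReal (E A) := by
  obtain ⟨α, hα, hmono⟩ := hΦ.exists_semimonotone
  obtain ⟨C, hC, hcoer⟩ := hΦ.exists_abs_le
  -- Here `2(2A+α²)` bounds `∑ |n|⁴|f̂|²`; the squared term bounds the mean of `φ(f)`, and `4(2A+α²)
  -- + 4A` its nonzero modes. The final `A` is the velocity energy itself.
  refine ⟨fun A => (2 * Real.pi) ^ 2 * (2 + 2 * (2 * (2 * A + α ^ 2)))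
    + (2 * Real.pi) ^ 2 * (2 * (2 * (2 * A + α ^ 2)) + 2 * (2 * A)
      + (2 * (2 * (2 * A + α ^ 2) + 2 * A + 1) + C) ^ 2) + A, fun ε hε A hA f hf hv => ?_⟩
  set g : Torus2 → ℝ := fun x => deriv Φ (f x) with hg
  have hgL : MemLp g 2 volume := hf.memLp_phi
  have hfL := memLp_L2Torus f
  obtain ⟨hsd, hD⟩ := summable_sq_drivingTerm hε hA hv
  set d := drivingTerm (deriv Φ) f with hd
  have hdn : ∀ n, n ≠ 0 → d n = -(freqSq n : ℂ) * fourierCoeffs f n - fourierCoeffs g n :=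
    fun n hn => drivingTerm_of_ne _ f hn
  have hs4 := hf.summable_sq
  obtain ⟨hsT, hT⟩ := tsum_freqSq_semimonotone hfL hgL (S := Ioo (-1) 1) (ψ := deriv Φ)
    (hf.range.mono fun x hx => ⟨hx, rfl⟩) hmono hs4
  have hs0 := hasSum_sq_fourierCoeffs hfL
  have hf1 : (⨍ x, f x ^ 2) ≤ 1 := by
    rw [torus_average, smul_eq_mul]
    have h1 : ∫ x, f x ^ 2 ≤ ∫ _ : Torus2, (1 : ℝ) := by
      refine integral_mono_ae hfL.integrable_sq (integrable_const _) ?_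
      filter_upwards [hf.abs_le_one] with x hx
      exact (sq_le_one_iff_abs_le_one _).mpr hx
    rw [integral_const, torus_volume_real_univ, smul_eq_mul, mul_one] at h1
    rw [inv_mul_le_iff₀ (by positivity), mul_one]
    exact h1
  have hS0 : ∑' n, ‖fourierCoeffs f n‖ ^ 2 ≤ 1 := hs0.tsum_eq.trans_le hf1
  -- The identity `ĝ = -|n|²f̂ - d` paired with `|n|²f̂`. Young splits the `d` and `α` terms, each
  -- taking `|n|⁴|f̂|²/4`; after summation the semimonotone term is nonnegative and is dropped.
  have hterm4 : ∀ n, freqSq n ^ 2 * ‖fourierCoeffs f n‖ ^ 2 * (1 / 2)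
      + freqSq n * (((starRingEnd ℂ) (fourierCoeffs g n) * fourierCoeffs f n).re
        + α * ‖fourierCoeffs f n‖ ^ 2) ≤ ‖d n‖ ^ 2 + α ^ 2 * ‖fourierCoeffs f n‖ ^ 2 := fun n => by
    by_cases hn : n = 0
    · rw [hn, freqSq_zero]
      simp only [ne_eq, OfNat.ofNat_ne_zero, not_false_eq_true, zero_pow, zero_mul, add_zero]
      positivity
    have hP : fourierCoeffs g n = -(freqSq n : ℂ) * fourierCoeffs f n - d n := by
      rw [hdn n hn]
      ring
    have hre : ((starRingEnd ℂ) (fourierCoeffs g n) * fourierCoeffs f n).re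
        = -(freqSq n * ‖fourierCoeffs f n‖ ^ 2)
          - ((starRingEnd ℂ) (d n) * fourierCoeffs f n).re := by
      rw [hP, map_sub, map_mul, map_neg, Complex.conj_ofReal, sub_mul, mul_assoc, Complex.conj_mul',
        ← Complex.ofReal_pow, Complex.sub_re, ← Complex.ofReal_neg, Complex.re_ofReal_mul,
        Complex.ofReal_re]
      ring
    have hcross : -((starRingEnd ℂ) (d n) * fourierCoeffs f n).re
        ≤ ‖d n‖ * ‖fourierCoeffs f n‖ := by
      refine (neg_le_abs _).trans ((Complex.abs_re_le_norm _).trans ?_)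
      rw [norm_mul, RCLike.norm_conj]
    have hx := freqSq_nonneg n
    rw [hre]
    have h5 := mul_le_mul_of_nonneg_left hcross hx
    nlinarith [sq_nonneg (‖d n‖ - freqSq n * ‖fourierCoeffs f n‖ / 2),
      sq_nonneg (α * ‖fourierCoeffs f n‖ - freqSq n * ‖fourierCoeffs f n‖ / 2)]
  have hS4 : ∑' n, freqSq n ^ 2 * ‖fourierCoeffs f n‖ ^ 2 ≤ 2 * (2 * A + α ^ 2) := by
    have h := ((hs4.mul_right (1 / 2)).add hsT).tsum_le_tsum hterm4
      (hsd.add (hs0.summable.mul_left (α ^ 2)))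
    rw [(hs4.mul_right (1 / 2)).tsum_add hsT, hsd.tsum_add (hs0.summable.mul_left (α ^ 2)),
      tsum_mul_left, tsum_mul_right] at h
    nlinarith [mul_le_mul_of_nonneg_left hS0 (sq_nonneg α)]
  set S4 := ∑' n, freqSq n ^ 2 * ‖fourierCoeffs f n‖ ^ 2 with hS4def
  have hgterm : ∀ n, n ≠ 0 → ‖fourierCoeffs g n‖ ^ 2
      ≤ 2 * (freqSq n ^ 2 * ‖fourierCoeffs f n‖ ^ 2) + 2 * ‖d n‖ ^ 2 := fun n hn => by
    have hP : fourierCoeffs g n = -((freqSq n : ℂ) * fourierCoeffs f n + d n) := by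
      rw [hdn n hn]
      ring
    have h1 : ‖fourierCoeffs g n‖ ≤ freqSq n * ‖fourierCoeffs f n‖ + ‖d n‖ := by
      rw [hP, norm_neg]
      refine (norm_add_le _ _).trans_eq ?_
      rw [norm_mul, Complex.norm_real, Real.norm_eq_abs, abs_of_nonneg (freqSq_nonneg n)]
    have h2 := pow_le_pow_left₀ (norm_nonneg _) h1 2
    nlinarith [sq_nonneg (freqSq n * ‖fourierCoeffs f n‖ - ‖d n‖)]
  have hsB : Summable fun n => 2 * (freqSq n ^ 2 * ‖fourierCoeffs f n‖ ^ 2) + 2 * ‖d n‖ ^ 2 :=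
    (hs4.mul_left 2).add (hsd.mul_left 2)
  have htB : ∑' n, (2 * (freqSq n ^ 2 * ‖fourierCoeffs f n‖ ^ 2) + 2 * ‖d n‖ ^ 2)
      ≤ 2 * (2 * (2 * A + α ^ 2)) + 2 * (2 * A) := by
    rw [(hs4.mul_left 2).tsum_add (hsd.mul_left 2), tsum_mul_left, tsum_mul_left]
    linarith
  have hf0 : fourierCoeffs f 0 = 0 := by
    rw [fourierCoeffs_zero_freq, hf.mean_zero]
    simp
  -- Because `f̂(0) = 0`, only the nonzero modes of `φ(f)` enter, and these are already bounded.
  have hfg : (⨍ x, g x * f x) ≤ 2 * (2 * A + α ^ 2) + 2 * A + 1 := by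
    have h := hasSum_fourierCoeffs hgL hfL
    rw [← h.tsum_eq]
    have hle : ∀ n, ((starRingEnd ℂ) (fourierCoeffs g n) * fourierCoeffs f n).re
        ≤ (2 * (freqSq n ^ 2 * ‖fourierCoeffs f n‖ ^ 2) + 2 * ‖d n‖ ^ 2) * (1 / 2)
          + ‖fourierCoeffs f n‖ ^ 2 := fun n => by
      by_cases hn : n = 0
      · rw [hn, hf0]
        simp only [mul_zero, Complex.zero_re]
        positivity
      have h1 := Complex.re_le_norm ((starRingEnd ℂ) (fourierCoeffs g n) * fourierCoeffs f n)
      rw [norm_mul, RCLike.norm_conj] at h1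
      nlinarith [hgterm n hn, sq_nonneg (‖fourierCoeffs g n‖ - ‖fourierCoeffs f n‖)]
    refine (h.summable.tsum_le_tsum hle ((hsB.mul_right _).add hs0.summable)).trans ?_
    rw [(hsB.mul_right _).tsum_add hs0.summable, tsum_mul_right]
    linarith
  have hmean : |⨍ x, g x| ≤ 2 * (2 * (2 * A + α ^ 2) + 2 * A + 1) + C := by
    have hpi : (0 : ℝ) < ((2 * Real.pi) ^ 2)⁻¹ := by positivity
    have hfgi : Integrable (fun x => g x * f x) := hgL.integrable_mul hfL
    have h1 : |∫ x, g x| ≤ ∫ x, (2 * (g x * f x) + C) := by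
      refine abs_integral_le_integral_abs.trans ?_
      refine integral_mono_ae hgL.integrable_torus.abs
        ((hfgi.const_mul 2).add (integrable_const C)) ?_
      filter_upwards [hf.range] with x hx
      exact hcoer _ hx
    rw [integral_add (hfgi.const_mul 2) (integrable_const C), integral_const_mul, integral_const,
      torus_volume_real_univ, smul_eq_mul] at h1
    rw [torus_average, smul_eq_mul] at hfg ⊢
    rw [abs_mul, abs_of_pos hpi]
    have h2 := mul_le_mul_of_nonneg_left h1 hpi.le
    have h3 : ((2 * Real.pi) ^ 2)⁻¹ * (2 * (∫ x, g x * f x) + (2 * Real.pi) ^ 2 * C)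
        = 2 * (((2 * Real.pi) ^ 2)⁻¹ * ∫ x, g x * f x) + C := by
      have := Real.pi_ne_zero
      field_simp
    rw [h3] at h2
    linarith
  have hgsq : (⨍ x, g x ^ 2) ≤ 2 * (2 * (2 * A + α ^ 2)) + 2 * (2 * A)
      + (2 * (2 * (2 * A + α ^ 2) + 2 * A + 1) + C) ^ 2 := by
    have h := hasSum_sq_fourierCoeffs hgL
    -- Parseval with the zero mode isolated: it is the mean, the other modes come from the equation.
    rw [← h.tsum_eq, h.summable.tsum_eq_add_tsum_ite 0, add_comm]
    refine add_le_add (le_trans ?_ htB) ?_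
    · refine Summable.tsum_le_tsum (fun n => ?_) ?_ hsB
      · split_ifs with hn
        · positivity
        · exact hgterm n hn
      · refine Summable.of_nonneg_of_le (fun n => ?_) (fun n => ?_) h.summable
        · split_ifs <;> positivity
        · split_ifs
          · positivity
          · exact le_rfl
    · rw [fourierCoeffs_zero_freq, Complex.norm_real, Real.norm_eq_abs]
      exact pow_le_pow_left₀ (abs_nonneg _) hmean 2
  have hpart1 : sobolevNormSq 2 (fourierCoeffs f)
      ≤ ENNReal.ofReal ((2 * Real.pi) ^ 2 * (2 + 2 * (2 * (2 * A + α ^ 2)))) := by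
    have hsum : Summable fun n => (2 * Real.pi) ^ 2 * (2 * ‖fourierCoeffs f n‖ ^ 2
        + 2 * (freqSq n ^ 2 * ‖fourierCoeffs f n‖ ^ 2)) :=
      ((hs0.summable.mul_left 2).add (hs4.mul_left 2)).mul_left _
    have hle : sobolevNormSq 2 (fourierCoeffs f) ≤ ∑' n, ENNReal.ofReal ((2 * Real.pi) ^ 2
        * (2 * ‖fourierCoeffs f n‖ ^ 2 + 2 * (freqSq n ^ 2 * ‖fourierCoeffs f n‖ ^ 2))) := by
      rw [sobolevNormSq_two]
      refine ENNReal.tsum_le_tsum fun n => ENNReal.ofReal_le_ofReal ?_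
      rw [mul_assoc]
      refine mul_le_mul_of_nonneg_left ?_ (by positivity)
      have : (1 + freqSq n) ^ 2 ≤ 2 + 2 * freqSq n ^ 2 := by nlinarith [sq_nonneg (freqSq n - 1)]
      nlinarith [mul_le_mul_of_nonneg_right this (sq_nonneg ‖fourierCoeffs f n‖)]
    refine hle.trans ?_
    rw [tsum_ofReal_eq (fun n => by positivity) hsum, tsum_mul_left,
      (hs0.summable.mul_left 2).tsum_add (hs4.mul_left 2), tsum_mul_left, tsum_mul_left]
    refine ENNReal.ofReal_le_ofReal (mul_le_mul_of_nonneg_left ?_ (by positivity))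
    linarith
  have hpart2 : eLpNorm g 2 volume ^ 2 ≤ ENNReal.ofReal ((2 * Real.pi) ^ 2
      * (2 * (2 * (2 * A + α ^ 2)) + 2 * (2 * A)
      + (2 * (2 * (2 * A + α ^ 2) + 2 * A + 1) + C) ^ 2)) := by
    rw [hgL.eLpNorm_sq_torus]
    refine ENNReal.ofReal_le_ofReal ?_
    rw [torus_average, smul_eq_mul, inv_mul_le_iff₀ (by positivity)] at hgsq
    exact hgsq
  rw [phaseNormSq, add_assoc]
  refine (add_le_add (add_le_add hpart1 hpart2) hv).trans ?_
  rw [← ENNReal.ofReal_add (by positivity) (by positivity),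
    ← ENNReal.ofReal_add (by positivity) hA]

/-! ### Absolute continuity in time and Grönwall's inequality. -/

lemma AbsolutelyContinuousOnInterval.of_dist_le {X Y : Type*} [PseudoMetricSpace X]
    [PseudoMetricSpace Y] {f : ℝ → X} {g : ℝ → Y} {a b K : ℝ}
    (hg : AbsolutelyContinuousOnInterval g a b)
    (h : ∀ x ∈ uIcc a b, ∀ y ∈ uIcc a b, dist (f x) (f y) ≤ K * dist (g x) (g y)) :
    AbsolutelyContinuousOnInterval f a b := by
  rw [absolutelyContinuousOnInterval_iff] at hg ⊢
  intro ε hε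
  have hK : 0 < |K| + 1 := by positivity
  obtain ⟨δ, hδ, H⟩ := hg (ε / (|K| + 1)) (div_pos hε hK)
  refine ⟨δ, hδ, fun E hE hlt => ?_⟩
  have h1 := H E hE hlt
  have h2 : ∑ i ∈ Finset.range E.1, dist (f (E.2 i).1) (f (E.2 i).2)
      ≤ (|K| + 1) * ∑ i ∈ Finset.range E.1, dist (g (E.2 i).1) (g (E.2 i).2) := by
    rw [Finset.mul_sum]
    refine Finset.sum_le_sum fun i hi => ?_
    refine (h _ (hE.1 i hi).1 _ (hE.1 i hi).2).trans ?_
    exact mul_le_mul_of_nonneg_right ((le_abs_self K).trans (by linarith)) dist_nonneg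
  rw [lt_div_iff₀ hK] at h1
  linarith

lemma IsTimeDerivOn.mono {I J : Set ℝ} {f f' : ℝ → L2Torus} (h : IsTimeDerivOn J f f')
    (hIJ : I ⊆ J) : IsTimeDerivOn I f f' :=
  fun s hs t ht => h s (hIJ hs) t (hIJ ht)

lemma IsTimeDerivOn.ae_hasDerivAt {b : ℝ} (hb : 0 ≤ b) {V V' : ℝ → L2Torus}
    (h : IsTimeDerivOn (Icc 0 b) V V') :
    ∀ᵐ t ∂volume.restrict (Ioo 0 b), HasDerivAt V (V' t) t := by
  have h0 : (0 : ℝ) ∈ Icc 0 b := left_mem_Icc.mpr hb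
  have hbm : b ∈ Icc 0 b := right_mem_Icc.mpr hb
  have hd := (h 0 h0 b hbm).1.ae_hasDerivAt_integral
  rw [ae_restrict_iff' measurableSet_Ioo]
  filter_upwards [hd] with t ht htI
  have ht' := ht (by rw [uIcc_of_le hb]; exact Ioo_subset_Icc_self htI) 0 left_mem_uIcc
  refine (ht'.const_add (V 0)).congr_of_eventuallyEq ?_
  filter_upwards [Ioo_mem_nhds htI.1 htI.2] with s hs
  rw [← (h 0 h0 s (Ioo_subset_Icc_self hs)).2]
  abel

/-- Increments of `V` are dominated by those of the scalar primitive of `‖V'‖`, and squaring is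
Lipschitz on the bounded range of `‖J V‖`. This permits the fundamental theorem of calculus for the
energy. -/
lemma IsTimeDerivOn.absolutelyContinuous_norm_sq {G : Type*} [NormedAddCommGroup G]
    [NormedSpace ℝ G] (J : L2Torus →L[ℝ] G) {b : ℝ} (hb : 0 ≤ b) {V V' : ℝ → L2Torus}
    (h : IsTimeDerivOn (Icc 0 b) V V') :
    AbsolutelyContinuousOnInterval (fun t => ‖J (V t)‖ ^ 2) 0 b := by
  have h0 : (0 : ℝ) ∈ Icc 0 b := left_mem_Icc.mpr hb
  have hbm : b ∈ Icc 0 b := right_mem_Icc.mpr hb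
  have hint : IntervalIntegrable (fun t => ‖V' t‖) volume 0 b := (h 0 h0 b hbm).1.norm
  have hg := hint.absolutelyContinuousOnInterval_intervalIntegral (c := 0) left_mem_uIcc
  set g : ℝ → ℝ := fun t => ∫ v in 0..t, ‖V' v‖ with hgdef
  have hdist : ∀ s ∈ Icc 0 b, ∀ t ∈ Icc 0 b, ‖V t - V s‖ ≤ |g t - g s| := fun s hs t ht => by
    rw [(h s hs t ht).2, hgdef]
    simp only
    rw [intervalIntegral.integral_interval_sub_left (h 0 h0 t ht).1.norm (h 0 h0 s hs).1.norm]
    exact intervalIntegral.norm_integral_le_abs_integral_norm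
  obtain ⟨M, hM⟩ := hg.exists_bound
  have hVb : ∀ t ∈ Icc 0 b, ‖V t‖ ≤ ‖V 0‖ + 2 * M := fun t ht => by
    have h1 := hdist 0 h0 t ht
    have h2 := hM t (by rwa [uIcc_of_le hb])
    have h3 := hM 0 (by rwa [uIcc_of_le hb])
    rw [Real.norm_eq_abs] at h2 h3
    have h4 := abs_sub (g t) (g 0)
    have h5 : ‖V t‖ ≤ ‖V 0‖ + ‖V t - V 0‖ := by
      simpa using norm_add_le (V 0) (V t - V 0)
    linarith
  refine hg.of_dist_le (K := ‖J‖ * (2 * (‖J‖ * (‖V 0‖ + 2 * M)))) fun s hs t ht => ?_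
  rw [uIcc_of_le hb] at hs ht
  rw [Real.dist_eq, Real.dist_eq]
  have e : ‖J (V s)‖ ^ 2 - ‖J (V t)‖ ^ 2
      = (‖J (V s)‖ - ‖J (V t)‖) * (‖J (V s)‖ + ‖J (V t)‖) := by ring
  have h1 : |‖J (V s)‖ - ‖J (V t)‖| ≤ ‖J‖ * |g s - g t| := by
    refine (abs_norm_sub_norm_le _ _).trans ?_
    rw [← map_sub]
    exact (J.le_opNorm _).trans (mul_le_mul_of_nonneg_left (hdist t ht s hs) (norm_nonneg _))
  have h2 : ∀ t ∈ Icc 0 b, ‖J (V t)‖ ≤ ‖J‖ * (‖V 0‖ + 2 * M) := fun t ht =>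
    (J.le_opNorm _).trans (mul_le_mul_of_nonneg_left (hVb t ht) (norm_nonneg _))
  rw [e, abs_mul, abs_of_nonneg (by positivity : 0 ≤ ‖J (V s)‖ + ‖J (V t)‖)]
  calc |‖J (V s)‖ - ‖J (V t)‖| * (‖J (V s)‖ + ‖J (V t)‖)
      ≤ (‖J‖ * |g s - g t|) * (2 * (‖J‖ * (‖V 0‖ + 2 * M))) := by
        refine mul_le_mul h1 ?_ (by positivity) (by positivity)
        linarith [h2 s hs, h2 t ht]
    _ = _ := by ring

/-- Grönwall's inequality for an absolutely continuous energy with dissipation. -/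
lemma gronwall_dissipation {b : ℝ} (hb : 0 ≤ b) {y y' k g D : ℝ → ℝ}
    (hac : AbsolutelyContinuousOnInterval y 0 b)
    (hder : ∀ᵐ t ∂volume.restrict (Ioo 0 b), HasDerivAt y (y' t) t)
    (hineq : ∀ᵐ t ∂volume.restrict (Ioo 0 b), y' t + D t ≤ k t * y t + g t)
    (hk : IntervalIntegrable k volume 0 b) (hk0 : ∀ t, 0 ≤ k t)
    (hg : IntervalIntegrable g volume 0 b) (hg0 : ∀ t, 0 ≤ g t)
    (hD : AEStronglyMeasurable D (volume.restrict (Ioc 0 b))) (hD0 : ∀ t, 0 ≤ D t) :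
    IntervalIntegrable D volume 0 b ∧
      y b + ∫ t in 0..b, D t
        ≤ Real.exp (∫ t in 0..b, k t) * (y 0 + ∫ t in 0..b, g t) := by
  have hres : volume.restrict (Ioc (0 : ℝ) b) = volume.restrict (Ioo 0 b) :=
    Measure.restrict_congr_set Ioo_ae_eq_Ioc.symm
  have hyc := hac.continuousOn
  have hky : IntervalIntegrable (fun t => k t * y t) volume 0 b := hk.mul_continuousOn hyc
  have hdy := hac.intervalIntegrable_deriv
  -- Integrability of the dissipation is a conclusion: almost everywhere `0 ≤ D ≤ k y + g - y'`, and
  -- the right side is integrable.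
  have hDi : IntervalIntegrable D volume 0 b := by
    rw [intervalIntegrable_iff_integrableOn_Ioc_of_le hb]
    have hbd := ((hky.add hg).sub hdy)
    rw [intervalIntegrable_iff_integrableOn_Ioc_of_le hb] at hbd
    refine Integrable.mono' hbd hD ?_
    rw [hres]
    filter_upwards [hder, hineq] with t h1 h2
    rw [Real.norm_eq_abs, abs_of_nonneg (hD0 t)]
    simp only [h1.deriv]
    linarith
  refine ⟨hDi, ?_⟩
  set κ : ℝ → ℝ := fun t => ∫ v in 0..t, k v with hκ
  have hκac : AbsolutelyContinuousOnInterval κ 0 b :=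
    hk.absolutelyContinuousOnInterval_intervalIntegral left_mem_uIcc
  have hki : ∀ t ∈ Icc 0 b, IntervalIntegrable k volume 0 t := fun t ht =>
    hk.mono_set (by rw [uIcc_of_le hb, uIcc_of_le ht.1]; exact Icc_subset_Icc_right ht.2)
  have hκ0 : ∀ t ∈ Icc 0 b, 0 ≤ κ t := fun t ht =>
    intervalIntegral.integral_nonneg ht.1 fun s _ => hk0 s
  have hκb : ∀ t ∈ Icc 0 b, κ t ≤ κ b := fun t ht => by
    have h1 : κ b - κ t = ∫ v in t..b, k v :=
      intervalIntegral.integral_interval_sub_left hk (hki t ht)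
    have h2 : 0 ≤ ∫ v in t..b, k v :=
      intervalIntegral.integral_nonneg ht.2 fun s _ => hk0 s
    linarith
  -- `p ↦ e^{-p}` is `1`-Lipschitz on `[0, ∞)`, where `κ` takes its values.
  have hexp : AbsolutelyContinuousOnInterval (fun t => Real.exp (-κ t)) 0 b := by
    refine hκac.of_dist_le (K := 1) fun s hs t ht => ?_
    rw [uIcc_of_le hb] at hs ht
    rw [one_mul, Real.dist_eq, Real.dist_eq]
    have key : ∀ p q : ℝ, 0 ≤ p → p ≤ q → |Real.exp (-p) - Real.exp (-q)| ≤ |p - q| := by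
      intro p q hp hpq
      have h1 : Real.exp (-q) ≤ Real.exp (-p) := Real.exp_le_exp.mpr (by linarith)
      have h2 : Real.exp (-p) ≤ 1 := Real.exp_le_one_iff.mpr (by linarith)
      have h3 := Real.add_one_le_exp (p - q)
      have h4 : Real.exp (-q) = Real.exp (-p) * Real.exp (p - q) := by
        rw [← Real.exp_add]; congr 1; ring
      rw [abs_of_nonneg (by linarith), abs_of_nonpos (by linarith), h4]
      nlinarith [Real.exp_pos (-p)]
    rcases le_total (κ s) (κ t) with h | h
    · exact key _ _ (hκ0 s hs) h
    · rw [abs_sub_comm, abs_sub_comm (κ s)]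
      exact key _ _ (hκ0 t ht) h
  have hP := hexp.mul hac
  have hFTC := hP.integral_deriv_eq_sub
  have hkd : ∀ᵐ t ∂volume.restrict (Ioo 0 b), HasDerivAt κ (k t) t := by
    rw [ae_restrict_iff' measurableSet_Ioo]
    filter_upwards [hk.ae_hasDerivAt_integral] with t ht htI
    exact ht (by rw [uIcc_of_le hb]; exact Ioo_subset_Icc_self htI) 0 left_mem_uIcc
  -- Integrating factor: the forcing keeps a weight at most `1`, while the dissipation keeps at
  -- least `e^{-κ(b)}`, the smallest value of the factor.
  have hmono : ∫ t in 0..b, deriv ((fun t => Real.exp (-κ t)) * y) t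
      ≤ ∫ t in 0..b, (g t - Real.exp (-κ b) * D t) := by
    rw [intervalIntegral.integral_of_le hb, intervalIntegral.integral_of_le hb]
    refine setIntegral_mono_ae_restrict
      ((intervalIntegrable_iff_integrableOn_Ioc_of_le hb).mp hP.intervalIntegrable_deriv)
      ((intervalIntegrable_iff_integrableOn_Ioc_of_le hb).mp (hg.sub (hDi.const_mul _))) ?_
    rw [hres]
    filter_upwards [hder, hineq, hkd, ae_restrict_mem measurableSet_Ioo] with t h1 h2 h3 htI
    have hd : HasDerivAt ((fun t => Real.exp (-κ t)) * y)
        (Real.exp (-κ t) * -k t * y t + Real.exp (-κ t) * y' t) t := h3.neg.exp.mul h1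
    rw [hd.deriv]
    have ht := Ioo_subset_Icc_self htI
    have e1 : Real.exp (-κ t) ≤ 1 := Real.exp_le_one_iff.mpr (by linarith [hκ0 t ht])
    have e2 : Real.exp (-κ b) ≤ Real.exp (-κ t) := Real.exp_le_exp.mpr (by linarith [hκb t ht])
    have e3 := Real.exp_pos (-κ t)
    have e4 := mul_le_mul_of_nonneg_left h2 e3.le
    have e5 := mul_le_mul_of_nonneg_right e1 (hg0 t)
    have e6 := mul_le_mul_of_nonneg_right e2 (hD0 t)
    linarith
  rw [hFTC, intervalIntegral.integral_sub hg (hDi.const_mul _),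
    intervalIntegral.integral_const_mul] at hmono
  have hκz : κ 0 = 0 := intervalIntegral.integral_same
  simp only [Pi.mul_apply, hκz, neg_zero, Real.exp_zero, one_mul] at hmono
  have h5 : Real.exp (-κ b) * (y b + ∫ t in 0..b, D t) ≤ y 0 + ∫ t in 0..b, g t := by linarith
  have h6 := mul_le_mul_of_nonneg_left h5 (Real.exp_pos (κ b)).le
  rwa [← mul_assoc, ← Real.exp_add, add_neg_cancel, Real.exp_zero, one_mul] at h6

/-! ### The velocity energy as a squared Hilbert norm. -/

/-- The weighted Fourier transform whose squared norm is `ε ‖f‖²_{L²} + ‖f‖²_{Ḣ⁻¹}`. -/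
noncomputable def energySeq (ε : ℝ) (f : L2Torus) (n : Freq) : ℂ :=
  (2 * Real.pi * √(ε + (freqSq n)⁻¹) : ℝ) * fourierCoeffs f n

lemma inv_freqSq_le_one (n : Freq) : (freqSq n)⁻¹ ≤ 1 := by
  by_cases hn : n = 0
  · simp [hn, freqSq_zero]
  · exact inv_le_one_of_one_le₀ (one_le_freqSq hn)

lemma norm_sq_energySeq {ε : ℝ} (hε : 0 ≤ ε) (f : L2Torus) (n : Freq) :
    ‖energySeq ε f n‖ ^ 2 = (2 * Real.pi) ^ 2 * (ε + (freqSq n)⁻¹) * ‖fourierCoeffs f n‖ ^ 2 := by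
  have h0 := inv_nonneg.mpr (freqSq_nonneg n)
  rw [energySeq, norm_mul, Complex.norm_real, Real.norm_eq_abs, mul_pow, sq_abs, mul_pow,
    Real.sq_sqrt (by positivity)]

lemma norm_sq_energySeq_le {ε : ℝ} (hε : 0 ≤ ε) (f : L2Torus) (n : Freq) :
    ‖energySeq ε f n‖ ^ 2 ≤ (ε + 1) * ((2 * Real.pi) ^ 2 * ‖fourierCoeffs f n‖ ^ 2) := by
  rw [norm_sq_energySeq hε]
  have h1 := mul_le_mul_of_nonneg_right (inv_freqSq_le_one n)
    (show 0 ≤ (2 * Real.pi) ^ 2 * ‖fourierCoeffs f n‖ ^ 2 by positivity)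
  nlinarith

lemma memℓp_energySeq {ε : ℝ} (hε : 0 ≤ ε) (f : L2Torus) :
    Memℓp (E := fun _ : Freq => ℂ) (energySeq ε f) 2 := by
  refine memℓp_gen ?_
  simp only [ENNReal.toReal_ofNat, Real.rpow_two]
  exact Summable.of_nonneg_of_le (fun n => by positivity) (norm_sq_energySeq_le hε f)
    ((hasSum_norm_sq_L2Torus f).summable.mul_left _)

/-- The bounded operator `f ↦ energySeq ε f`. -/
noncomputable def energyMap (ε : ℝ≥0) : L2Torus →L[ℝ] lp (fun _ : Freq => ℂ) 2 :=
  LinearMap.mkContinuous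
    { toFun := fun f => ⟨energySeq ε f, memℓp_energySeq ε.2 f⟩
      map_add' := fun f g => by
        ext n
        simp only [energySeq, fourierCoeffs_Lp_add, Pi.add_apply, mul_add, lp.coeFn_add]
      map_smul' := fun r f => by
        ext n
        simp only [energySeq, fourierCoeffs_Lp_smul, Pi.smul_apply, lp.coeFn_smul,
          RingHom.id_apply, smul_eq_mul, Complex.real_smul]
        ring }
    (√(ε + 1)) fun f => by
      refine le_of_sq_le_sq ?_ (by positivity)
      have h := lp.norm_rpow_eq_tsum (p := 2) (by norm_num)
        (⟨energySeq ε f, memℓp_energySeq ε.2 f⟩ : lp (fun _ : Freq => ℂ) 2)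
      simp only [ENNReal.toReal_ofNat, Real.rpow_two] at h
      rw [mul_pow, Real.sq_sqrt (by positivity)]
      refine h.trans_le ?_
      rw [← (hasSum_norm_sq_L2Torus f).tsum_eq, ← tsum_mul_left]
      have hs := (hasSum_norm_sq_L2Torus f).summable.mul_left ((ε : ℝ) + 1)
      exact Summable.tsum_le_tsum (norm_sq_energySeq_le ε.2 f)
        (Summable.of_nonneg_of_le (fun n => by positivity) (norm_sq_energySeq_le ε.2 f) hs) hs

lemma energyMap_apply (ε : ℝ≥0) (f : L2Torus) (n : Freq) : energyMap ε f n = energySeq ε f n := rfl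

lemma hasSum_norm_sq_energyMap (ε : ℝ≥0) (f : L2Torus) :
    HasSum (fun n => (2 * Real.pi) ^ 2 * (ε + (freqSq n)⁻¹) * ‖fourierCoeffs f n‖ ^ 2)
      (‖energyMap ε f‖ ^ 2) := by
  have h := lp.hasSum_norm (p := 2) (by norm_num) (energyMap ε f)
  simp only [ENNReal.toReal_ofNat, Real.rpow_two] at h
  simpa only [energyMap_apply, norm_sq_energySeq ε.coe_nonneg] using h

lemma velocityEnergy_fourierCoeffs (ε : ℝ≥0) (f : L2Torus) :
    velocityEnergy ε (fourierCoeffs f) = ENNReal.ofReal (‖energyMap ε f‖ ^ 2) := by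
  have h := hasSum_norm_sq_energyMap ε f
  rw [velocityEnergy_eq ε.coe_nonneg, tsum_ofReal_eq (fun n => ?_) h.summable, h.tsum_eq]
  have h0 := inv_nonneg.mpr (freqSq_nonneg n)
  positivity

lemma hasSum_inner_energyMap (ε : ℝ≥0) (f g : L2Torus) :
    HasSum (fun n => (2 * Real.pi) ^ 2 * (ε + (freqSq n)⁻¹)
        * ((starRingEnd ℂ) (fourierCoeffs f n) * fourierCoeffs g n).re)
      (inner ℂ (energyMap ε f) (energyMap ε g)).re := by
  have h := Complex.hasSum_re (lp.hasSum_inner (energyMap ε f) (energyMap ε g))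
  convert! h using 1
  ext n
  have h0 := inv_nonneg.mpr (freqSq_nonneg n)
  have hsq : √((ε : ℝ) + (freqSq n)⁻¹) * √((ε : ℝ) + (freqSq n)⁻¹) = ε + (freqSq n)⁻¹ :=
    Real.mul_self_sqrt (by positivity)
  rw [energyMap_apply, energyMap_apply, energySeq, energySeq, RCLike.inner_apply, map_mul,
    Complex.conj_ofReal, mul_mul_mul_comm, ← Complex.ofReal_mul, Complex.re_ofReal_mul,
    mul_comm (fourierCoeffs g n)]
  linear_combination (-(2 * Real.pi) ^ 2
    * ((starRingEnd ℂ) (fourierCoeffs f n) * fourierCoeffs g n).re) * hsq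

/-- Since the energy is the squared norm of a bounded linear image, it is differentiated by the
product rule for the inner product, without exchanging a derivative with the Fourier sum. -/
lemma hasDerivAt_norm_sq_energyMap (ε : ℝ≥0) {V : ℝ → L2Torus} {v : L2Torus} {t : ℝ}
    (h : HasDerivAt V v t) :
    HasDerivAt (fun t => ‖energyMap ε (V t)‖ ^ 2)
      (2 * (inner ℂ (energyMap ε (V t)) (energyMap ε v)).re) t := by
  have h1 : HasDerivAt (fun t => energyMap ε (V t)) (energyMap ε v) t :=
    (energyMap ε).hasFDerivAt.comp_hasDerivAt t h
  have h2 := Complex.reCLM.hasFDerivAt.comp_hasDerivAt t (h1.inner ℂ h1)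
  have e : (fun t => ‖energyMap ε (V t)‖ ^ 2)
      = Complex.reCLM ∘ fun t => inner ℂ (energyMap ε (V t)) (energyMap ε (V t)) := by
    ext s
    rw [Function.comp_apply, Complex.reCLM_apply, inner_self_eq_norm_sq_to_K]
    norm_cast
  rw [e]
  convert! h2 using 1
  rw [Complex.reCLM_apply, Complex.add_re, ← inner_conj_symm (energyMap ε v), Complex.conj_re]
  ring

/-! ### The equation at a fixed time. -/

/-- The equation `ε v + (-Δ)⁻¹ ((u·∇)f + v) = Δf - φ(f) + m(φ(f))` at a fixed time. -/
def SolvesAt (ε : ℝ) (φ : ℝ → ℝ) (u : Fin 2 → L2Torus) (f v : L2Torus) : Prop :=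
  ∃ G : Fin 2 → L2Torus, (∀ j, IsWeakPartial j f (G j)) ∧
    (ε : ℂ) • fourierCoeffs v
        + invNegLaplacianF (fourierCoeffs (fun x => ∑ j, u j x * G j x) + fourierCoeffs v)
      = drivingTerm φ f

/-- The divergence of a vector field given by Fourier coefficients. -/
noncomputable def divF (a : Fin 2 → Freq → ℂ) (n : Freq) : ℂ :=
  ∑ j, Complex.I * (n j : ℂ) * a j n

lemma norm_divF_le (a : Fin 2 → Freq → ℂ) (n : Freq) :
    ‖divF a n‖ ≤ ∑ j, |(n j : ℝ)| * ‖a j n‖ := by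
  refine (norm_sum_le _ _).trans (Finset.sum_le_sum fun j _ => le_of_eq ?_)
  rw [norm_mul, norm_mul, Complex.norm_I, one_mul, Complex.norm_intCast]

/-- Cauchy–Schwarz over the two components; it is the bound of the divergence from `L²` to `Ḣ⁻¹`. -/
lemma norm_divF_sq_le (a : Fin 2 → Freq → ℂ) (n : Freq) :
    ‖divF a n‖ ^ 2 ≤ freqSq n * ∑ j, ‖a j n‖ ^ 2 := by
  refine (pow_le_pow_left₀ (norm_nonneg _) (norm_divF_le a n) 2).trans ?_
  refine (Finset.sum_mul_sq_le_sq_mul_sq _ _ _).trans_eq ?_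
  simp only [sq_abs, freqSq]

/-- At the zero mode both `(-Δ)⁻¹` and the driving term vanish, leaving `ε v̂(0) = 0`. -/
lemma SolvesAt.coeff_zero {ε : ℝ} (hε : 0 < ε) {φ : ℝ → ℝ} {u : Fin 2 → L2Torus}
    {f v : L2Torus} (h : SolvesAt ε φ u f v) : fourierCoeffs v 0 = 0 := by
  obtain ⟨G, -, h⟩ := h
  have h0 := congrFun h 0
  rw [drivingTerm_zero] at h0
  have : (ε : ℂ) ≠ 0 := by exact_mod_cast hε.ne'
  simpa [invNegLaplacianF, this] using h0

lemma SolvesAt.coeff {ε : ℝ} {φ : ℝ → ℝ} {u : Fin 2 → L2Torus}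
    {f v : L2Torus} (h : SolvesAt ε φ u f v)
    (hdiv : ∀ n : Freq, ∑ j, Complex.I * (n j : ℂ) * fourierCoeffs (u j) n = 0)
    {n : Freq} (hn : n ≠ 0) :
    ((ε + (freqSq n)⁻¹ : ℝ) : ℂ) * fourierCoeffs v n
      = drivingTerm φ f n
        - ((freqSq n)⁻¹ : ℝ) * divF (fun j => fourierCoeffs (fun x => u j x * f x)) n := by
  obtain ⟨G, hG, h⟩ := h
  have h0 := congrFun h n
  rw [← h0, divF, ← fourierCoeffs_advection hdiv hG]
  simp only [Pi.add_apply, Pi.smul_apply, smul_eq_mul, invNegLaplacianF, if_neg hn]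
  push_cast
  ring

lemma memLp_mul_of_ae_abs_le {w f : Torus2 → ℝ} {M : ℝ} (hw : MemLp w 2 volume)
    (hf : AEStronglyMeasurable f volume) (hM : ∀ᵐ x, |f x| ≤ M) :
    MemLp (fun x => w x * f x) 2 volume ∧ ∫ x, (w x * f x) ^ 2 ≤ M ^ 2 * ∫ x, w x ^ 2 := by
  have h1 : MemLp (fun x => w x * f x) 2 volume := by
    have h : MemLp (fun x => f x * w x) 2 volume :=
      hw.mul (p := ⊤) (q := 2) (r := 2) (memLp_top_of_bound hf M hM)
    simpa only [mul_comm] using h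
  refine ⟨h1, ?_⟩
  rw [← integral_const_mul]
  refine integral_mono_ae h1.integrable_sq (hw.integrable_sq.const_mul _) ?_
  filter_upwards [hM] with x hx
  have h2 : f x ^ 2 ≤ M ^ 2 := sq_le_sq' (by linarith [neg_abs_le (f x)]) ((le_abs_self _).trans hx)
  have h3 := mul_le_mul_of_nonneg_right h2 (sq_nonneg (w x))
  calc (w x * f x) ^ 2 = f x ^ 2 * w x ^ 2 := by ring
    _ ≤ _ := h3

lemma hasSum_fourierCoeffs_sq {f : Torus2 → ℝ} (hf : MemLp f 2 volume) :
    HasSum (fun n => (2 * Real.pi) ^ 2 * ‖fourierCoeffs f n‖ ^ 2) (∫ x, f x ^ 2) := by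
  have h := (hasSum_sq_fourierCoeffs hf).mul_left ((2 * Real.pi) ^ 2)
  rw [torus_average, smul_eq_mul, ← mul_assoc, mul_inv_cancel₀ (by positivity), one_mul] at h
  exact h

/-- The velocity and the phase velocity differ by a transport term bounded by the drift. -/
lemma SolvesAt.velocityEnergy_sub_le {ε : ℝ} (hε : 0 < ε) {φ : ℝ → ℝ} {u : Fin 2 → L2Torus}
    {f v : L2Torus} (h : SolvesAt ε φ u f v)
    (hdiv : ∀ n : Freq, ∑ j, Complex.I * (n j : ℂ) * fourierCoeffs (u j) n = 0)
    (hf : ∀ᵐ x, |f x| ≤ 1) :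
    velocityEnergy ε (phaseVelocity ε φ f - fourierCoeffs v)
      ≤ ENNReal.ofReal (∑ j, ‖u j‖ ^ 2) := by
  have hprod := fun j => memLp_mul_of_ae_abs_le (memLp_L2Torus (u j))
    (memLp_L2Torus f).aestronglyMeasurable hf
  have hsum := hasSum_sum (s := Finset.univ) fun j (_ : j ∈ Finset.univ) =>
    hasSum_fourierCoeffs_sq (hprod j).1
  have hle : velocityEnergy ε (phaseVelocity ε φ f - fourierCoeffs v)
      ≤ ∑' n, ENNReal.ofReal (∑ j, (2 * Real.pi) ^ 2
        * ‖fourierCoeffs (fun x => u j x * f x) n‖ ^ 2) := by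
    rw [velocityEnergy_eq hε.le]
    refine ENNReal.tsum_le_tsum fun n => ENNReal.ofReal_le_ofReal ?_
    rw [Pi.sub_apply, ← Finset.mul_sum, mul_assoc]
    refine mul_le_mul_of_nonneg_left ?_ (by positivity)
    by_cases hn : n = 0
    · subst hn
      rw [h.coeff_zero hε, phaseVelocity, resolventF, if_pos rfl]
      simp only [sub_zero, norm_zero, ne_eq, OfNat.ofNat_ne_zero, not_false_eq_true, zero_pow,
        mul_zero]
      positivity
    set q := divF (fun j => fourierCoeffs (fun x => u j x * f x)) n with hq
    have hx1 := one_le_freqSq hn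
    have hx : 0 < freqSq n := by linarith
    have hw : 0 < ε + (freqSq n)⁻¹ := by positivity
    have hwC : ((ε + (freqSq n)⁻¹ : ℝ) : ℂ) ≠ 0 := by exact_mod_cast hw.ne'
    have hr : phaseVelocity ε φ f n - fourierCoeffs v n
        -- The difference is `(ε + (-Δ)⁻¹)⁻¹ (-Δ)⁻¹ div(uf)`; its energy loses the weight once, and
        -- `|n|⁻² ≤ ε + |n|⁻²` removes `ε` from the bound.
        = ((((freqSq n)⁻¹ : ℝ) : ℂ) * q) / ((ε + (freqSq n)⁻¹ : ℝ) : ℂ) := by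
      have hc := h.coeff hdiv hn
      have e1 : phaseVelocity ε φ f n = drivingTerm φ f n / ((ε + (freqSq n)⁻¹ : ℝ) : ℂ) := by
        rw [phaseVelocity, resolventF, if_neg hn]
        push_cast
        rw [one_div]
      rw [e1, eq_div_iff hwC, sub_mul, div_mul_cancel₀ _ hwC]
      linear_combination -hc
    rw [hr, norm_div, norm_mul, Complex.norm_real, Complex.norm_real, Real.norm_eq_abs,
      Real.norm_eq_abs, abs_of_pos hw, abs_of_pos (inv_pos.mpr hx)]
    have e2 : (ε + (freqSq n)⁻¹) * ((freqSq n)⁻¹ * ‖q‖ / (ε + (freqSq n)⁻¹)) ^ 2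
        = ((freqSq n)⁻¹ ^ 2 * ‖q‖ ^ 2) / (ε + (freqSq n)⁻¹) := by
      field_simp
    rw [e2, div_le_iff₀ hw]
    have h5 := norm_divF_sq_le (fun j => fourierCoeffs (fun x => u j x * f x)) n
    rw [← hq] at h5
    set S := ∑ j, ‖fourierCoeffs (fun x => u j x * f x) n‖ ^ 2 with hSdef
    have hS : 0 ≤ S := Finset.sum_nonneg fun _ _ => sq_nonneg _
    calc (freqSq n)⁻¹ ^ 2 * ‖q‖ ^ 2 ≤ (freqSq n)⁻¹ ^ 2 * (freqSq n * S) := by gcongr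
      _ = S * (freqSq n)⁻¹ := by field_simp
      _ ≤ S * (ε + (freqSq n)⁻¹) := by
        refine mul_le_mul_of_nonneg_left ?_ hS
        linarith
  refine hle.trans ?_
  rw [tsum_ofReal_eq (fun n => by positivity) hsum.summable, hsum.tsum_eq]
  refine ENNReal.ofReal_le_ofReal (Finset.sum_le_sum fun j _ => ?_)
  rw [norm_sq_L2Torus]
  simpa using (hprod j).2

/-- The differential inequality for the difference of two solutions at a fixed time. -/
lemma SolvesAt.energy_inequality {ε : ℝ≥0} (hε : 0 < ε) {φ : ℝ → ℝ} {α : ℝ}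
    (hφ : ∀ a ∈ Ioo (-1 : ℝ) 1, ∀ b ∈ Ioo (-1 : ℝ) 1,
      0 ≤ (φ a - φ b) * (a - b) + α * (a - b) ^ 2)
    {u₁ u₂ : Fin 2 → L2Torus} {f₁ f₂ v₁ v₂ : L2Torus}
    (h₁ : SolvesAt ε φ u₁ f₁ v₁) (h₂ : SolvesAt ε φ u₂ f₂ v₂)
    (hdiv₁ : ∀ n : Freq, ∑ j, Complex.I * (n j : ℂ) * fourierCoeffs (u₁ j) n = 0)
    (hdiv₂ : ∀ n : Freq, ∑ j, Complex.I * (n j : ℂ) * fourierCoeffs (u₂ j) n = 0)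
    (hu : ∀ j, sobolevNormSq 2 (fourierCoeffs (u₁ j)) < ⊤)
    (hf₁ : MemPhaseSpace ε φ f₁) (hf₂ : MemPhaseSpace ε φ f₂) :
    2 * (inner ℂ (energyMap ε (f₂ - f₁)) (energyMap ε (v₂ - v₁))).re
        + (1 / 2) * (sobolevNormSq 1 (fourierCoeffs (f₂ - f₁ : L2Torus))).toReal
      ≤ (2 * α ^ 2 + 3
          + 2 * (sobolevConst * ∑ j, (sobolevNormSq 2 (fourierCoeffs (u₁ j))).toReal))
          * ‖energyMap ε (f₂ - f₁)‖ ^ 2 + ∑ j, ‖u₂ j - u₁ j‖ ^ 2 := by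
  choose M hM0 hM hMS using fun j => ae_sq_le_sobolev (hu j)
  set B := ∑ j, M j ^ 2 with hB
  have hB0 : 0 ≤ B := Finset.sum_nonneg fun j _ => sq_nonneg _
  have hBS : B ≤ sobolevConst * ∑ j, (sobolevNormSq 2 (fourierCoeffs (u₁ j))).toReal := by
    rw [Finset.mul_sum]
    exact Finset.sum_le_sum fun j _ => hMS j
  set V := f₂ - f₁ with hV
  set g : Torus2 → ℝ := fun x => φ (f₂ x) - φ (f₁ x) with hg
  have hVL := memLp_L2Torus V
  have hgL : MemLp g 2 volume := hf₂.memLp_phi.sub hf₁.memLp_phi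
  have hVc : fourierCoeffs V = fourierCoeffs f₂ - fourierCoeffs f₁ := fourierCoeffs_Lp_sub f₂ f₁
  have hVx : ∀ᵐ x, V x = f₂ x - f₁ x := Lp.coeFn_sub f₂ f₁
  have hgc : fourierCoeffs g
      = fourierCoeffs (fun x => φ (f₂ x)) - fourierCoeffs (fun x => φ (f₁ x)) :=
    fourierCoeffs_sub hf₂.memLp_phi.integrable_torus hf₁.memLp_phi.integrable_torus
  have hV0 : fourierCoeffs V 0 = 0 := by
    rw [hVc, Pi.sub_apply, fourierCoeffs_zero_freq, fourierCoeffs_zero_freq, hf₁.mean_zero,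
      hf₂.mean_zero, sub_self]
  -- the transport terms
  have hA := fun j => memLp_mul_of_ae_abs_le (memLp_L2Torus (u₂ j - u₁ j))
    (memLp_L2Torus f₂).aestronglyMeasurable hf₂.abs_le_one
  have hBm := fun j => memLp_mul_of_ae_abs_le hVL
    (memLp_L2Torus (u₁ j)).aestronglyMeasurable (hM j)
  set a : Fin 2 → Freq → ℂ := fun j => fourierCoeffs (fun x => (u₂ j - u₁ j : L2Torus) x * f₂ x)
    with ha
  set b : Fin 2 → Freq → ℂ := fun j => fourierCoeffs (fun x => V x * u₁ j x) with hb
  -- The splitting `u₂f₂ - u₁f₁ = (u₂-u₁)f₂ + V u₁`: the drift increment meets the bounded `f₂`, and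
  -- `V` meets the bounded `u₁`.
  have hab : ∀ j, fourierCoeffs (fun x => u₂ j x * f₂ x) - fourierCoeffs (fun x => u₁ j x * f₁ x)
      = a j + b j := fun j => by
    have i2 := ((memLp_L2Torus (u₂ j)).integrable_mul (memLp_L2Torus f₂))
    have i1 := ((memLp_L2Torus (u₁ j)).integrable_mul (memLp_L2Torus f₁))
    have e1 := fourierCoeffs_sub i2 i1
    have e2 := fourierCoeffs_add (hA j).1.integrable_torus (hBm j).1.integrable_torus
    refine e1.symm.trans (Eq.trans (fourierCoeffs_congr ?_) e2)
    filter_upwards [Lp.coeFn_sub (u₂ j) (u₁ j), hVx] with x hx1 hx2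
    rw [hx1, hx2]
    simp only [Pi.mul_apply, Pi.sub_apply]
    ring
  have hcoeff : ∀ n, n ≠ 0 → ((ε + (freqSq n)⁻¹ : ℝ) : ℂ) * fourierCoeffs (v₂ - v₁ : L2Torus) n
      = -(freqSq n : ℂ) * fourierCoeffs V n - fourierCoeffs g n
        - ((freqSq n)⁻¹ : ℝ) * (divF a n + divF b n) := fun n hn => by
    have e1 := h₁.coeff hdiv₁ hn
    have e2 := h₂.coeff hdiv₂ hn
    rw [drivingTerm_of_ne _ _ hn] at e1 e2
    have e3 : divF (fun j => fourierCoeffs (fun x => u₂ j x * f₂ x)) n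
        - divF (fun j => fourierCoeffs (fun x => u₁ j x * f₁ x)) n = divF a n + divF b n := by
      simp only [divF, ← Finset.sum_sub_distrib, ← Finset.sum_add_distrib, ← mul_sub, ← mul_add]
      exact Finset.sum_congr rfl fun j _ => congrArg _ (congrFun (hab j) n)
    rw [fourierCoeffs_Lp_sub, hVc, hgc, ← e3, Pi.sub_apply, Pi.sub_apply, Pi.sub_apply]
    linear_combination e2 - e1
  -- the termwise inequality
  have hterm : ∀ n, (2 * Real.pi) ^ 2 * (ε + (freqSq n)⁻¹)
          * ((starRingEnd ℂ) (fourierCoeffs V n) * fourierCoeffs (v₂ - v₁ : L2Torus) n).re * 2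
        + (2 * ((2 * Real.pi) ^ 2
            * ((starRingEnd ℂ) (fourierCoeffs g n) * fourierCoeffs V n).re)
          + 2 * α * ((2 * Real.pi) ^ 2 * ‖fourierCoeffs V n‖ ^ 2)
          + (2 * Real.pi) ^ 2 * (1 + freqSq n) * ‖fourierCoeffs V n‖ ^ 2 * (1 / 2))
      ≤ (2 * α ^ 2 + 3 + 2 * B)
          * ((2 * Real.pi) ^ 2 * (ε + (freqSq n)⁻¹) * ‖fourierCoeffs V n‖ ^ 2)
        + (∑ j, (2 * Real.pi) ^ 2 * ‖a j n‖ ^ 2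
          + (2 * (B + 1))⁻¹ * ∑ j, (2 * Real.pi) ^ 2 * ‖b j n‖ ^ 2
          - (1 / 2) * ((2 * Real.pi) ^ 2 * ‖fourierCoeffs V n‖ ^ 2)) := fun n => by
    by_cases hn : n = 0
    · subst hn
      rw [hV0]
      simp only [map_zero, zero_mul, mul_zero, Complex.zero_re, norm_zero, ne_eq,
        OfNat.ofNat_ne_zero, not_false_eq_true, zero_pow, add_zero, zero_add, sub_zero]
      positivity
    have hx1 := one_le_freqSq hn
    set x := freqSq n with hxdef
    have hx : 0 < x := by linarith
    set z := fourierCoeffs V n with hz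
    have hre : (ε + x⁻¹) * ((starRingEnd ℂ) z * fourierCoeffs (v₂ - v₁ : L2Torus) n).re
        = -x * ‖z‖ ^ 2 - ((starRingEnd ℂ) (fourierCoeffs g n) * z).re
          - x⁻¹ * ((starRingEnd ℂ) z * (divF a n + divF b n)).re := by
      rw [← Complex.re_ofReal_mul, mul_left_comm, hcoeff n hn]
      have e : (starRingEnd ℂ) z * (-(x : ℂ) * z - fourierCoeffs g n
          - ((x⁻¹ : ℝ) : ℂ) * (divF a n + divF b n))
          = ((-x : ℝ) : ℂ) * ((starRingEnd ℂ) z * z) - (starRingEnd ℂ) z * fourierCoeffs g n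
            - ((x⁻¹ : ℝ) : ℂ) * ((starRingEnd ℂ) z * (divF a n + divF b n)) := by
        push_cast
        ring
      have e' : ((starRingEnd ℂ) z * fourierCoeffs g n).re
          = ((starRingEnd ℂ) (fourierCoeffs g n) * z).re := by
        rw [← Complex.conj_re, map_mul, Complex.conj_conj, mul_comm]
      rw [e, Complex.sub_re, Complex.sub_re, Complex.re_ofReal_mul, Complex.re_ofReal_mul,
        Complex.conj_mul', ← Complex.ofReal_pow, Complex.ofReal_re, e']
    have hdivn : -((starRingEnd ℂ) z * (divF a n + divF b n)).re
        ≤ ∑ j, (|(n j : ℝ)| * ‖z‖ * ‖a j n‖ + |(n j : ℝ)| * ‖z‖ * ‖b j n‖) := by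
      refine (neg_le_abs _).trans ((Complex.abs_re_le_norm _).trans ?_)
      rw [norm_mul, RCLike.norm_conj]
      have h1 := (norm_add_le (divF a n) (divF b n)).trans
        (add_le_add (norm_divF_le a n) (norm_divF_le b n))
      refine (mul_le_mul_of_nonneg_left h1 (norm_nonneg z)).trans_eq ?_
      rw [← Finset.sum_add_distrib, Finset.mul_sum]
      exact Finset.sum_congr rfl fun j _ => by ring
    -- Young with `p = |n_j||z|/|n|²`. The weight `1/(2(B+1))` is chosen so that the `b` terms, of
    -- total size at most `B‖V‖²`, cost at most `½‖V‖²`; `B+1` avoids dividing by zero. The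
    -- coefficient of `p²` is `1 + 2(B+1)`.
    have hyoung : ∀ j, 2 * (x⁻¹ * (|(n j : ℝ)| * ‖z‖ * ‖a j n‖ + |(n j : ℝ)| * ‖z‖ * ‖b j n‖))
        ≤ ‖a j n‖ ^ 2 + (2 * (B + 1))⁻¹ * ‖b j n‖ ^ 2
          + (3 + 2 * B) * (x⁻¹ ^ 2 * (n j : ℝ) ^ 2 * ‖z‖ ^ 2) := fun j => by
      have hc : 0 < 2 * (B + 1) := by linarith
      have e0 : (x⁻¹ * |(n j : ℝ)| * ‖z‖) ^ 2 = x⁻¹ ^ 2 * (n j : ℝ) ^ 2 * ‖z‖ ^ 2 := by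
        rw [mul_pow, mul_pow, sq_abs]
      set p := x⁻¹ * |(n j : ℝ)| * ‖z‖ with hp
      have e1 : 2 * (p * ‖a j n‖) ≤ ‖a j n‖ ^ 2 + p ^ 2 := by nlinarith [sq_nonneg (p - ‖a j n‖)]
      have e2 : 2 * (p * ‖b j n‖) ≤ (2 * (B + 1))⁻¹ * ‖b j n‖ ^ 2 + (2 * (B + 1)) * p ^ 2 := by
        have e3 : 0 ≤ (2 * (B + 1))⁻¹ * (‖b j n‖ - (2 * (B + 1)) * p) ^ 2 := by positivity
        have e4 : (2 * (B + 1))⁻¹ * (‖b j n‖ - (2 * (B + 1)) * p) ^ 2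
            = (2 * (B + 1))⁻¹ * ‖b j n‖ ^ 2 + (2 * (B + 1)) * p ^ 2 - 2 * (p * ‖b j n‖) := by
          field_simp
          ring
        linarith
      rw [← e0]
      have e5 : 2 * (x⁻¹ * (|(n j : ℝ)| * ‖z‖ * ‖a j n‖ + |(n j : ℝ)| * ‖z‖ * ‖b j n‖))
          = 2 * (p * ‖a j n‖) + 2 * (p * ‖b j n‖) := by rw [hp]; ring
      linarith
    have hxx : x⁻¹ ^ 2 * ((n 0 : ℝ) ^ 2 + (n 1 : ℝ) ^ 2) = x⁻¹ := by
      have hfx : (n 0 : ℝ) ^ 2 + (n 1 : ℝ) ^ 2 = x := by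
        rw [hxdef, freqSq, Fin.sum_univ_two]
      rw [hfx]
      field_simp
    have hsumyoung : 2 * (x⁻¹ * ∑ j, (|(n j : ℝ)| * ‖z‖ * ‖a j n‖ + |(n j : ℝ)| * ‖z‖ * ‖b j n‖))
        ≤ ∑ j, ‖a j n‖ ^ 2 + (2 * (B + 1))⁻¹ * ∑ j, ‖b j n‖ ^ 2
          + (3 + 2 * B) * (x⁻¹ * ‖z‖ ^ 2) := by
      simp only [Fin.sum_univ_two]
      linear_combination hyoung 0 + hyoung 1 + (3 + 2 * B) * ‖z‖ ^ 2 * hxx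
    have hdx := mul_le_mul_of_nonneg_left hdivn (inv_pos.mpr hx).le
    -- Interpolation of `L²` between `H¹` and `Ḣ⁻¹`: part of the dissipation absorbs the loss of
    -- monotonicity.
    have hα : 2 * α * ‖z‖ ^ 2 ≤ (1 / 2) * x * ‖z‖ ^ 2 + 2 * α ^ 2 * (x⁻¹ * ‖z‖ ^ 2) := by
      have e1 : 0 ≤ x⁻¹ * (x / 2 - α) ^ 2 := by positivity
      have e2 : x⁻¹ * (x / 2 - α) ^ 2 = x / 4 - α + α ^ 2 * x⁻¹ := by
        field_simp
        ring
      rw [e2] at e1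
      nlinarith [mul_le_mul_of_nonneg_right e1 (sq_nonneg ‖z‖)]
    have hεz : 0 ≤ (2 * α ^ 2 + 3 + 2 * B) * (ε * ‖z‖ ^ 2) := by positivity
    -- Poincaré for nonzero modes; it supplies the reserve `-½‖V‖²` that pays for the `b` terms.
    have hxz : ‖z‖ ^ 2 ≤ x * ‖z‖ ^ 2 := le_mul_of_one_le_left (sq_nonneg _) hx1
    have hmain : 2 * ((ε + x⁻¹) * ((starRingEnd ℂ) z * fourierCoeffs (v₂ - v₁ : L2Torus) n).re)
          + (2 * ((starRingEnd ℂ) (fourierCoeffs g n) * z).re + 2 * α * ‖z‖ ^ 2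
            + (1 + x) * ‖z‖ ^ 2 * (1 / 2))
        ≤ (2 * α ^ 2 + 3 + 2 * B) * ((ε + x⁻¹) * ‖z‖ ^ 2) + (∑ j, ‖a j n‖ ^ 2
          + (2 * (B + 1))⁻¹ * ∑ j, ‖b j n‖ ^ 2 - (1 / 2) * ‖z‖ ^ 2) := by
      rw [hre]
      linarith
    have hP := mul_le_mul_of_nonneg_left hmain (show 0 ≤ (2 * Real.pi) ^ 2 by positivity)
    rw [← Finset.mul_sum, ← Finset.mul_sum]
    refine le_trans (le_of_eq ?_) (hP.trans (le_of_eq ?_)) <;> ring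
  -- summation
  have hs1 := (hasSum_inner_energyMap ε V (v₂ - v₁)).mul_right 2
  have hs2 := (((hasSum_fourierCoeffs hgL hVL).mul_left ((2 * Real.pi) ^ 2)).mul_left 2)
  have hs3 := (hasSum_norm_sq_L2Torus V)
  have hsH : Summable fun n => (2 * Real.pi) ^ 2 * (1 + freqSq n) * ‖fourierCoeffs V n‖ ^ 2 := by
    have k1 := hf₁.memH2
    have k2 := hf₂.memH2
    rw [sobolevNormSq_two] at k1 k2
    refine Summable.of_nonneg_of_le (fun n => ?_) (fun n => ?_)
      (((summable_of_tsum_ofReal_lt_top (fun n => by positivity) k1).add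
        (summable_of_tsum_ofReal_lt_top (fun n => by positivity) k2)).mul_left 2)
    · have := freqSq_nonneg n
      positivity
    · have h0 := freqSq_nonneg n
      have e1 : ‖fourierCoeffs V n‖ ^ 2
          ≤ 2 * (‖fourierCoeffs f₁ n‖ ^ 2 + ‖fourierCoeffs f₂ n‖ ^ 2) := by
        rw [hVc, Pi.sub_apply]
        have := pow_le_pow_left₀ (norm_nonneg _)
          (norm_sub_le (fourierCoeffs f₂ n) (fourierCoeffs f₁ n)) 2
        nlinarith [sq_nonneg (‖fourierCoeffs f₂ n‖ - ‖fourierCoeffs f₁ n‖)]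
      have e2 : 1 + freqSq n ≤ (1 + freqSq n) ^ 2 := by nlinarith
      calc (2 * Real.pi) ^ 2 * (1 + freqSq n) * ‖fourierCoeffs V n‖ ^ 2
          ≤ (2 * Real.pi) ^ 2 * (1 + freqSq n) ^ 2
            * (2 * (‖fourierCoeffs f₁ n‖ ^ 2 + ‖fourierCoeffs f₂ n‖ ^ 2)) := by gcongr
        _ = _ := by ring
  have hs4 := hsH.hasSum.mul_right (1 / 2)
  have hL := hs1.add ((hs2.add (hs3.mul_left (2 * α))).add hs4)
  have hs5 := (hasSum_norm_sq_energyMap ε V).mul_left (2 * α ^ 2 + 3 + 2 * B)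
  have hs6 := hasSum_sum (s := Finset.univ) fun j (_ : j ∈ Finset.univ) =>
    hasSum_fourierCoeffs_sq (hA j).1
  have hs7 := (hasSum_sum (s := Finset.univ) fun j (_ : j ∈ Finset.univ) =>
    hasSum_fourierCoeffs_sq (hBm j).1).mul_left (2 * (B + 1))⁻¹
  have hR := hs5.add ((hs6.add hs7).sub (hs3.mul_left (1 / 2)))
  have hfin := hasSum_le hterm hL hR
  have hH1 : (sobolevNormSq 1 (fourierCoeffs V)).toReal
      = ∑' n, (2 * Real.pi) ^ 2 * (1 + freqSq n) * ‖fourierCoeffs V n‖ ^ 2 := by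
    have hnn : ∀ n, 0 ≤ (2 * Real.pi) ^ 2 * (1 + freqSq n) * ‖fourierCoeffs V n‖ ^ 2 :=
      fun n => by
        have := freqSq_nonneg n
        positivity
    rw [sobolevNormSq_one, tsum_ofReal_eq hnn hsH, ENNReal.toReal_ofReal (tsum_nonneg hnn)]
  have hA2 : ∑ j, ∫ x, ((u₂ j - u₁ j : L2Torus) x * f₂ x) ^ 2 ≤ ∑ j, ‖u₂ j - u₁ j‖ ^ 2 :=
    Finset.sum_le_sum fun j _ => by
      rw [norm_sq_L2Torus]
      simpa using (hA j).2
  have hB2 : (2 * (B + 1))⁻¹ * ∑ j, ∫ x, (V x * u₁ j x) ^ 2 ≤ (1 / 2) * ‖V‖ ^ 2 := by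
    have e1 : ∑ j, ∫ x, (V x * u₁ j x) ^ 2 ≤ B * ‖V‖ ^ 2 := by
      rw [hB, Finset.sum_mul]
      exact Finset.sum_le_sum fun j _ => by
        rw [norm_sq_L2Torus]
        exact (hBm j).2
    have hc : 0 < 2 * (B + 1) := by linarith
    rw [inv_mul_le_iff₀ hc]
    nlinarith [sq_nonneg ‖V‖]
  have hmono : 0 ≤ 2 * ((2 * Real.pi) ^ 2 * ⨍ x, g x * V x) + 2 * α * ‖V‖ ^ 2 := by
    have hgV : Integrable (fun x => g x * V x) := hgL.integrable_mul hVL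
    have e1 : 0 ≤ ∫ x, (g x * V x + α * V x ^ 2) := by
      refine integral_nonneg_of_ae ?_
      filter_upwards [hVx, hf₁.range, hf₂.range] with x hx r1 r2
      rw [hx]
      exact hφ _ r2 _ r1
    rw [integral_add hgV (hVL.integrable_sq.const_mul α), integral_const_mul,
      ← norm_sq_L2Torus] at e1
    rw [torus_average, smul_eq_mul, ← mul_assoc ((2 * Real.pi) ^ 2),
      mul_inv_cancel₀ (by positivity), one_mul]
    linarith
  have hkB := mul_le_mul_of_nonneg_right hBS (sq_nonneg ‖energyMap ε V‖)
  rw [hH1]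
  linarith

/-! ### Increments in time. -/

lemma IsTimeDerivOn.continuousOn {b : ℝ} (hb : 0 ≤ b) {V V' : ℝ → L2Torus}
    (h : IsTimeDerivOn (Icc 0 b) V V') : ContinuousOn V (Icc 0 b) := by
  have h0 : (0 : ℝ) ∈ Icc 0 b := left_mem_Icc.mpr hb
  have hi := (h 0 h0 b (right_mem_Icc.mpr hb)).1
  have hc := intervalIntegral.continuousOn_primitive_interval' hi (a := 0) left_mem_uIcc
  rw [uIcc_of_le hb] at hc
  refine (hc.const_add (V 0)).congr fun t ht => ?_
  simp only
  rw [← (h 0 h0 t ht).2]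
  abel

lemma IsTimeDerivOn.aestronglyMeasurable {b : ℝ} (hb : 0 ≤ b) {V V' : ℝ → L2Torus}
    (h : IsTimeDerivOn (Icc 0 b) V V') : AEStronglyMeasurable V (volume.restrict (Ioc 0 b)) :=
  ((h.continuousOn hb).mono Ioc_subset_Icc_self).aestronglyMeasurable measurableSet_Ioc

lemma IsTimeDerivOn.aestronglyMeasurable_deriv {b : ℝ} (hb : 0 ≤ b) {V V' : ℝ → L2Torus}
    (h : IsTimeDerivOn (Icc 0 b) V V') : AEStronglyMeasurable V' (volume.restrict (Ioc 0 b)) :=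
  ((intervalIntegrable_iff_integrableOn_Ioc_of_le hb).mp
    (h 0 (left_mem_Icc.mpr hb) b (right_mem_Icc.mpr hb)).1).aestronglyMeasurable

/-- The increment `f(· + h) - f` has the increment of the derivative as its time derivative. -/
lemma IsTimeDerivOn.increment {I J : Set ℝ} {f f' : ℝ → L2Torus} (hf : IsTimeDerivOn J f f')
    {h : ℝ} (hI : ∀ t ∈ I, t ∈ J ∧ t + h ∈ J) :
    IsTimeDerivOn I (fun t => f (t + h) - f t) (fun t => f' (t + h) - f' t) := by
  intro s hs t ht
  have h1 := hf s (hI s hs).1 t (hI t ht).1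
  have h2 := hf (s + h) (hI s hs).2 (t + h) (hI t ht).2
  have h3 : IntervalIntegrable (fun τ => f' (τ + h)) volume s t := by
    have := h2.1.comp_add_right h
    simpa using this
  refine ⟨h3.sub h1.1, ?_⟩
  rw [intervalIntegral.integral_sub h3 h1.1, intervalIntegral.integral_comp_add_right, ← h1.2,
    ← h2.2]
  exact sub_sub_sub_comm _ _ _ _

lemma sq_lintegral_le_measure_mul {α : Type*} [MeasurableSpace α] {μ : Measure α} {f : α → ℝ≥0∞}
    (hf : AEMeasurable f μ) : (∫⁻ x, f x ∂μ) ^ 2 ≤ μ univ * ∫⁻ x, f x ^ 2 ∂μ := by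
  have h := ENNReal.lintegral_mul_le_Lp_mul_Lq μ Real.HolderConjugate.two_two hf
    (aemeasurable_const (b := (1 : ℝ≥0∞)))
  simp only [Pi.mul_apply, mul_one, ENNReal.rpow_two, one_pow, lintegral_one] at h
  calc (∫⁻ x, f x ∂μ) ^ 2
      ≤ ((∫⁻ x, f x ^ 2 ∂μ) ^ (1 / 2 : ℝ) * μ univ ^ (1 / 2 : ℝ)) ^ 2 := by gcongr
    _ = μ univ * ∫⁻ x, f x ^ 2 ∂μ := by
      rw [mul_pow, ← ENNReal.rpow_natCast, ← ENNReal.rpow_natCast, ← ENNReal.rpow_mul,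
        ← ENNReal.rpow_mul, mul_comm]
      norm_num

/-- The `L²`-in-time bound for increments by the time derivative. -/
lemma IsTimeDerivOn.lintegral_increment_le {T b h : ℝ} (hh : 0 ≤ h) (hb : 0 ≤ b) (hT : b + h ≤ T)
    {f f' : ℝ → L2Torus} (hf : IsTimeDerivOn (Icc 0 T) f f') :
    ∫⁻ t in Ioc 0 b, ‖f (t + h) - f t‖ₑ ^ 2
      ≤ ENNReal.ofReal (h ^ 2) * ∫⁻ t in Ioc 0 T, ‖f' t‖ₑ ^ 2 := by
  have hmeas := hf.aestronglyMeasurable_deriv (by linarith)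
  -- A Borel version of `‖f'‖` extended by zero to the line, so that Tonelli and translation
  -- invariance apply without restrictions.
  set G : ℝ → ℝ≥0∞ := (Ioc 0 T).indicator hmeas.enorm.mk with hG
  have hGm : Measurable G := hmeas.enorm.measurable_mk.indicator measurableSet_Ioc
  have hGe : ∀ᵐ s ∂volume.restrict (Ioc 0 T), ‖f' s‖ₑ = G s := by
    filter_upwards [hmeas.enorm.ae_eq_mk, ae_restrict_mem measurableSet_Ioc] with s hs hsI
    rw [hs, hG, indicator_of_mem hsI]
  have hshift : ∀ t, ∫⁻ s in Ioc t (t + h), G s ^ 2 = ∫⁻ r in Ioc 0 h, G (t + r) ^ 2 := by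
    intro t
    rw [← lintegral_indicator measurableSet_Ioc, ← lintegral_indicator measurableSet_Ioc,
      ← lintegral_add_left_eq_self _ t]
    refine lintegral_congr fun r => ?_
    simp only [indicator, mem_Ioc, lt_add_iff_pos_right, add_le_add_iff_left]
  -- Cauchy–Schwarz in time gives one factor `h`; integrating over the shift `r ∈ (0, h]` after
  -- exchanging integrals gives the other.
  have hpt : ∀ t ∈ Ioc 0 b, ‖f (t + h) - f t‖ₑ ^ 2
      ≤ ENNReal.ofReal h * ∫⁻ r in Ioc 0 h, G (t + r) ^ 2 := by
    intro t ht
    have hsub : Ioc t (t + h) ⊆ Ioc 0 T := Ioc_subset_Ioc ht.1.le (by linarith [ht.2])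
    rw [(hf t ⟨ht.1.le, by linarith [ht.2]⟩ (t + h) ⟨by linarith [ht.1], by linarith [ht.2]⟩).2,
      intervalIntegral.integral_of_le (by linarith)]
    have h1 : ‖∫ τ in Ioc t (t + h), f' τ‖ₑ ≤ ∫⁻ τ in Ioc t (t + h), G τ := by
      refine (enorm_integral_le_lintegral_enorm _).trans_eq ?_
      exact lintegral_congr_ae (ae_restrict_of_ae_restrict_of_subset hsub hGe)
    refine (pow_le_pow_left' h1 2).trans ?_
    refine (sq_lintegral_le_measure_mul hGm.aemeasurable).trans_eq ?_
    rw [hshift, Measure.restrict_apply_univ, Real.volume_Ioc]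
    simp
  calc ∫⁻ t in Ioc 0 b, ‖f (t + h) - f t‖ₑ ^ 2
      ≤ ∫⁻ t in Ioc 0 b, ENNReal.ofReal h * ∫⁻ r in Ioc 0 h, G (t + r) ^ 2 :=
        setLIntegral_mono' measurableSet_Ioc hpt
    _ = ENNReal.ofReal h * ∫⁻ t in Ioc 0 b, ∫⁻ r in Ioc 0 h, G (t + r) ^ 2 :=
        lintegral_const_mul' _ _ ENNReal.ofReal_ne_top
    _ = ENNReal.ofReal h * ∫⁻ r in Ioc 0 h, ∫⁻ t in Ioc 0 b, G (t + r) ^ 2 := by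
        rw [lintegral_lintegral_swap]
        exact ((hGm.comp measurable_add).pow_const 2).aemeasurable
    _ ≤ ENNReal.ofReal h * ∫⁻ _ in Ioc 0 h, ∫⁻ s, G s ^ 2 := by
        refine mul_le_mul_right (lintegral_mono fun r => ?_) _
        refine (setLIntegral_le_lintegral _ _).trans_eq ?_
        exact lintegral_add_right_eq_self (fun s => G s ^ 2) r
    _ = ENNReal.ofReal (h ^ 2) * ∫⁻ t in Ioc 0 T, ‖f' t‖ₑ ^ 2 := by
        rw [setLIntegral_const, Real.volume_Ioc, sub_zero, ENNReal.ofReal_pow hh,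
          mul_comm (∫⁻ s, G s ^ 2), ← mul_assoc, ← sq]
        congr 1
        have h2 : (fun s => G s ^ 2) = (Ioc 0 T).indicator fun s => G s ^ 2 := by
          ext s
          by_cases hs : s ∈ Ioc 0 T
          · rw [indicator_of_mem hs]
          · rw [indicator_of_notMem hs, hG, indicator_of_notMem hs]
            simp
        rw [h2, lintegral_indicator measurableSet_Ioc]
        refine lintegral_congr_ae (hGe.mono fun s hs => ?_)
        simp only
        rw [hs]

lemma sobolevNormSq_zero_enorm (f : L2Torus) : sobolevNormSq 0 (fourierCoeffs f) = ‖f‖ₑ ^ 2 := by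
  rw [sobolevNormSq_zero_L2Torus, ENNReal.ofReal_pow (norm_nonneg _), ofReal_norm]

lemma sobolevNormSq_two_sub_le (c d : Freq → ℂ) :
    sobolevNormSq 2 (c - d) ≤ 2 * sobolevNormSq 2 c + 2 * sobolevNormSq 2 d := by
  rw [sobolevNormSq_two, sobolevNormSq_two, sobolevNormSq_two, ← ENNReal.tsum_mul_left,
    ← ENNReal.tsum_mul_left, ← ENNReal.tsum_add]
  refine ENNReal.tsum_le_tsum fun n => ?_
  have h2 : (2 : ℝ≥0∞) = ENNReal.ofReal 2 := by simp
  rw [h2, ← ENNReal.ofReal_mul (by norm_num), ← ENNReal.ofReal_mul (by norm_num),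
    ← ENNReal.ofReal_add (by positivity) (by positivity)]
  refine ENNReal.ofReal_le_ofReal ?_
  have h3 : ‖(c - d) n‖ ^ 2 ≤ 2 * ‖c n‖ ^ 2 + 2 * ‖d n‖ ^ 2 := by
    rw [Pi.sub_apply]
    have := pow_le_pow_left₀ (norm_nonneg _) (norm_sub_le (c n) (d n)) 2
    nlinarith [sq_nonneg (‖c n‖ - ‖d n‖)]
  have h4 := mul_le_mul_of_nonneg_left h3
    (show 0 ≤ (2 * Real.pi) ^ 2 * (1 + freqSq n) ^ 2 by positivity)
  linarith

lemma MemPhaseSpace.sobolevNormSq_sub_lt_top {ε : ℝ} {φ : ℝ → ℝ} {f g : L2Torus}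
    (hf : MemPhaseSpace ε φ f) (hg : MemPhaseSpace ε φ g) :
    sobolevNormSq 2 (fourierCoeffs (f - g : L2Torus)) < ⊤ := by
  rw [fourierCoeffs_Lp_sub]
  exact (sobolevNormSq_two_sub_le _ _).trans_lt (ENNReal.add_lt_top.mpr
    ⟨ENNReal.mul_lt_top (by simp) hf.memH2, ENNReal.mul_lt_top (by simp) hg.memH2⟩)

/-! ### The energy estimate for increments of the solution. -/

/-- Everything the equation gives at a single time. -/
structure GoodTime (ε : ℝ) (φ : ℝ → ℝ) (u : Fin 2 → L2Torus) (f v : L2Torus) : Prop where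
  solves : SolvesAt ε φ u f v
  divFree : ∀ n : Freq, ∑ j, Complex.I * (n j : ℂ) * fourierCoeffs (u j) n = 0
  memH2 : ∀ j, sobolevNormSq 2 (fourierCoeffs (u j)) < ⊤

lemma ae_restrict_shift {T b h : ℝ} (hh : 0 ≤ h) (hT : b + h ≤ T) {p : ℝ → Prop}
    (hp : ∀ᵐ t ∂volume.restrict (Ioo 0 T), p t) :
    ∀ᵐ t ∂volume.restrict (Ioo 0 b), p t ∧ p (t + h) := by
  rw [ae_restrict_iff' measurableSet_Ioo] at hp ⊢
  have h2 := (measurePreserving_add_right (volume : Measure ℝ) h).quasiMeasurePreserving.ae hp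
  filter_upwards [hp, h2] with t h1 h2 ht
  exact ⟨h1 ⟨ht.1, by linarith [ht.2]⟩, h2 ⟨by linarith [ht.1], by linarith [ht.2]⟩⟩

/-- The energy estimate for increments in time. -/
lemma increment_estimate {ε : ℝ≥0} (hε : 0 < ε) {φ : ℝ → ℝ} {α : ℝ}
    (hφ : ∀ a ∈ Ioo (-1 : ℝ) 1, ∀ b ∈ Ioo (-1 : ℝ) 1,
      0 ≤ (φ a - φ b) * (a - b) + α * (a - b) ^ 2)
    {T b h K : ℝ} (hb : 0 ≤ b) (hh : 0 ≤ h) (hT : b + h < T)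
    {u u' : Fin 2 → ℝ → L2Torus} {θ θ' : ℝ → L2Torus}
    (hθ : IsTimeDerivOn (Ico 0 T) θ θ') (hphase : ∀ t ∈ Ico 0 T, MemPhaseSpace ε φ (θ t))
    (hu : ∀ j, IsTimeDerivOn (Icc 0 T) (u j) (u' j))
    (hgood : ∀ᵐ t ∂volume.restrict (Ioo 0 T), GoodTime ε φ (fun j => u j t) (θ t) (θ' t))
    (hK : 0 ≤ K)
    (hu2 : ∫⁻ t in Ioo 0 T, ∑ j, sobolevNormSq 2 (fourierCoeffs (u j t)) ≤ ENNReal.ofReal K)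
    (hu' : ∫⁻ t in Ioo 0 T, ∑ j, sobolevNormSq 0 (fourierCoeffs (u' j t)) ≤ ENNReal.ofReal K) :
    ENNReal.ofReal (‖energyMap ε (θ (b + h) - θ b)‖ ^ 2)
        + 2⁻¹ * ∫⁻ t in Ioc 0 b, sobolevNormSq 1 (fourierCoeffs (θ (t + h) - θ t : L2Torus))
      ≤ ENNReal.ofReal (Real.exp ((2 * α ^ 2 + 3) * T + 2 * sobolevConst * K)
        * (‖energyMap ε (θ h - θ 0)‖ ^ 2 + h ^ 2 * K)) := by
  have hT0 : 0 ≤ T := by linarith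
  have hbT : b ≤ T := by linarith
  have hres : ∀ c : ℝ, volume.restrict (Ioc (0 : ℝ) c) = volume.restrict (Ioo 0 c) :=
    fun c => Measure.restrict_congr_set Ioo_ae_eq_Ioc.symm
  rw [← hres T] at hu2 hu'
  have hsub : Ioc (0 : ℝ) b ⊆ Ioc 0 T := Ioc_subset_Ioc_right hbT
  set V : ℝ → L2Torus := fun t => θ (t + h) - θ t with hVdef
  have hV : IsTimeDerivOn (Icc 0 b) V (fun t => θ' (t + h) - θ' t) :=
    hθ.increment fun t ht => ⟨⟨ht.1, by linarith [ht.2]⟩,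
      ⟨by linarith [ht.1], by linarith [ht.2]⟩⟩
  have hW : ∀ j, IsTimeDerivOn (Icc 0 b) (fun t => u j (t + h) - u j t)
      (fun t => u' j (t + h) - u' j t) := fun j =>
    (hu j).increment fun t ht => ⟨⟨ht.1, by linarith [ht.2]⟩,
      ⟨by linarith [ht.1], by linarith [ht.2]⟩⟩
  have hum : ∀ j, AEStronglyMeasurable (u j) (volume.restrict (Ioc 0 b)) := fun j =>
    ((hu j).mono (Icc_subset_Icc_right hbT)).aestronglyMeasurable hb
  have hVm := hV.aestronglyMeasurable hb
  have hVfin : ∀ t ∈ Icc 0 b, sobolevNormSq 2 (fourierCoeffs (V t)) < ⊤ := fun t ht =>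
    (hphase (t + h) ⟨by linarith [ht.1], by linarith [ht.2]⟩).sobolevNormSq_sub_lt_top
      (hphase t ⟨ht.1, by linarith [ht.2]⟩)
  -- the Grönwall coefficient
  set S : ℝ → ℝ≥0∞ := fun t => ∑ j, sobolevNormSq 2 (fourierCoeffs (u j t)) with hS
  have hSm : AEMeasurable S (volume.restrict (Ioc 0 b)) :=
    Finset.aemeasurable_fun_sum _ fun j _ => (hum j).sobolevNormSq 2
  have hSle : ∫⁻ t in Ioc 0 b, S t ≤ ENNReal.ofReal K :=
    (lintegral_mono_set hsub).trans hu2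
  have hSint : Integrable (fun t => (S t).toReal) (volume.restrict (Ioc 0 b)) :=
    integrable_toReal_of_lintegral_ne_top hSm (hSle.trans_lt ENNReal.ofReal_lt_top).ne
  have hSintegral : ∫ t in Ioc 0 b, (S t).toReal ≤ K := by
    rw [integral_toReal hSm (ae_lt_top' hSm (hSle.trans_lt ENNReal.ofReal_lt_top).ne)]
    exact ENNReal.toReal_le_of_le_ofReal hK hSle
  set k : ℝ → ℝ := fun t => 2 * α ^ 2 + 3 + 2 * (sobolevConst * (S t).toReal) with hk
  have hki : IntervalIntegrable k volume 0 b := by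
    rw [intervalIntegrable_iff_integrableOn_Ioc_of_le hb]
    exact (integrable_const _).add ((hSint.const_mul _).const_mul _)
  -- The Grönwall exponent is bounded through `‖u‖²_{L²(H²)}`, independently of `b`, `h` and `ε`.
  have hkle : ∫ t in 0..b, k t ≤ (2 * α ^ 2 + 3) * T + 2 * sobolevConst * K := by
    rw [intervalIntegral.integral_of_le hb, integral_add (integrable_const _)
      ((hSint.const_mul _).const_mul _), integral_const_mul, integral_const_mul, integral_const]
    have h1 := mul_le_mul_of_nonneg_left hSintegral sobolevConst_nonneg
    have h2 : (2 * α ^ 2 + 3) * b ≤ (2 * α ^ 2 + 3) * T :=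
      mul_le_mul_of_nonneg_left hbT (by positivity)
    simp only [measureReal_restrict_apply_univ, Real.volume_real_Ioc_of_le hb, sub_zero,
      smul_eq_mul]
    linarith
  -- the forcing
  set g : ℝ → ℝ := fun t => ∑ j, ‖u j (t + h) - u j t‖ ^ 2 with hg
  have hgc : ContinuousOn g (Icc 0 b) :=
    continuousOn_finsetSum _ fun j _ => (((hW j).continuousOn hb).norm.pow 2)
  have hgi : IntervalIntegrable g volume 0 b := by
    refine ContinuousOn.intervalIntegrable ?_
    rwa [uIcc_of_le hb]
  have hgle : ∫ t in 0..b, g t ≤ h ^ 2 * K := by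
    rw [intervalIntegral.integral_of_le hb]
    rw [integral_eq_lintegral_of_nonneg_ae
      (Eventually.of_forall fun t => Finset.sum_nonneg fun j _ => sq_nonneg _)
      ((intervalIntegrable_iff_integrableOn_Ioc_of_le hb).mp hgi).aestronglyMeasurable]
    refine ENNReal.toReal_le_of_le_ofReal (by positivity) ?_
    have e1 : ∀ t, ENNReal.ofReal (g t) = ∑ j, ‖u j (t + h) - u j t‖ₑ ^ 2 := fun t => by
      rw [hg, ENNReal.ofReal_sum_of_nonneg fun j _ => sq_nonneg _]
      refine Finset.sum_congr rfl fun j _ => ?_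
      rw [ENNReal.ofReal_pow (norm_nonneg _), ofReal_norm]
    rw [lintegral_congr e1]
    rw [lintegral_finsetSum' _ fun j _ =>
      (((hW j).aestronglyMeasurable hb).enorm.pow_const 2)]
    refine (Finset.sum_le_sum fun j _ =>
      (hu j).lintegral_increment_le hh hb hT.le).trans ?_
    rw [← Finset.mul_sum, ENNReal.ofReal_mul (by positivity)]
    refine mul_le_mul_right ?_ _
    simp only [sobolevNormSq_zero_enorm] at hu'
    rw [lintegral_finsetSum' _ fun j _ =>
      (((hu j).aestronglyMeasurable_deriv hT0).enorm.pow_const 2)] at hu'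
    exact hu'
  -- the dissipation
  set D : ℝ → ℝ := fun t => (1 / 2) * (sobolevNormSq 1 (fourierCoeffs (V t))).toReal with hD
  have hDm : AEStronglyMeasurable D (volume.restrict (Ioc 0 b)) :=
    ((hVm.sobolevNormSq 1).ennreal_toReal.const_mul _).aestronglyMeasurable
  have hder := hV.ae_hasDerivAt hb
  have hac := hV.absolutelyContinuous_norm_sq (energyMap ε) hb
  have hineq : ∀ᵐ t ∂volume.restrict (Ioo 0 b),
      2 * (inner ℂ (energyMap ε (V t)) (energyMap ε (θ' (t + h) - θ' t))).re + D t
        ≤ k t * ‖energyMap ε (V t)‖ ^ 2 + g t := by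
    -- The equation must hold at both `t` and `t + h`; translation preserves null sets.
    filter_upwards [ae_restrict_shift hh hT.le hgood, ae_restrict_mem measurableSet_Ioo]
      with t ht htI
    have h1 := SolvesAt.energy_inequality hε hφ ht.1.solves ht.2.solves ht.1.divFree ht.2.divFree
      ht.1.memH2 (hphase t ⟨htI.1.le, by linarith [htI.2]⟩)
      (hphase (t + h) ⟨by linarith [htI.1], by linarith [htI.2]⟩)
    have h2 : (S t).toReal = ∑ j, (sobolevNormSq 2 (fourierCoeffs (u j t))).toReal :=
      ENNReal.toReal_sum fun j _ => (ht.1.memH2 j).ne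
    simp only [hk, hg, hD, h2]
    exact h1
  obtain ⟨hDi, hgr⟩ := gronwall_dissipation hb hac
    (hder.mono fun t ht => hasDerivAt_norm_sq_energyMap ε ht) hineq hki
    (fun t => by have := sobolevConst_nonneg; positivity) hgi
    (fun t => Finset.sum_nonneg fun j _ => sq_nonneg _) hDm (fun t => by positivity)
  have hDe : 2⁻¹ * ∫⁻ t in Ioc 0 b, sobolevNormSq 1 (fourierCoeffs (V t))
      = ENNReal.ofReal (∫ t in 0..b, D t) := by
    rw [intervalIntegral.integral_of_le hb, ofReal_integral_eq_lintegral_ofReal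
      ((intervalIntegrable_iff_integrableOn_Ioc_of_le hb).mp hDi)
      (Eventually.of_forall fun t => by positivity),
      ← lintegral_const_mul' _ _ (by simp)]
    refine setLIntegral_congr_fun measurableSet_Ioc fun t ht => ?_
    -- Finiteness is needed so that passing to real numbers in `D` loses nothing.
    have hfin : sobolevNormSq 1 (fourierCoeffs (V t)) ≠ ⊤ :=
      ((sobolevNormSq_mono (by norm_num) _).trans_lt (hVfin t (Ioc_subset_Icc_self ht))).ne
    simp only [hD]
    rw [ENNReal.ofReal_mul (by norm_num), ENNReal.ofReal_toReal hfin, one_div,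
      ENNReal.ofReal_inv_of_pos (by norm_num)]
    simp
  rw [hDe, ← ENNReal.ofReal_add (by positivity)
    (intervalIntegral.integral_nonneg hb fun t _ => by positivity)]
  refine ENNReal.ofReal_le_ofReal (hgr.trans ?_)
  simp only [hVdef, zero_add]
  refine mul_le_mul (Real.exp_le_exp.mpr hkle) (by linarith) ?_ (Real.exp_pos _).le
  exact add_nonneg (sq_nonneg _) (intervalIntegral.integral_nonneg hb fun t _ =>
    Finset.sum_nonneg fun j _ => sq_nonneg _)

/-! ### From increments to velocity and phase velocity. -/

lemma velocityEnergy_neg {ε : ℝ} (hε : 0 ≤ ε) (c : Freq → ℂ) :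
    velocityEnergy ε (-c) = velocityEnergy ε c := by
  simp only [velocityEnergy_eq hε, Pi.neg_apply, norm_neg]

lemma velocityEnergy_sub_comm {ε : ℝ} (hε : 0 ≤ ε) (c d : Freq → ℂ) :
    velocityEnergy ε (c - d) = velocityEnergy ε (d - c) := by
  rw [← velocityEnergy_neg hε, neg_sub]

/-- If `d` has energy at most `A` and `c - d` has energy at most `B`, then `c` has energy at most
`2A + 2B`. -/
lemma velocityEnergy_le_of_sub_le {ε : ℝ} (hε : 0 ≤ ε) {c d : Freq → ℂ} {A B : ℝ} (hA : 0 ≤ A)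
    (hB : 0 ≤ B) (hd : velocityEnergy ε d ≤ ENNReal.ofReal A)
    (hcd : velocityEnergy ε (c - d) ≤ ENNReal.ofReal B) :
    velocityEnergy ε c ≤ ENNReal.ofReal (2 * A + 2 * B) := by
  have h := velocityEnergy_add_le hε d (c - d)
  rw [add_sub_cancel] at h
  refine h.trans ?_
  rw [ENNReal.ofReal_add (by positivity) (by positivity), ENNReal.ofReal_mul (by norm_num),
    ENNReal.ofReal_mul (by norm_num), ENNReal.ofReal_ofNat]
  gcongr

lemma velocityEnergy_le_phaseNormSq (ε : ℝ) (φ : ℝ → ℝ) (f : L2Torus) :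
    velocityEnergy ε (phaseVelocity ε φ f) ≤ phaseNormSq ε φ f := by
  rw [phaseNormSq, add_assoc]
  exact le_add_self

lemma velocityEnergy_le_phaseDistSq (ε : ℝ) (φ : ℝ → ℝ) (f g : L2Torus) :
    velocityEnergy ε (phaseVelocity ε φ f - phaseVelocity ε φ g) ≤ phaseDistSq ε φ f g := by
  rw [phaseDistSq, add_assoc]
  exact le_add_self

lemma sobolevNormSq_smul (s r : ℝ) (c : Freq → ℂ) :
    sobolevNormSq s ((r : ℂ) • c) = ENNReal.ofReal (r ^ 2) * sobolevNormSq s c := by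
  rw [sobolevNormSq, sobolevNormSq, ← ENNReal.tsum_mul_left]
  refine tsum_congr fun n => ?_
  rw [← ENNReal.ofReal_mul (sq_nonneg r), Pi.smul_apply, smul_eq_mul, norm_mul, Complex.norm_real,
    Real.norm_eq_abs, mul_pow |r|, sq_abs]
  congr 1
  ring

/-- The derivative is only locally integrable up to `T`, so the half-open interval is exhausted by
countably many compact ones. -/
lemma IsTimeDerivOn.ae_hasDerivAt_Ico {T : ℝ} (hT : 0 < T) {V V' : ℝ → L2Torus}
    (h : IsTimeDerivOn (Ico 0 T) V V') :
    ∀ᵐ t ∂volume.restrict (Ioo 0 T), HasDerivAt V (V' t) t := by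
  have hn : ∀ n : ℕ, ∀ᵐ t ∂(volume : Measure ℝ), t ∈ Ioo 0 (max 0 (T - 1 / (n + 1))) →
      HasDerivAt V (V' t) t := fun n => by
    rw [← ae_restrict_iff' measurableSet_Ioo]
    refine (h.mono (Icc_subset_Ico_right (max_lt hT ?_))).ae_hasDerivAt (le_max_left _ _)
    have : (0 : ℝ) < 1 / (n + 1) := by positivity
    linarith
  rw [ae_restrict_iff' measurableSet_Ioo]
  filter_upwards [ae_all_iff.mpr hn] with t ht htI
  obtain ⟨n, hn⟩ := exists_nat_one_div_lt (sub_pos.mpr htI.2)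
  exact ht n ⟨htI.1, lt_max_of_lt_right (by linarith)⟩

/-- If the difference quotients of a curve satisfy a uniform energy bound, then so does the
derivative. -/
lemma energy_bounds_of_increment {ε : ℝ≥0} {T h₀ C : ℝ} (hT : 0 < T) (hh₀ : 0 < h₀) (hC : 0 ≤ C)
    {θ θ' : ℝ → L2Torus} (hθ : IsTimeDerivOn (Ico 0 T) θ θ')
    (hinc : ∀ b h : ℝ, 0 ≤ b → 0 < h → h < h₀ → b + h < T →
      ENNReal.ofReal (‖energyMap ε (θ (b + h) - θ b)‖ ^ 2)
        + 2⁻¹ * ∫⁻ t in Ioc 0 b, sobolevNormSq 1 (fourierCoeffs (θ (t + h) - θ t : L2Torus))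
      ≤ ENNReal.ofReal (h ^ 2 * C)) :
    (∀ᵐ t ∂volume.restrict (Ioo 0 T),
        velocityEnergy ε (fourierCoeffs (θ' t)) ≤ ENNReal.ofReal C) ∧
      ∀ b ∈ Ico 0 T, ∫⁻ t in Ioc 0 b, sobolevNormSq 1 (fourierCoeffs (θ' t))
        ≤ ENNReal.ofReal (2 * C) := by
  have hderiv := hθ.ae_hasDerivAt_Ico hT
  have hquot : ∀ t, HasDerivAt θ (θ' t) t →
      Tendsto (fun h : ℝ => h⁻¹ • (θ (t + h) - θ t)) (𝓝[>] 0) (𝓝 (θ' t)) := fun t ht =>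
    (hasDerivAt_iff_tendsto_slope_zero.mp ht).mono_left
      (nhdsWithin_mono _ fun x (hx : 0 < x) => hx.ne')
  refine ⟨?_, fun b hb => ?_⟩
  · filter_upwards [hderiv, ae_restrict_mem measurableSet_Ioo] with t ht htI
    rw [velocityEnergy_fourierCoeffs]
    refine ENNReal.ofReal_le_ofReal ?_
    have hlim : Tendsto (fun h : ℝ => ‖energyMap ε (h⁻¹ • (θ (t + h) - θ t))‖ ^ 2) (𝓝[>] 0)
        (𝓝 (‖energyMap ε (θ' t)‖ ^ 2)) :=
      (((energyMap ε).continuous.tendsto _).comp (hquot t ht)).norm.pow 2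
    refine le_of_tendsto hlim ?_
    have hmem : Ioo (0 : ℝ) (min h₀ (T - t)) ∈ 𝓝[>] (0 : ℝ) :=
      Ioo_mem_nhdsGT (lt_min hh₀ (sub_pos.mpr htI.2))
    filter_upwards [hmem] with h hh
    have h1 := le_trans le_self_add (hinc t h htI.1.le hh.1 (hh.2.trans_le (min_le_left _ _))
      (by linarith [hh.2.trans_le (min_le_right h₀ (T - t))]))
    have hh0 : 0 < h ^ 2 := by have := hh.1; positivity
    rw [ENNReal.ofReal_le_ofReal_iff (by positivity)] at h1
    rw [map_smul, norm_smul, mul_pow, norm_inv, Real.norm_eq_abs, inv_pow, sq_abs,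
      inv_mul_le_iff₀ hh0]
    exact h1
  -- Halving keeps every step `η n ≤ h₁` strictly below `h₀` and keeps `b + η n < T`.
  · set h₁ : ℝ := min h₀ (T - b) / 2 with hh₁
    have hm : 0 < min h₀ (T - b) := lt_min hh₀ (sub_pos.mpr hb.2)
    have hh₁0 : 0 < h₁ := by positivity
    set η : ℕ → ℝ := fun n => h₁ / (n + 1) with hη
    have hη0 : ∀ n, 0 < η n := fun n => by positivity
    have hηle : ∀ n, η n ≤ h₁ := fun n => div_le_self hh₁0.le (by linarith [n.cast_nonneg (α := ℝ)])
    have hη1 : ∀ n, η n < h₀ := fun n => by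
      linarith [hηle n, min_le_left h₀ (T - b)]
    have hη2 : ∀ n, b + η n < T := fun n => by
      linarith [hηle n, min_le_right h₀ (T - b)]
    have hηlim : Tendsto η atTop (𝓝[>] 0) := by
      refine tendsto_nhdsWithin_iff.mpr ⟨?_, Eventually.of_forall hη0⟩
      have := (tendsto_one_div_add_atTop_nhds_zero_nat (𝕜 := ℝ)).const_mul h₁
      simpa [hη, div_eq_mul_inv] using this
    set F : ℕ → ℝ → ℝ≥0∞ := fun n t =>
      sobolevNormSq 1 (fourierCoeffs ((η n)⁻¹ • (θ (t + η n) - θ t) : L2Torus)) with hF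
    have hFm : ∀ n, AEMeasurable (F n) (volume.restrict (Ioc 0 b)) := fun n => by
      have hV : IsTimeDerivOn (Icc 0 b) (fun t => θ (t + η n) - θ t)
          (fun t => θ' (t + η n) - θ' t) :=
        hθ.increment fun t ht => ⟨⟨ht.1, by linarith [ht.2, hb.2]⟩,
          ⟨by linarith [ht.1, hη0 n], by linarith [ht.2, hη2 n]⟩⟩
      exact ((hV.aestronglyMeasurable hb.1).const_smul ((η n)⁻¹)).sobolevNormSq 1
    have hFle : ∀ n, ∫⁻ t in Ioc 0 b, F n t ≤ ENNReal.ofReal (2 * C) := fun n => by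
      have h1 := le_trans le_add_self (hinc b (η n) hb.1 (hη0 n) (hη1 n) (hη2 n))
      have h2 : ∀ t, F n t = ENNReal.ofReal ((η n)⁻¹ ^ 2)
          * sobolevNormSq 1 (fourierCoeffs (θ (t + η n) - θ t : L2Torus)) := fun t => by
        simp only [hF]
        rw [fourierCoeffs_Lp_smul, sobolevNormSq_smul]
      rw [lintegral_congr h2, lintegral_const_mul' _ _ ENNReal.ofReal_ne_top]
      set I := ∫⁻ t in Ioc 0 b, sobolevNormSq 1 (fourierCoeffs (θ (t + η n) - θ t : L2Torus))
      have h3 : I ≤ 2 * ENNReal.ofReal (η n ^ 2 * C) := by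
        calc I = 2 * (2⁻¹ * I) := by
              rw [← mul_assoc, ENNReal.mul_inv_cancel (by norm_num) (by norm_num), one_mul]
          _ ≤ _ := by gcongr
      refine (mul_le_mul_right h3 _).trans_eq ?_
      rw [show (2 : ℝ≥0∞) = ENNReal.ofReal 2 by simp, ← ENNReal.ofReal_mul (by norm_num),
        ← ENNReal.ofReal_mul (by positivity)]
      congr 1
      have := (hη0 n).ne'
      field_simp
    have hres : volume.restrict (Ioc (0 : ℝ) b) = volume.restrict (Ioo 0 b) :=
      Measure.restrict_congr_set Ioo_ae_eq_Ioc.symm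
    -- Difference quotients converge in `L²` at almost every time, and the `H¹` norm is lower
    -- semicontinuous there; Fatou then passes to the integral.
    have hlsc : ∀ᵐ t ∂volume.restrict (Ioc 0 b),
        sobolevNormSq 1 (fourierCoeffs (θ' t)) ≤ liminf (fun n => F n t) atTop := by
      rw [hres]
      filter_upwards [ae_restrict_of_ae_restrict_of_subset (Ioo_subset_Ioo_right hb.2.le) hderiv]
        with t ht
      have h1 := lowerSemicontinuousAt_iff_le_liminf.mp
        (lowerSemicontinuous_sobolevNormSq 1 (θ' t))
      refine h1.trans ?_
      exact liminf_le_liminf_of_le ((hquot t ht).comp hηlim)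
    calc ∫⁻ t in Ioc 0 b, sobolevNormSq 1 (fourierCoeffs (θ' t))
        ≤ ∫⁻ t in Ioc 0 b, liminf (fun n => F n t) atTop := lintegral_mono_ae hlsc
      _ ≤ liminf (fun n => ∫⁻ t in Ioc 0 b, F n t) atTop := lintegral_liminf_le' hFm
      _ ≤ ENNReal.ofReal (2 * C) :=
        liminf_le_of_le (by isBoundedDefault) fun c hc => by
          obtain ⟨n, hn⟩ := hc.exists
          exact hn.trans (hFle n)

/-- The first increment is controlled by the initial phase velocity and the drift. -/
lemma initial_increment_le {ε : ℝ≥0} (hε : 0 < ε) {φ : ℝ → ℝ} {T K R : ℝ} (hT : 0 < T)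
    {u : Fin 2 → ℝ → L2Torus} {θ θ' : ℝ → L2Torus} (hK : 0 ≤ K) (hR : 0 ≤ R)
    (hθ : IsTimeDerivOn (Ico 0 T) θ θ') (hcont : ContinuousIntoPhaseSpace ε φ T θ)
    (hgood : ∀ᵐ t ∂volume.restrict (Ioo 0 T), GoodTime ε φ (fun j => u j t) (θ t) (θ' t))
    (huK : ∀ᵐ t ∂volume.restrict (Ioo 0 T), ∑ j, ‖u j t‖ ^ 2 ≤ K)
    (hinit : velocityEnergy ε (phaseVelocity ε φ (θ 0)) ≤ ENNReal.ofReal R) :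
    ∃ h₀ > 0, ∀ h, 0 < h → h < h₀ → h < T →
      ‖energyMap ε (θ h - θ 0)‖ ^ 2 ≤ h ^ 2 * (2 * (2 * R + 2) + 2 * K) := by
  have h0 : (0 : ℝ) ∈ Ico 0 T := ⟨le_rfl, hT⟩
  have hnear := (hcont 0 h0).2.eventually (eventually_le_nhds (b := (1 : ℝ≥0∞)) one_pos)
  rw [eventually_nhdsWithin_iff] at hnear
  obtain ⟨h₀, hh₀, hball⟩ := Metric.eventually_nhds_iff.mp hnear
  refine ⟨h₀, hh₀, fun h hh hh' hhT => ?_⟩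
  -- Two uses of `‖c+d‖² ≤ 2‖c‖² + 2‖d‖²`: from `θ(0)` to `θ(t)`, at phase distance at most `1`, and
  -- then from phase velocity to velocity, at cost `K`.
  set Y := 2 * (2 * R + 2) + 2 * K with hY
  have hY0 : 0 ≤ Y := by positivity
  have hbound : ∀ᵐ t ∂volume.restrict (Ioo 0 h), ‖energyMap ε (θ' t)‖ ≤ √Y := by
    have hsub : Ioo 0 h ⊆ Ioo 0 T := Ioo_subset_Ioo_right hhT.le
    filter_upwards [ae_restrict_of_ae_restrict_of_subset hsub hgood,
      ae_restrict_of_ae_restrict_of_subset hsub huK, ae_restrict_mem measurableSet_Ioo]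
      with t hg hu htI
    have htT : t ∈ Ico 0 T := ⟨htI.1.le, htI.2.trans hhT⟩
    have hd : phaseDistSq ε φ (θ t) (θ 0) ≤ ENNReal.ofReal 1 := by
      rw [ENNReal.ofReal_one]
      refine hball ?_ htT
      rw [Real.dist_eq, sub_zero, abs_of_pos htI.1]
      exact htI.2.trans hh'
    have h1 := velocityEnergy_le_of_sub_le ε.coe_nonneg hR zero_le_one hinit
      ((velocityEnergy_le_phaseDistSq ε φ (θ t) (θ 0)).trans hd)
    have h2 := hg.solves.velocityEnergy_sub_le (NNReal.coe_pos.mpr hε) hg.divFree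
      (hcont t htT).1.abs_le_one
    rw [velocityEnergy_sub_comm ε.coe_nonneg] at h2
    have h3 := velocityEnergy_le_of_sub_le ε.coe_nonneg (by positivity) hK h1
      (h2.trans (ENNReal.ofReal_le_ofReal hu))
    rw [velocityEnergy_fourierCoeffs, ENNReal.ofReal_le_ofReal_iff (by positivity)] at h3
    refine Real.le_sqrt_of_sq_le ?_
    rw [hY]
    linarith
  have hd := hθ 0 h0 h ⟨hh.le, hhT⟩
  have hres : volume.restrict (Ioc (0 : ℝ) h) = volume.restrict (Ioo 0 h) :=
    Measure.restrict_congr_set Ioo_ae_eq_Ioc.symm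
  -- The bounded operator `energyMap` passes under the time integral of `θ'`.
  have hnorm : ‖energyMap ε (θ h - θ 0)‖ ≤ √Y * |h - 0| := by
    rw [hd.2, ← ContinuousLinearMap.intervalIntegral_comp_comm _ hd.1]
    refine intervalIntegral.norm_integral_le_of_norm_le_const_ae ?_
    rw [← hres, ae_restrict_iff' measurableSet_Ioc] at hbound
    rw [uIoc_of_le hh.le]
    exact hbound
  refine (pow_le_pow_left₀ (norm_nonneg _) hnorm 2).trans_eq ?_
  rw [sub_zero, mul_pow, sq_abs, Real.sq_sqrt hY0, mul_comm]

/-- A bound on the velocity at almost every time gives a bound on the phase velocity at every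
time. -/
lemma phaseVelocity_energy_le {ε : ℝ≥0} (hε : 0 < ε) {φ : ℝ → ℝ} {T K C : ℝ}
    {u : Fin 2 → ℝ → L2Torus} {θ θ' : ℝ → L2Torus} (hK : 0 ≤ K) (hC : 0 ≤ C)
    (hcont : ContinuousIntoPhaseSpace ε φ T θ)
    (hgood : ∀ᵐ t ∂volume.restrict (Ioo 0 T), GoodTime ε φ (fun j => u j t) (θ t) (θ' t))
    (huK : ∀ᵐ t ∂volume.restrict (Ioo 0 T), ∑ j, ‖u j t‖ ^ 2 ≤ K)
    (hvel : ∀ᵐ t ∂volume.restrict (Ioo 0 T),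
      velocityEnergy ε (fourierCoeffs (θ' t)) ≤ ENNReal.ofReal C) {t : ℝ} (ht : t ∈ Ico 0 T) :
    velocityEnergy ε (phaseVelocity ε φ (θ t))
      ≤ ENNReal.ofReal (2 * (2 * C + 2 * K) + 2 * 1) := by
  have hnear := (hcont t ht).2.eventually (eventually_le_nhds (b := (1 : ℝ≥0∞)) one_pos)
  rw [eventually_nhdsWithin_iff] at hnear
  obtain ⟨δ, hδ, hball⟩ := Metric.eventually_nhds_iff.mp hnear
  have hlt : t < min (t + δ) T := lt_min (by linarith) ht.2
  have hsub : Ioo t (min (t + δ) T) ⊆ Ioo 0 T := Ioo_subset_Ioo ht.1 (min_le_right _ _)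
  -- Every right neighbourhood of `t` has positive measure, so it contains a time `s` at which all
  -- almost-everywhere facts hold; the bound is carried from `s` to `t` at phase distance at most
  -- `1`.
  have : NeBot (ae (volume.restrict (Ioo t (min (t + δ) T)))) := by
    rw [ae_neBot, ne_eq, Measure.restrict_eq_zero, Real.volume_Ioo, ENNReal.ofReal_eq_zero]
    linarith
  obtain ⟨s, hg, hu, hv, hsI⟩ := ((ae_restrict_of_ae_restrict_of_subset hsub hgood).and
    ((ae_restrict_of_ae_restrict_of_subset hsub huK).and
      ((ae_restrict_of_ae_restrict_of_subset hsub hvel).and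
        (ae_restrict_mem measurableSet_Ioo)))).exists
  have hsT : s ∈ Ico 0 T := Ioo_subset_Ico_self (hsub hsI)
  have hd : phaseDistSq ε φ (θ s) (θ t) ≤ ENNReal.ofReal 1 := by
    rw [ENNReal.ofReal_one]
    refine hball ?_ hsT
    rw [Real.dist_eq, abs_of_pos (sub_pos.mpr hsI.1)]
    linarith [hsI.2.trans_le (min_le_left (t + δ) T)]
  have h2 := hg.solves.velocityEnergy_sub_le (NNReal.coe_pos.mpr hε) hg.divFree
      (hcont s hsT).1.abs_le_one
  have h1 := velocityEnergy_le_of_sub_le ε.coe_nonneg hC hK hv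
    (h2.trans (ENNReal.ofReal_le_ofReal hu))
  have h3 := (velocityEnergy_le_phaseDistSq ε φ (θ s) (θ t)).trans hd
  rw [velocityEnergy_sub_comm ε.coe_nonneg] at h3
  exact velocityEnergy_le_of_sub_le ε.coe_nonneg (by positivity) zero_le_one h1 h3

/-! ### Assembly of the uniform bound. -/

theorem lemma5p1 (Φ : ℝ → ℝ) (hΦ : IsSingularPotential Φ) :
    ∃ C : ℝ≥0 → ℝ≥0 → ℝ → ℝ≥0,
      ∀ (R K : ℝ≥0) (T : ℝ), 0 < T →
      ∀ ε ∈ Ioc (0 : ℝ) 1,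
      ∀ (θ₀ : L2Torus) (δ₀ : ℝ) (u u' : Fin 2 → ℝ → L2Torus) (θ θ' : ℝ → L2Torus),
        MemPhaseSpace ε (deriv Φ) θ₀ →
        phaseNormSq ε (deriv Φ) θ₀ ≤ (R : ℝ≥0∞) ^ 2 →
        δ₀ ∈ Ioo (0 : ℝ) 1 →
        (∀ᵐ x, |θ₀ x| ≤ 1 - δ₀) →
        (∀ j, IsTimeDerivOn (Icc 0 T) (u j) (u' j)) →
        velocityNormSq T u u' ≤ (K : ℝ≥0∞) ^ 2 →
        IsDivFree T u →
        IsWeakSolution ε (deriv Φ) T u θ₀ θ θ' →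
        (∀ᵐ t ∂volume.restrict (Ioo 0 T), ∀ᵐ x, |θ t x| ≤ 1) →
        ContinuousIntoPhaseSpace ε (deriv Φ) T θ →
        (∀ t ∈ Ico 0 T, ∫⁻ τ in Ioc 0 t, sobolevNormSq 1 (fourierCoeffs (θ' τ)) < ⊤) →
        (∀ t ∈ Ico 0 T,
          (⨆ τ ∈ Icc 0 t, phaseNormSq ε (deriv Φ) (θ τ))
            + ∫⁻ τ in Ioc 0 t, sobolevNormSq 1 (fourierCoeffs (θ' τ)) ≤ C R K T) ∧
        (∀ᵐ t ∂volume.restrict (Ioo 0 T),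
          ENNReal.ofReal ε * sobolevNormSq 0 (fourierCoeffs (θ' t))
            + homSobolevNormSq (-1) (fourierCoeffs (θ' t)) ≤ C R K T) := by
  obtain ⟨α, hα, hmono⟩ := hΦ.exists_semimonotone
  obtain ⟨E, hE⟩ := hΦ.exists_phaseNormSq_le
  -- the bound on the energy of `∂_t θ`
  set B : ℝ≥0 → ℝ≥0 → ℝ → ℝ := fun R K T =>
    Real.exp ((2 * α ^ 2 + 3) * T + 2 * sobolevConst * (K : ℝ) ^ 2)
      * (2 * (2 * (R : ℝ) ^ 2 + 2) + 2 * (K : ℝ) ^ 2 + (K : ℝ) ^ 2) with hBdef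
  have hB : ∀ R K T, 0 ≤ B R K T := fun R K T => by positivity
  -- The argument of `E` is the bound on the phase velocity at every time; `2B` bounds the
  -- dissipation integral and also dominates the pointwise velocity bound `B`.
  refine ⟨fun R K T => (E (2 * (2 * B R K T + 2 * (K : ℝ) ^ 2) + 2 * 1)).toNNReal
    + (2 * B R K T).toNNReal, fun R K T hT ε hε θ₀ δ₀ u u' θ θ' _ hR _ _ hu hK hdiv hsol
      _ hcont _ => ?_⟩
  obtain ⟨ε, rfl⟩ : ∃ e : ℝ≥0, (e : ℝ) = ε := ⟨⟨ε, hε.1.le⟩, rfl⟩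
  have hε0 : 0 < ε := by exact_mod_cast hε.1
  have hofR : ∀ r : ℝ≥0, (r : ℝ≥0∞) ^ 2 = ENNReal.ofReal ((r : ℝ) ^ 2) := fun r => by
    rw [ENNReal.ofReal_pow r.coe_nonneg, ENNReal.ofReal_coe_nnreal]
  rw [hofR] at hR hK
  have hK0 : (0 : ℝ) ≤ (K : ℝ) ^ 2 := sq_nonneg _
  have hK1 := (le_self_add.trans le_self_add).trans hK
  have hK2 := (le_add_self.trans le_self_add).trans hK
  have hK3 := le_add_self.trans hK
  have huK : ∀ᵐ t ∂volume.restrict (Ioo 0 T), ∑ j, ‖u j t‖ ^ 2 ≤ (K : ℝ) ^ 2 := by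
    filter_upwards [ENNReal.ae_le_essSup (μ := volume.restrict (Ioo 0 T))
      (fun t => ∑ j, sobolevNormSq 1 (fourierCoeffs (u j t)))] with t ht
    have h1 := ht.trans hK1
    have h2 : ∑ j, sobolevNormSq 0 (fourierCoeffs (u j t))
        ≤ ∑ j, sobolevNormSq 1 (fourierCoeffs (u j t)) :=
      Finset.sum_le_sum fun j _ => sobolevNormSq_mono zero_le_one _
    have h3 := h2.trans h1
    simp only [sobolevNormSq_zero_L2Torus] at h3
    rwa [← ENNReal.ofReal_sum_of_nonneg fun j _ => sq_nonneg _,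
      ENNReal.ofReal_le_ofReal_iff hK0] at h3
  have hgood : ∀ᵐ t ∂volume.restrict (Ioo 0 T),
      GoodTime ε (deriv Φ) (fun j => u j t) (θ t) (θ' t) := by
    have hmeas : AEMeasurable (fun t => ∑ j, sobolevNormSq 2 (fourierCoeffs (u j t)))
        (volume.restrict (Ioo 0 T)) := by
      rw [Measure.restrict_congr_set Ioo_ae_eq_Ioc]
      exact Finset.aemeasurable_fun_sum _ fun j _ =>
        ((hu j).aestronglyMeasurable hT.le).sobolevNormSq 2
    filter_upwards [hsol.equation, hdiv,
      ae_lt_top' hmeas (hK2.trans_lt ENNReal.ofReal_lt_top).ne] with t h1 h2 h3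
    exact ⟨h1, h2, fun j => ENNReal.sum_lt_top.mp h3 j (Finset.mem_univ j)⟩
  have hinit : velocityEnergy ε (phaseVelocity ε (deriv Φ) (θ 0))
      ≤ ENNReal.ofReal ((R : ℝ) ^ 2) := by
    rw [hsol.initial]
    exact (velocityEnergy_le_phaseNormSq _ _ _).trans hR
  obtain ⟨h₀, hh₀, hfirst⟩ := initial_increment_le hε0 hT hK0 (sq_nonneg (R : ℝ)) hsol.timeDeriv
    hcont hgood huK hinit
  obtain ⟨hvel, hdiss⟩ := energy_bounds_of_increment (ε := ε) hT hh₀ (hB R K T) hsol.timeDeriv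
    fun b h hb hh hh' hbT => by
      refine (increment_estimate hε0 hmono hb hh.le hbT hsol.timeDeriv (fun t ht => (hcont t ht).1)
        hu hgood hK0 hK2 hK3).trans (ENNReal.ofReal_le_ofReal ?_)
      have h1 := hfirst h hh hh' (by linarith)
      calc _ ≤ Real.exp ((2 * α ^ 2 + 3) * T + 2 * sobolevConst * (K : ℝ) ^ 2)
            * (h ^ 2 * (2 * (2 * (R : ℝ) ^ 2 + 2) + 2 * (K : ℝ) ^ 2) + h ^ 2 * (K : ℝ) ^ 2) := by
            gcongr
        _ = h ^ 2 * B R K T := by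
            rw [hBdef]
            ring
  have hA0 : 0 ≤ 2 * (2 * B R K T + 2 * (K : ℝ) ^ 2) + 2 * 1 := by
    have := hB R K T
    positivity
  refine ⟨fun t ht => ?_, ?_⟩
  · rw [ENNReal.coe_add]
    refine add_le_add (iSup₂_le fun τ hτ => ?_) (hdiss t ht)
    have hτT : τ ∈ Ico 0 T := ⟨hτ.1, hτ.2.trans_lt ht.2⟩
    exact hE ε hε _ hA0 (θ τ) (hcont τ hτT).1
      (phaseVelocity_energy_le hε0 hK0 (hB R K T) hcont hgood huK hvel hτT)
  · filter_upwards [hvel] with t ht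
    refine ht.trans ((ENNReal.ofReal_le_ofReal (q := 2 * B R K T) ?_).trans ?_)
    · linarith [hB R K T]
    · rw [ENNReal.coe_add]
      exact le_add_self
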